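/- **Conventions.** Let $\lambda$ be a Dyck path from $(0,0)$ to $(2n,0)$ with steps $U=(1,1)$ and $D=(1,-1)$, staying weakly above $y=0$. A box is a unit diamond with centre $(x,y)$, $x+y$ odd, and corners $(x\pm1,y),(x,y\pm1)$. An edge of the planted plane tree $\mathrm{Tree}(\lambda)$ is an up step $u$ of $\lambda$ together with its matching down step $d$; an edge is above another if its pair of steps encloses the other pair, and strictly left of another if both its steps precede both steps of the other. A natural label $T$ of $\mathrm{Tree}(\lambda)$ is a bijection from the edges to $\{1,\dots,n\}$ that increases from the root to the leaves; $e_i$ is the edge labelled $i$. **Dyck tilings.** A Dyck tile is a ribbon whose box centres form a translated Dyck path (a single box is the trivial one). A Dyck tiling is a tiling by Dyck tiles of the skew shape between a lower Dyck path and an upper Dyck path of the same length. It is cover-inclusive if each tile, translated by $(0,-2)$, is below the lower path or contained in another tile. **$\mathrm{DTR}$.** Let $h_i=2\cdot\#\{e' \text{ strictly left of } e_i \text{ with label}<i\}+\#\{e'\text{ above }e_i\}$. Start with the empty tiling of size $0$; for $i=1,\dots,n$ perform the spread at $x=h_i$ (cut both paths and every tile at this line, move the right part by $(2,0)$, and reconnect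 paths and tiles by $UD$), and then, if $s>h_i+1$, add single boxes on top of the upper path in the columns $h_i+1<x<s$. Here $s$ is the special column: the right-most column $s$ such that the upper path has an up step ending on $x=s$ whose end point is not the top corner of a tile that is a single box. The result is $\mathrm{DTR}(T)$. **Dyck tableaux.** The anchor box of an edge $(u,d)$ in the zeroth floor is the box south-east of $u$ and south-west of $d$; in the $p$-th floor it is this box moved by $(0,2p)$. The partial frozen region of $(u,d)$ consists of the boxes below the part of $\lambda$ from $u$ to $d$ and above the path $D\cdots DU\cdots U$ with the same end points; the frozen region of $\lambda$ is the union of these regions. The tableau $\mathrm{DTab}(T)$ is built for $i=1,\dots,n$ as follows, every box being empty, labelled, or passed by exactly one line. The free floor of an edge is the lowest floor that is not below the free floor of its parent edge and in which its anchor box is not passed by a line. The label $i$ is put in the anchor box of $e_i$ in the free floor of $e_i$. If $e_{i-1}$ is strictly right of $e_i$, a line with north-east and south-east steps is drawn from the north-east edge of the box labelled $i$ to the north-west edge of the box labelled $i-1$; it is the lowest line such that: it stays between the highest path $U^nD^n$ and the bottom path (the concatenation of the paths $D^{m}U^{m}$, one for each prime factor of $\lambda$ of length $2m$); it avoids labelled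 boxes and boxes passed by earlier lines; it passes through the anchor box, in the free floor, of an edge without a label only as a $\vee$-turn; and it passes straight through every other box of the redefined frozen region, i.e. of the union of the frozen region of $\lambda$ and of the partial frozen regions of the edges with labels $k<i$, each moved by $(0,2p)$ if $k$ lies in the $p$-th floor. **The map $\phi_0$.** It sends a Dyck tableau over $\lambda$ to the following tiling. Its lower path is $\lambda$; its upper path is the lowest Dyck path of length $2n$ above $\lambda$, above all labelled boxes and above all boxes passed by lines. If the label of an edge $(u,d)$ is in the $p$-th floor, there are $p$ non-trivial Dyck tiles above the part of $\lambda$ from $u$ to $d$, running parallel to it: the $j$-th one passes through the boxes with centres $(x,\lambda(x)+2j-1)$. Parts of $j$-th tiles which share a box belong to one tile. The remaining region is filled with single boxes. **Theorem.** Let $\lambda$ be any Dyck path. The map $T\mapsto\mathrm{DTab}(T)$ is injective on the natural labels of $\mathrm{Tree}(\lambda)$, and $\phi_0$ is a bijection from the set of generalized Dyck tableaux $\{\mathrm{DTab}(T): T \text{ a natural label of } \mathrm{Tree}(\lambda)\}$ onto the set of all cover-inclusive Dyck tilings with lower path $\lambda$. Moreover $\phi_0(\mathrm{DTab}(T))=\mathrm{DTR}(T)$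 for every natural label $T$ of $\mathrm{Tree}(\lambda)$. -/

import Mathlib

namespace DyckTableaux

/-! ### Dyck paths, boxes, planted plane trees -/

/-- The height `y` of the Dyck path of the word `w` on the line `x`
(it is `0` to the right of the end point of the path). -/
def height (w : DyckWord) (x : ℕ) : ℤ :=
  ((w.toList.take x).count DyckStep.U : ℤ) - ((w.toList.take x).count DyckStep.D : ℤ)

/-- `f` is the height function of a Dyck path of length `2 * n`. -/
def IsDyckPath (n : ℕ) (f : ℕ → ℤ) : Prop :=
  ∃ w : DyckWord, w.semilength = n ∧ f = height w

/-- A unit box, recorded by its centre `(x, y)`: the box has the corners `(x - 1, y)`, `(x, y + 1)`,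
`(x + 1, y)` and `(x, y - 1)`. -/
abbrev Box : Type := ℕ × ℤ

/-- An edge of the planted plane tree of `lam`: an up step and the down step matched with it.
Step number `k` (counted from `0`) joins the lines `x = k` and `x = k + 1`. The step `down` is the
first one after `up` that leads back to the height from which the step `up` starts. -/
@[ext]
structure Edge (lam : DyckWord) where
  up : ℕ
  down : ℕ
  up_lt_down : up < down
  down_lt : down < 2 * lam.semilength
  height_eq : height lam (down + 1) = height lam up
  height_lt : ∀ k, up < k → k ≤ down → height lam up < height lam k

variable {lam : DyckWord}

/-- `e.IsAbove e'`: the edge `e` lies strictly between the edge `e'` and the root. -/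
def Edge.IsAbove (e e' : Edge lam) : Prop := e.up < e'.up ∧ e'.down < e.down

/-- `e.IsLeft e'`: the edge `e` is strictly left of the edge `e'`. -/
def Edge.IsLeft (e e' : Edge lam) : Prop := e.down < e'.up

/-- A natural label of the tree of `lam`: a bijection from the edges to `{1, …, n}` that increases
from the root to the leaves. -/
@[ext]
structure NaturalLabel (lam : DyckWord) where
  label : Edge lam → ℕ
  bijOn : Set.BijOn label Set.univ (Set.Icc 1 lam.semilength)
  increasing : ∀ e e', e.IsAbove e' → label e < label e'

/-! ### Dyck tilings -/

/-- A lower path and an upper path (as height functions) and a set of tiles (sets of boxes). -/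
@[ext]
structure Tiling where
  lower : ℕ → ℤ
  upper : ℕ → ℤ
  tiles : Set (Set Box)

/-- The boxes of the skew shape between two paths. -/
def skewShape (lower upper : ℕ → ℤ) : Set Box :=
  {b | Odd ((b.1 : ℤ) + b.2) ∧ lower b.1 + 1 ≤ b.2 ∧ b.2 + 1 ≤ upper b.1}

/-- A Dyck tile: a ribbon whose box centres form a translated Dyck path. -/
def IsDyckTile (t : Set Box) : Prop :=
  ∃ (b : Box) (w : DyckWord), t = {c | ∃ k ≤ 2 * w.semilength, c = (b.1 + k, b.2 + height w k)}

/-- The skew shape between two Dyck paths of the same length is tiled by Dyck tiles. -/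
structure Tiling.IsDyckTiling (D : Tiling) : Prop where
  paths : ∃ n, IsDyckPath n D.lower ∧ IsDyckPath n D.upper
  lower_le_upper : ∀ x, D.lower x ≤ D.upper x
  isDyckTile : ∀ t ∈ D.tiles, IsDyckTile t
  subset : ∀ t ∈ D.tiles, t ⊆ skewShape D.lower D.upper
  existsUnique : ∀ b ∈ skewShape D.lower D.upper, ∃! t, t ∈ D.tiles ∧ b ∈ t

/-- Each tile, translated by `(0, -2)`, is below the lower path or contained in another tile. -/
def Tiling.IsCoverInclusive (D : Tiling) : Prop :=
  ∀ t ∈ D.tiles,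
    (∀ b ∈ t, (b.2 - 2) + 1 ≤ D.lower b.1) ∨
      ∃ t' ∈ D.tiles, t' ≠ t ∧ ∀ b ∈ t, ((b.1, b.2 - 2) : Box) ∈ t'

/-- The cover-inclusive Dyck tilings with lower path `lam`. -/
def coverInclusiveTilings (lam : DyckWord) : Set Tiling :=
  {D | D.IsDyckTiling ∧ D.IsCoverInclusive ∧ D.lower = height lam}

/-! ### The Dyck tiling ribbon map -/

/-- Cut a path at `x = m`, move the right piece by `(2, 0)`, reconnect by the steps `UD`. -/
def spreadPath (m : ℕ) (f : ℕ → ℤ) (x : ℕ) : ℤ :=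
  if x ≤ m then f x else if x = m + 1 then f m + 1 else f (x - 2)

/-- The same operation on a tile: a box centred on `x = m` is cut, and the centres of its
two halves are reconnected by the steps `UD`. -/
def spreadTile (m : ℕ) (t : Set Box) : Set Box :=
  {b | b ∈ t ∧ b.1 ≤ m} ∪ {b | ∃ c ∈ t, m ≤ c.1 ∧ b = (c.1 + 2, c.2)} ∪
    {b | ∃ c ∈ t, c.1 = m ∧ b = (m + 1, c.2 + 1)}

/-- The spread of `D` at `x = m`. -/
def Tiling.spread (m : ℕ) (D : Tiling) : Tiling where
  lower := spreadPath m D.lower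
  upper := spreadPath m D.upper
  tiles := spreadTile m '' D.tiles

/-- Column `s` is eligible: the upper path has an up step ending on `x = s`, and its end point is
not the top corner of a tile that is a single box. -/
def Tiling.IsEligible (D : Tiling) (s : ℕ) : Prop :=
  (∃ r, s = r + 1 ∧ D.upper s = D.upper r + 1) ∧ ({((s, D.upper s - 1) : Box)} : Set Box) ∉ D.tiles

/-- The right-most eligible column. -/
noncomputable def Tiling.specialColumn (D : Tiling) : ℕ := sSup {s | D.IsEligible s}

/-- The ribbon-growth of `D`, a tiling that was spread at `x = m`: on top of the upper path, a
ribbon of single boxes is added from the new up step (ending on `x = m + 1`) to the up step ending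
on the special column; there is no ribbon if the special column is `m + 1`. -/
noncomputable def Tiling.ribbonGrowth (m : ℕ) (D : Tiling) : Tiling where
  lower := D.lower
  upper := fun x => if m + 1 < x ∧ x < D.specialColumn then D.upper x + 2 else D.upper x
  tiles := D.tiles ∪
    {t | ∃ x, m + 1 < x ∧ x < D.specialColumn ∧ t = {((x, D.upper x + 1) : Box)}}

/-- The entry `h_i` of the insertion history: twice the number of edges with a label below `i` which
are strictly left of the edge labelled `i`, plus the number of edges between that edge and the
root. -/
noncomputable def NaturalLabel.insertionHistory (T : NaturalLabel lam) (i : ℕ) : ℕ :=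
  2 * {e' : Edge lam | ∃ e, T.label e = i ∧ e'.IsLeft e ∧ T.label e' < i}.ncard +
    {e' : Edge lam | ∃ e, T.label e = i ∧ e'.IsAbove e}.ncard

/-- The tiling obtained from the edges labelled `1, …, i`: each edge in turn is inserted by a spread
and a ribbon-growth, starting with the empty tiling of size `0`. -/
noncomputable def NaturalLabel.ribbonTiling (T : NaturalLabel lam) : ℕ → Tiling
  | 0 => ⟨fun _ => 0, fun _ => 0, ∅⟩
  | i + 1 =>
    ((T.ribbonTiling i).spread (T.insertionHistory (i + 1))).ribbonGrowth
      (T.insertionHistory (i + 1))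

/-- The Dyck tiling ribbon map. -/
noncomputable def DTR (T : NaturalLabel lam) : Tiling := T.ribbonTiling lam.semilength

/-! ### Generalized Dyck tableaux -/

/-- The anchor box of `e` in the `p`-th floor. In the zeroth floor it is the box south-east of the
up step and south-west of the down step of `e`. -/
def Edge.anchor (e : Edge lam) (p : ℕ) : Box :=
  ((e.up + e.down + 1) / 2, height lam e.up - ((e.down - e.up - 1) / 2 : ℕ) + 2 * (p : ℤ))

/-- The partial frozen region associated with `e`, translated by `(0, 2 * p)`: the boxes
below the part of the path `lam` from the up step to the down step of `e`, and above the path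
`D⋯DU⋯U` with the same end points. -/
def Edge.frozenRegion (e : Edge lam) (p : ℕ) : Set Box :=
  {b | Odd ((b.1 : ℤ) + b.2) ∧ e.up < b.1 ∧ b.1 ≤ e.down ∧
    b.2 + 1 ≤ height lam b.1 + 2 * (p : ℤ) ∧
    height lam e.up - min ((b.1 : ℤ) - e.up) ((e.down : ℤ) + 1 - b.1) + 2 * (p : ℤ) ≤ b.2 - 1}

/-- The region between the highest path `U⋯UD⋯D` and the bottom path of `lam`, which is a
concatenation of paths `D⋯DU⋯U`, one for each prime factor of `lam`; the bottom path has at `x` the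
height `-d`, where `d` is the distance from `x` to the nearest return of `lam` to the height `0`. -/
def baseRegion (lam : DyckWord) : Set Box :=
  {b | Odd ((b.1 : ℤ) + b.2) ∧
    b.2 + 1 ≤ min (b.1 : ℤ) (2 * (lam.semilength : ℤ) - b.1) ∧
    ∀ r ≤ 2 * lam.semilength, height lam r = 0 → -|(b.1 : ℤ) - r| ≤ b.2 - 1}

/-- When the boxes in `occ` carry lines: the lowest floor in which `e` has an anchor box without a
line and which is not lower than the floor found in the same way for the edges above `e`. -/
noncomputable def Edge.freeFloor (occ : Set Box) (e : Edge lam) : ℕ :=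
  sInf {p | (∀ e' : Edge lam, (h : e'.IsAbove e) → e'.freeFloor occ ≤ p) ∧ e.anchor p ∉ occ}
termination_by e.up
decreasing_by exact h.1

/-- A generalized Dyck tableau over `lam` as a diagram: the anchor box of the edge `e` in the floor
`floor e` carries the label `label e`, and `line i` is the set of the boxes through which the line
passes that starts at the box labelled `i` (it is empty if there is no such line). Every other
box is empty. -/
@[ext]
structure DyckTableau (lam : DyckWord) where
  label : Edge lam → ℕ
  floor : Edge lam → ℕ
  line : ℕ → Set Box

namespace DyckTableau

/-- The boxes that carry a line. -/
def lineBoxes (F : DyckTableau lam) : Set Box := {b | ∃ i, b ∈ F.line i}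

/-- The box that carries the label of the edge `e`. -/
def labeledBox (F : DyckTableau lam) (e : Edge lam) : Box := e.anchor (F.floor e)

/-- The current anchor box of an edge without a label. -/
noncomputable def freeAnchor (F : DyckTableau lam) (e : Edge lam) : Box :=
  e.anchor (e.freeFloor F.lineBoxes)

/-- The frozen region redefined by the labels below `i`. -/
def redefinedFrozenRegion (F : DyckTableau lam) (i : ℕ) : Set Box :=
  {b | (∃ e : Edge lam, b ∈ e.frozenRegion 0) ∨
    ∃ e : Edge lam, F.label e < i ∧ b ∈ e.frozenRegion (F.floor e)}

/-- Let the boxes with the labels `1, …, i` and the lines of the labels below `i` be in place.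
`F.IsLine i e e' L` says that a line may run from the box labelled `i` (of the edge `e`) to the box
labelled `i - 1` (of the edge `e'`) through the boxes with the centres `(x, L x)`. -/
structure IsLine (F : DyckTableau lam) (i : ℕ) (e e' : Edge lam) (L : ℕ → ℤ) : Prop where
  /-- it starts from the north-east edge of the box labelled `i` -/
  start : L (F.labeledBox e).1 = (F.labeledBox e).2 ∧
    L ((F.labeledBox e).1 + 1) = (F.labeledBox e).2 + 1
  /-- it ends at the north-west edge of the box labelled `i - 1` -/
  finish : L (F.labeledBox e').1 = (F.labeledBox e').2 ∧
    ∀ x, x + 1 = (F.labeledBox e').1 → L x = (F.labeledBox e').2 + 1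
  /-- it consists of north-east and south-east steps -/
  steps : ∀ x, (F.labeledBox e).1 ≤ x → x < (F.labeledBox e').1 →
    L (x + 1) = L x + 1 ∨ L (x + 1) = L x - 1
  mem_region : ∀ x, (F.labeledBox e).1 < x → x < (F.labeledBox e').1 → (x, L x) ∈ baseRegion lam
  /-- a box carries at most one line -/
  not_mem_lineBoxes : ∀ x, (F.labeledBox e).1 < x → x < (F.labeledBox e').1 →
    (x, L x) ∉ F.lineBoxes
  /-- it does not pass through labelled boxes -/
  ne_labeledBox : ∀ x, (F.labeledBox e).1 < x → x < (F.labeledBox e').1 →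
    ∀ k : Edge lam, F.label k ≤ i → (x, L x) ≠ F.labeledBox k
  /-- the anchor box of an edge without a label can only become a `∨`-turn box -/
  turn : ∀ x, (F.labeledBox e).1 ≤ x → x + 1 < (F.labeledBox e').1 →
    ∀ k : Edge lam, i < F.label k → (x + 1, L (x + 1)) = F.freeAnchor k →
      L x = L (x + 1) + 1 ∧ L (x + 2) = L (x + 1) + 1
  /-- any other box of the redefined frozen region can only become a parallel box -/
  parallel : ∀ x, (F.labeledBox e).1 ≤ x → x + 1 < (F.labeledBox e').1 →
    (x + 1, L (x + 1)) ∈ F.redefinedFrozenRegion i →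
    (∀ k : Edge lam, i < F.label k → (x + 1, L (x + 1)) ≠ F.freeAnchor k) →
      L (x + 2) - L (x + 1) = L (x + 1) - L x

/-- The boxes strictly between the boxes labelled `i` and `i - 1` on the lowest line joining them;
the set is empty unless the edge labelled `i - 1` is strictly right of the edge labelled `i`. -/
def lowestLine (F : DyckTableau lam) (i : ℕ) : Set Box :=
  {b | ∃ (e e' : Edge lam) (L : ℕ → ℤ),
    F.label e = i ∧ F.label e' + 1 = i ∧ e.IsLeft e' ∧ F.IsLine i e e' L ∧
    (∀ L', F.IsLine i e e' L' →
      ∀ x, (F.labeledBox e).1 ≤ x → x ≤ (F.labeledBox e').1 → L x ≤ L' x) ∧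
    (F.labeledBox e).1 < b.1 ∧ b.1 < (F.labeledBox e').1 ∧ b.2 = L b.1}

/-- Put the label `i` in its box. -/
noncomputable def putLabel (F : DyckTableau lam) (i : ℕ) : DyckTableau lam :=
  { F with floor := fun e => if F.label e = i then e.freeFloor F.lineBoxes else F.floor e }

/-- Draw the line that starts from the box labelled `i`, if there is one. -/
noncomputable def putLine (F : DyckTableau lam) (i : ℕ) : DyckTableau lam :=
  { F with line := Function.update F.line i (F.lowestLine i) }

end DyckTableau

/-- The diagram after the labels `1, …, i` have been put in (the values of `floor` at the edges with
a larger label have no meaning yet). -/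
noncomputable def NaturalLabel.partialTableau (T : NaturalLabel lam) : ℕ → DyckTableau lam
  | 0 => ⟨T.label, fun _ => 0, fun _ => ∅⟩
  | i + 1 => ((T.partialTableau i).putLabel (i + 1)).putLine (i + 1)

/-- The generalized Dyck tableau of a natural label. -/
noncomputable def DTab (T : NaturalLabel lam) : DyckTableau lam :=
  T.partialTableau lam.semilength

/-! ### The map from Dyck tableaux to Dyck tilings -/

namespace DyckTableau

/-- The lowest Dyck path above `lam`, above the labelled boxes, and above the boxes on lines, i.e.
the parallel boxes and the turn boxes, which form the ribbons between consecutive labels. -/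
noncomputable def topPath (F : DyckTableau lam) (x : ℕ) : ℤ :=
  sInf {y | ∃ f, IsDyckPath lam.semilength f ∧ (∀ z, height lam z ≤ f z) ∧
    (∀ e, (F.labeledBox e).2 + 1 ≤ f (F.labeledBox e).1) ∧
    (∀ b ∈ F.lineBoxes, b.2 + 1 ≤ f b.1) ∧ y = f x}

/-- The step number `k` of `lam` belongs to the part of `lam` from the up step to the down step of
an edge over which there are at least `j` non-trivial tiles. -/
def IsCovered (F : DyckTableau lam) (j k : ℕ) : Prop :=
  ∃ e : Edge lam, j ≤ F.floor e ∧ e.up ≤ k ∧ k ≤ e.down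

/-- The non-trivial tiles: over the steps from the up step to the down step of the edge `e` there
are `floor e` of them, the `j`-th one running parallel to `lam` at the vertical distance `2 * j - 1`.
The parts of the `j`-th tiles over adjacent edges share a box and belong to the same tile, so
the `j`-th tiles are given by the maximal runs of covered steps. -/
def nontrivialTiles (F : DyckTableau lam) : Set (Set Box) :=
  {t | ∃ j a b : ℕ, 1 ≤ j ∧ a < b ∧ (∀ k, a ≤ k → k < b → F.IsCovered j k) ∧
    (∀ k, k + 1 = a → ¬ F.IsCovered j k) ∧ ¬ F.IsCovered j b ∧
    t = {c | a ≤ c.1 ∧ c.1 ≤ b ∧ c.2 = height lam c.1 + (2 * (j : ℤ) - 1)}}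

/-- The map `φ₀`: the remaining region is filled with single boxes. -/
noncomputable def phi0 (F : DyckTableau lam) : Tiling where
  lower := height lam
  upper := F.topPath
  tiles := F.nontrivialTiles ∪
    {t | ∃ b ∈ skewShape (height lam) F.topPath, (∀ s ∈ F.nontrivialTiles, b ∉ s) ∧ t = {b}}

end DyckTableau

end DyckTableaux

/-! Both constructions are governed by one count. If the edge labelled `k - 1` is strictly right of
the edge labelled `k`, the strip of `k` is what lies strictly between these two edges, and `floorOf
e` is the number of strips with a starting label below that of `e` which pass over `e`. The ends of
such a strip carry labels smaller than that of `e`, so they are not descendants of `e`; a strip that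
meets the interior of `e` therefore covers all of `e` (`strip_iff_of_subinterval`).

On the side of tableaux, the lines have a closed form, `level`. In column `x`, line `t` follows the
bottom path `D⋯DU⋯U` of the edge closest to the root among those over `x` with a label of at least
`t - 1`, raised by the number of earlier strips; where there is no such edge, it runs along `lam`,
raised in the same way. Levels increase with `t`, and each box in the gap between two successive
levels is on line `t` or in the translated frozen region of the edge labelled `t - 1`
(`mem_lineSet_or_frozen`). It follows that the free floor at the moment of labelling is `floorOf`,
that `level` is an admissible line (`isLine_level`), and that it is the lowest one
(`level_le_of_isLine`): a competitor that drops below it is trapped in boxes which it must cross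
straight on, and it descends past its end point. The upper path is then `lam` raised by twice the
number of strips over each point (`topPath_DTab`).

On the side of tilings, all tiles of a cover-inclusive tiling run parallel to the lower path, so the
tiling is encoded by the number `v x` of boxes in each column and the number `c k` of levels joined
across each step. `Valid` characterizes the codes that occur (`mem_coverInclusiveTilings`,
`exists_valid`, `Valid.ext`). Spreads and ribbon-growths are explicit on codes (`Valid.insert`), and
an induction over the labels (`exists_isStage`) shows that the ribbon added with label `i` is
exactly the strip of `i` and that the joints are the numbers `floorOf`. Comparing the two
descriptions gives `phi0_DTab`.

For bijectivity, an insertion makes the new up step end on the special column. This determines the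
line of the spread, and then the ribbon (`Valid.insert_injective`). Conversely, the special column
of any nonempty tiling sits over a peak of the lower path, and the ribbon starting there can be
removed (`Valid.peak_of_isSpecial`, `Valid.exists_shrink`, `Valid.exists_insert`). The line of the
last spread identifies the leaf with the largest label, so that `DTR` is injective by descending
induction and surjective by induction on the number of edges. The map `phi0` inherits both
properties; `DTab` is injective because a tableau records its labels. -/

namespace DyckTableaux

/-! ### Paths as height functions -/

/-- `f` takes unit steps on `[0, 2 * n]`, is nonnegative, and vanishes at `0` and from `2 * n` on. -/
structure IsPath (n : ℕ) (f : ℕ → ℤ) : Prop where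
  zero : f 0 = 0
  step : ∀ k, k < 2 * n → f (k + 1) = f k + 1 ∨ f (k + 1) = f k - 1
  tail : ∀ x, 2 * n ≤ x → f x = 0
  nonneg : ∀ x, 0 ≤ f x

/-- The up step `a` of the path `f` is matched with the down step `b`. -/
def IsMatch (f : ℕ → ℤ) (a b : ℕ) : Prop :=
  a < b ∧ f (b + 1) = f a ∧ ∀ k, a < k → k ≤ b → f a < f k

theorem height_succ (w : DyckWord) {k : ℕ} (hk : k < 2 * w.semilength) :
    height w (k + 1) = height w k + 1 ∨ height w (k + 1) = height w k - 1 := by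
  rw [w.two_mul_semilength_eq_length] at hk
  unfold height
  rw [List.take_add_one, List.getElem?_eq_getElem hk]
  rcases (w.toList[k]).dichotomy with h | h <;> simp [h] <;> omega

theorem isPath_height (w : DyckWord) : IsPath w.semilength (height w) where
  zero := by simp [height]
  step _ hk := height_succ w hk
  tail x hx := by
    rw [w.two_mul_semilength_eq_length] at hx
    simp [height, List.take_of_length_le hx, w.count_U_eq_count_D]
  nonneg x := by
    have := w.count_D_le_count_U x
    unfold height
    omega

/-- The letters are read off the steps of `f`, and counting letters in prefixes gives `f` back.
Nothing is required beyond `2 * m`, so that a segment of a longer path can be turned into a word;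
this later produces the word of a Dyck tile. -/
theorem exists_dyckWord {m : ℕ} {f : ℕ → ℤ} (h0 : f 0 = 0)
    (hstep : ∀ k, k < 2 * m → f (k + 1) = f k + 1 ∨ f (k + 1) = f k - 1) (hend : f (2 * m) = 0)
    (hnn : ∀ x, x ≤ 2 * m → 0 ≤ f x) :
    ∃ w : DyckWord, w.semilength = m ∧ ∀ x, x ≤ 2 * m → height w x = f x := by
  set g : ℕ → DyckStep := fun k => if f (k + 1) = f k + 1 then DyckStep.U else DyckStep.D with hg
  have count_take : ∀ x, x ≤ 2 * m →
      ((((List.range x).map g).count DyckStep.U : ℕ) : ℤ) -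
        (((List.range x).map g).count DyckStep.D : ℕ) = f x := by
    intro x hx
    induction x with
    | zero => simp [h0]
    | succ x ih =>
      have ih := ih (by omega)
      rw [List.range_succ, List.map_append, List.count_append, List.count_append]
      rcases hstep x (by omega) with h | h
      · have : g x = DyckStep.U := by simp [hg, h]
        simp [this]; omega
      · have : g x = DyckStep.D := by
          simp only [hg]; rw [if_neg (by omega)]
        simp [this]; omega
  have take_eq : ∀ x, ((List.range (2 * m)).map g).take x = (List.range (min x (2 * m))).map g := by
    intro x
    rw [← List.map_take, List.take_range]
  have key : ∀ x, ((((List.range (2 * m)).map g).take x).count DyckStep.U : ℤ) -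
      (((List.range (2 * m)).map g).take x).count DyckStep.D = f (min x (2 * m)) := by
    intro x
    rw [take_eq]
    exact count_take _ (min_le_right _ _)
  have htot := count_take (2 * m) le_rfl
  let w : DyckWord := ⟨(List.range (2 * m)).map g, by omega, fun i => by
    have := key i
    have := hnn (min i (2 * m)) (min_le_right _ _)
    omega⟩
  refine ⟨w, ?_, fun x hx => ?_⟩
  · have hl : w.toList.length = 2 * m := by simp [w]
    have := w.two_mul_semilength_eq_length
    omega
  · have := key x
    rw [min_eq_left hx] at this
    exact this

theorem isDyckPath_iff {n : ℕ} {f : ℕ → ℤ} : IsDyckPath n f ↔ IsPath n f := by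
  constructor
  · rintro ⟨w, rfl, rfl⟩
    exact isPath_height w
  · intro h
    obtain ⟨w, hw, hwf⟩ := exists_dyckWord h.zero h.step (h.tail _ le_rfl) fun x _ => h.nonneg x
    refine ⟨w, hw, funext fun x => ?_⟩
    rcases le_total x (2 * n) with hx | hx
    · exact (hwf x hx).symm
    · rw [h.tail x hx, (isPath_height w).tail x (by rw [hw]; exact hx)]

namespace IsPath

variable {n : ℕ} {f : ℕ → ℤ}

theorem even_add (h : IsPath n f) {x : ℕ} (hx : x ≤ 2 * n) : Even (f x + x) := by
  induction x with
  | zero => simp [h.zero]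
  | succ x ih =>
    obtain ⟨z, hz⟩ := ih (by omega)
    rcases h.step x (by omega) with hs | hs
    · exact ⟨z + 1, by push_cast; omega⟩
    · exact ⟨z, by push_cast; omega⟩

theorem even_sub {g : ℕ → ℤ} (h : IsPath n f) (h' : IsPath n g) (x : ℕ) : Even (g x - f x) := by
  rcases le_total x (2 * n) with hx | hx
  · obtain ⟨a, ha⟩ := h.even_add hx
    obtain ⟨b, hb⟩ := h'.even_add hx
    exact ⟨b - a, by omega⟩
  · simp [h.tail x hx, h'.tail x hx]

theorem sub_le (h : IsPath n f) {x y : ℕ} (hxy : x ≤ y) (hy : y ≤ 2 * n) :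
    f y ≤ f x + (y - x) ∧ f x ≤ f y + (y - x) := by
  induction y, hxy using Nat.le_induction with
  | base => simp
  | succ y hxy ih =>
    have := ih (by omega)
    have := h.step y (by omega)
    push_cast
    omega

theorem le_min (h : IsPath n f) {x : ℕ} (hx : x ≤ 2 * n) :
    f x ≤ min (x : ℤ) (2 * (n : ℤ) - x) := by
  have h1 := (h.sub_le (Nat.zero_le x) hx).1
  have h2 := (h.sub_le hx le_rfl).2
  have h3 := h.tail (2 * n) le_rfl
  rw [h.zero] at h1
  push_cast at h1 h2
  omega

theorem lt_of_pos (h : IsPath n f) {x : ℕ} (hx : 0 < f x) : x < 2 * n := by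
  by_contra hc
  have := h.tail x (by omega)
  omega

theorem exists_match_up (h : IsPath n f) {k : ℕ} (hk : f (k + 1) = f k + 1) :
    ∃ b, IsMatch f k b := by
  classical
  have hex : ∃ b, k < b ∧ f (b + 1) ≤ f k :=
    -- Any index beyond both `k` and the end of the path serves, since `f` vanishes there.
    ⟨2 * n + k + 1, by omega, by rw [h.tail _ (by omega)]; exact h.nonneg k⟩
  have hmin : ∀ z, z < Nat.find hex → ¬(k < z ∧ f (z + 1) ≤ f k) := fun z => Nat.find_min hex
  have hs := Nat.find_spec hex
  generalize Nat.find hex = b at hmin hs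
  have hgt : ∀ z, k < z → z ≤ b → f k < f z := by
    intro z hz hzb
    rcases Nat.lt_or_ge (k + 1) z with h1 | h1
    · obtain ⟨y, rfl⟩ : ∃ y, z = y + 1 := ⟨z - 1, by omega⟩
      have := hmin y (by omega)
      by_contra hc
      exact this ⟨by omega, by omega⟩
    · obtain rfl : z = k + 1 := by omega
      omega
  refine ⟨b, hs.1, ?_, hgt⟩
  have h1 := hgt b hs.1 le_rfl
  have h2 := h.nonneg k
  have h3 := h.step b (h.lt_of_pos (by omega))
  have := hs.2
  omega

theorem exists_match_down (h : IsPath n f) {k : ℕ} (hkn : k < 2 * n) (hk : f (k + 1) = f k - 1) :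
    ∃ a, IsMatch f a k := by
  classical
  have h0 : f 0 ≤ f (k + 1) := by rw [h.zero]; exact h.nonneg _
  have hs : f (Nat.findGreatest (fun a => f a ≤ f (k + 1)) k) ≤ f (k + 1) :=
    Nat.findGreatest_spec (P := fun a => f a ≤ f (k + 1)) (Nat.zero_le k) h0
  have hgt : ∀ z, Nat.findGreatest (fun a => f a ≤ f (k + 1)) k < z → z ≤ k →
      ¬ f z ≤ f (k + 1) := fun z hz hzk => Nat.findGreatest_is_greatest hz hzk
  have hle : Nat.findGreatest (fun a => f a ≤ f (k + 1)) k ≤ k := Nat.findGreatest_le k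
  generalize Nat.findGreatest (fun a => f a ≤ f (k + 1)) k = a at hs hgt hle
  have hlt : a < k := by
    rcases hle.lt_or_eq with h1 | rfl
    · exact h1
    · omega
  have h1 := hgt (a + 1) (by omega) (by omega)
  have h2 := h.step a (by omega)
  refine ⟨a, hlt, by omega, fun z hz hzk => ?_⟩
  have := hgt z hz hzk
  omega

theorem exists_match_of_lt (h : IsPath n f) {a y : ℕ} (hay : a < y)
    (hlt : ∀ z, a < z → z ≤ y → f a < f z) : ∃ b, IsMatch f a b ∧ y ≤ b := by
  have h0 := h.nonneg a
  have h1 := hlt (a + 1) (by omega) (by omega)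
  have h2 : a + 1 < 2 * n := h.lt_of_pos (by omega)
  have h3 := h.step a (by omega)
  obtain ⟨b, hb⟩ := h.exists_match_up (k := a) (by omega)
  refine ⟨b, hb, ?_⟩
  by_contra hc
  have := hlt (b + 1) (by have := hb.1; omega) (by omega)
  have := hb.2.1
  omega

/-- A point of positive height lies over some matched pair that starts below it. -/
theorem exists_match_of_pos (h : IsPath n f) {x : ℕ} (hx : 0 < f x) :
    ∃ a b, IsMatch f a b ∧ a < x ∧ x ≤ b ∧ f a < f x ∧ ∀ z, a < z → z ≤ x → f x ≤ f z := by
  classical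
  have h0 : f 0 < f x := by rw [h.zero]; exact hx
  have hs : f (Nat.findGreatest (fun a => f a < f x) x) < f x :=
    Nat.findGreatest_spec (P := fun a => f a < f x) (Nat.zero_le x) h0
  have hgt : ∀ z, Nat.findGreatest (fun a => f a < f x) x < z → z ≤ x →
      ¬ f z < f x := fun z hz hzk => Nat.findGreatest_is_greatest hz hzk
  have hle : Nat.findGreatest (fun a => f a < f x) x ≤ x := Nat.findGreatest_le x
  generalize Nat.findGreatest (fun a => f a < f x) x = a at hs hgt hle
  have hlt : a < x := by
    rcases hle.lt_or_eq with h1 | rfl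
    · exact h1
    · omega
  obtain ⟨b, hb, hxb⟩ := h.exists_match_of_lt hlt fun z hz hzx => by
    have := hgt z hz hzx
    omega
  exact ⟨a, b, hb, hlt, hxb, hs, fun z hz hzx => not_lt.1 (hgt z hz hzx)⟩

end IsPath

/-! ### Edges -/

section Edge

variable {lam : DyckWord}

theorem IsMatch.exists_edge {a b : ℕ} (h : IsMatch (height lam) a b) :
    ∃ e : Edge lam, e.up = a ∧ e.down = b := by
  have h1 := h.2.2 b h.1 le_rfl
  have h2 := (isPath_height lam).nonneg a
  exact ⟨⟨a, b, h.1, (isPath_height lam).lt_of_pos (by omega), h.2.1, h.2.2⟩, rfl, rfl⟩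

namespace Edge

theorem height_up_succ (e : Edge lam) : height lam (e.up + 1) = height lam e.up + 1 := by
  have h1 := e.height_lt (e.up + 1) (by omega) e.up_lt_down
  have h2 := height_succ lam (k := e.up) (by have := e.up_lt_down; have := e.down_lt; omega)
  omega

theorem height_down (e : Edge lam) : height lam e.down = height lam e.up + 1 := by
  have h1 := e.height_lt e.down e.up_lt_down le_rfl
  have h2 := height_succ lam e.down_lt
  have := e.height_eq
  omega

theorem height_down_succ (e : Edge lam) : height lam (e.down + 1) = height lam e.down - 1 := by
  have := e.height_down
  have := e.height_eq
  omega

theorem up_ne_down (e e' : Edge lam) : e.up ≠ e'.down := by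
  intro h
  have h1 := e.height_up_succ
  have h2 := e'.height_down_succ
  rw [h] at h1
  omega

/-- Two edges are equal, nested, or one is strictly left of the other. -/
theorem cases_up_lt (e e' : Edge lam) (h : e.up < e'.up) : e.IsAbove e' ∨ e.IsLeft e' := by
  by_cases hl : e.down < e'.up
  · exact Or.inr hl
  · refine Or.inl ⟨h, ?_⟩
    have h1 := e'.up_ne_down e
    by_contra hc
    have h2 := e.height_lt e'.up h (by omega)
    rcases (not_lt.1 hc).lt_or_eq with h3 | h3
    · have := e'.height_lt (e.down + 1) (by omega) h3
      have := e.height_eq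
      omega
    · have := e.height_eq
      have := e'.height_eq
      rw [h3] at *
      omega

theorem ext_up {e e' : Edge lam} (h : e.up = e'.up) : e = e' := by
  refine Edge.ext h ?_
  have key : ∀ e e' : Edge lam, e.up = e'.up → e.down ≤ e'.down := by
    intro e e' h
    by_contra hc
    have h1 := e.height_lt (e'.down + 1) (by have := e'.up_lt_down; omega) (by omega)
    have h2 := e'.height_eq
    rw [h] at h1
    omega
  exact le_antisymm (key e e' h) (key e' e h.symm)

theorem cases (e e' : Edge lam) :
    e = e' ∨ e.IsAbove e' ∨ e'.IsAbove e ∨ e.IsLeft e' ∨ e'.IsLeft e := by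
  rcases lt_trichotomy e.up e'.up with h | h | h
  · rcases cases_up_lt e e' h with h | h <;> simp [h]
  · exact Or.inl (ext_up h)
  · rcases cases_up_lt e' e h with h | h <;> simp [h]

theorem ext_down {e e' : Edge lam} (h : e.down = e'.down) : e = e' := by
  have := e.up_lt_down
  have := e'.up_lt_down
  rcases cases e e' with h1 | ⟨h1, h2⟩ | ⟨h1, h2⟩ | h1 | h1
  · exact h1
  all_goals (try unfold IsLeft at h1); omega

theorem exists_up {k : ℕ} (hk : height lam (k + 1) = height lam k + 1) :
    ∃ e : Edge lam, e.up = k := by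
  obtain ⟨b, hb⟩ := (isPath_height lam).exists_match_up hk
  obtain ⟨e, he, -⟩ := hb.exists_edge
  exact ⟨e, he⟩

theorem exists_down {k : ℕ} (hkn : k < 2 * lam.semilength)
    (hk : height lam (k + 1) = height lam k - 1) : ∃ e : Edge lam, e.down = k := by
  obtain ⟨b, hb⟩ := (isPath_height lam).exists_match_down hkn hk
  obtain ⟨e, -, he⟩ := hb.exists_edge
  exact ⟨e, he⟩

theorem exists_step {k : ℕ} (hkn : k < 2 * lam.semilength) :
    ∃ e : Edge lam, e.up = k ∨ e.down = k := by
  rcases height_succ lam hkn with h | h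
  · obtain ⟨e, he⟩ := exists_up h
    exact ⟨e, Or.inl he⟩
  · obtain ⟨e, he⟩ := exists_down hkn h
    exact ⟨e, Or.inr he⟩

theorem eq_of_step {e e' : Edge lam} {k : ℕ} (h : e.up = k ∨ e.down = k)
    (h' : e'.up = k ∨ e'.down = k) : e = e' := by
  rcases h with h | h <;> rcases h' with h' | h'
  · exact ext_up (h.trans h'.symm)
  · exact absurd (h.trans h'.symm) (e.up_ne_down e')
  · exact absurd (h'.trans h.symm) (e'.up_ne_down e)
  · exact ext_down (h.trans h'.symm)

theorem up_lt (e : Edge lam) : e.up < 2 * lam.semilength := e.up_lt_down.trans e.down_lt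

instance : Finite (Edge lam) :=
  Finite.of_injective (fun e : Edge lam => (⟨e.up, e.up_lt⟩ : Fin (2 * lam.semilength)))
    fun _ _ h => ext_up (by simpa using h)

/-- The line `x` meets the interior of the part of the path from the up step to the down step. -/
def Contains (e : Edge lam) (x : ℕ) : Prop := e.up < x ∧ x ≤ e.down

theorem IsAbove.contains {e e' : Edge lam} (h : e.IsAbove e') {x : ℕ} (hx : e'.Contains x) :
    e.Contains x :=
  ⟨h.1.trans hx.1, hx.2.trans h.2.le⟩

theorem IsAbove.trans {e₁ e₂ e₃ : Edge lam} (h : e₁.IsAbove e₂) (h' : e₂.IsAbove e₃) :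
    e₁.IsAbove e₃ := ⟨h.1.trans h'.1, h'.2.trans h.2⟩

theorem Contains.cases {e e' : Edge lam} {x : ℕ} (h : e.Contains x) (h' : e'.Contains x) :
    e = e' ∨ e.IsAbove e' ∨ e'.IsAbove e := by
  rcases Edge.cases e e' with h1 | h1 | h1 | h1 | h1
  · exact Or.inl h1
  · exact Or.inr (Or.inl h1)
  · exact Or.inr (Or.inr h1)
  · unfold IsLeft at h1; have := h.2; have := h'.1; omega
  · unfold IsLeft at h1; have := h'.2; have := h.1; omega

theorem exists_contains {x : ℕ} (hx : 0 < height lam x) : ∃ e : Edge lam, e.Contains x := by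
  obtain ⟨a, b, hab, h1, h2, -⟩ := (isPath_height lam).exists_match_of_pos hx
  obtain ⟨e, rfl, rfl⟩ := hab.exists_edge
  exact ⟨e, h1, h2⟩

theorem exists_isAbove {e : Edge lam} (he : 0 < height lam e.up) :
    ∃ e' : Edge lam, e'.IsAbove e := by
  obtain ⟨a, b, hab, h1, h2, -⟩ := (isPath_height lam).exists_match_of_pos he
  obtain ⟨e', rfl, rfl⟩ := hab.exists_edge
  refine ⟨e', h1, ?_⟩
  rcases Edge.cases_up_lt e' e h1 with h | h
  · exact h.2
  · unfold IsLeft at h; omega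

theorem height_lt_of_isAbove {e e' : Edge lam} (h : e.IsAbove e') :
    height lam e.up < height lam e'.up :=
  e.height_lt _ h.1 (by have := h.2; have := e'.up_lt_down; omega)

theorem even_sub (e : Edge lam) : Even ((e.down : ℤ) + 1 - e.up) := by
  obtain ⟨a, ha⟩ := (isPath_height lam).even_add e.up_lt.le
  obtain ⟨b, hb⟩ := (isPath_height lam).even_add (x := e.down + 1) (by have := e.down_lt; omega)
  have := e.height_eq
  exact ⟨b - a, by push_cast at hb; omega⟩

end Edge

end Edge

/-! ### Strips between consecutive labels -/

section Label

variable {lam : DyckWord}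

namespace NaturalLabel

variable (T : NaturalLabel lam)

theorem label_pos (e : Edge lam) : 1 ≤ T.label e := (T.bijOn.mapsTo (Set.mem_univ e)).1

theorem label_le (e : Edge lam) : T.label e ≤ lam.semilength :=
  (T.bijOn.mapsTo (Set.mem_univ e)).2

theorem label_inj {e e' : Edge lam} (h : T.label e = T.label e') : e = e' :=
  T.bijOn.injOn (Set.mem_univ e) (Set.mem_univ e') h

theorem exists_label {i : ℕ} (h1 : 1 ≤ i) (h2 : i ≤ lam.semilength) :
    ∃ e, T.label e = i := by
  obtain ⟨e, -, he⟩ := T.bijOn.surjOn ⟨h1, h2⟩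
  exact ⟨e, he⟩

/-- The strip from the edge labelled `k` to the edge labelled `k - 1` further right covers the
interval from `p` to `q`. -/
def Strip (k p q : ℕ) : Prop :=
  ∃ a b, T.label a = k ∧ T.label b + 1 = k ∧ a.down < p ∧ q ≤ b.up

open Classical in
/-- The number of strips that start at a label below `t` and cover the interval from `p` to `q`. -/
noncomputable def strips (t p q : ℕ) : ℕ := Nat.count (fun k => T.Strip k p q) t

variable {T} {t p q : ℕ}

theorem strip_iff {a b : Edge lam} (hb : T.label b + 1 = T.label a) :
    T.Strip (T.label a) p q ↔ a.down < p ∧ q ≤ b.up := by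
  constructor
  · rintro ⟨a', b', ha', hb', h⟩
    obtain rfl := T.label_inj ha'
    obtain rfl := T.label_inj (e := b) (e' := b') (by omega)
    exact h
  · rintro h
    exact ⟨a, b, rfl, hb, h⟩

theorem strips_zero : T.strips 0 p q = 0 := by
  classical
  exact Nat.count_zero _

theorem strips_succ_of (h : T.Strip t p q) : T.strips (t + 1) p q = T.strips t p q + 1 := by
  classical
  simp [strips, Nat.count_succ, h]

theorem strips_succ_of_not (h : ¬ T.Strip t p q) : T.strips (t + 1) p q = T.strips t p q := by
  classical
  simp [strips, Nat.count_succ, h]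

theorem strips_mono {t' : ℕ} (h : t ≤ t') : T.strips t p q ≤ T.strips t' p q := by
  classical
  exact Nat.count_monotone _ h

theorem strips_le {p' q' : ℕ} (h : ∀ k, k < t → T.Strip k p q → T.Strip k p' q') :
    T.strips t p q ≤ T.strips t p' q' := by
  induction t with
  | zero => simp [strips_zero]
  | succ t ih =>
    have ih := ih fun k hk => h k (by omega)
    by_cases h1 : T.Strip t p q
    · rw [strips_succ_of h1, strips_succ_of (h t (by omega) h1)]
      omega
    · rw [strips_succ_of_not h1]
      exact ih.trans (strips_mono (Nat.le_succ t))

theorem strips_congr {p' q' : ℕ} (h : ∀ k, k < t → (T.Strip k p q ↔ T.Strip k p' q')) :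
    T.strips t p q = T.strips t p' q' :=
  le_antisymm (strips_le fun k hk => (h k hk).1) (strips_le fun k hk => (h k hk).2)

theorem strips_const {t' : ℕ} (h : t ≤ t') (hn : ∀ k, t ≤ k → k < t' → ¬ T.Strip k p q) :
    T.strips t' p q = T.strips t p q := by
  induction t', h using Nat.le_induction with
  | base => rfl
  | succ m hm ih =>
    rw [strips_succ_of_not (hn m hm (by omega)), ih fun k hk hkm => hn k hk (by omega)]

/-- Strips are counted by their starting labels, so a single exceptional label `k₀` costs at most
one. -/
theorem strips_le_add_one {p' q' k₀ : ℕ}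
    (h : ∀ k, k < t → k ≠ k₀ → T.Strip k p q → T.Strip k p' q') :
    T.strips t p q ≤ T.strips t p' q' + 1 := by
  induction t with
  | zero => simp [strips_zero]
  | succ t ih =>
    by_cases h1 : T.Strip t p q
    · by_cases ht : t = k₀
      · have := strips_le (T := T) (t := t) (p := p) (q := q) (p' := p') (q' := q')
          fun k hk => h k (by omega) (by omega)
        have := strips_mono (T := T) (p := p') (q := q') (Nat.le_add_right t 1)
        rw [strips_succ_of h1]
        omega
      · have := ih fun k hk => h k (by omega)
        rw [strips_succ_of h1, strips_succ_of (h t (by omega) ht h1)]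
        omega
    · have := ih fun k hk => h k (by omega)
      have := strips_mono (T := T) (p := p') (q := q') (Nat.le_add_right t 1)
      rw [strips_succ_of_not h1]
      omega

/-- The count rises by one at each strip, so every smaller value is attained just before some strip.
This picks out the strip with exactly `j` predecessors, whose line will block floor `j`. -/
theorem exists_strip_of_lt {j : ℕ} (h : j < T.strips t p q) :
    ∃ k, k < t ∧ T.Strip k p q ∧ T.strips k p q = j := by
  induction t with
  | zero => simp [strips_zero] at h
  | succ t ih =>
    by_cases h1 : T.Strip t p q
    · rw [strips_succ_of h1] at h
      rcases Nat.lt_or_ge j (T.strips t p q) with h2 | h2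
      · obtain ⟨k, hk, h3⟩ := ih h2
        exact ⟨k, by omega, h3⟩
      · exact ⟨t, by omega, h1, by omega⟩
    · rw [strips_succ_of_not h1] at h
      obtain ⟨k, hk, h3⟩ := ih h
      exact ⟨k, by omega, h3⟩

theorem strips_lt {t' : ℕ} (h : t < t') (hs : T.Strip t p q) :
    T.strips t p q < T.strips t' p q := by
  have := strips_succ_of hs
  have := strips_mono (T := T) (p := p) (q := q) (Nat.succ_le_of_lt h)
  simp only [Nat.succ_eq_add_one] at *
  omega

/-- The strips that start at an earlier label and meet the interior of `e` cover all of `e`. -/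
theorem strip_iff_of_subinterval {e : Edge lam} {k : ℕ} (hk : k ≤ T.label e + 1) (hp : e.up < p)
    (hpq : p ≤ q) (hq : q ≤ e.down) : T.Strip k p q ↔ T.Strip k e.up (e.down + 1) := by
  constructor
  · rintro ⟨a, b, ha, hb, h1, h2⟩
    refine ⟨a, b, ha, hb, ?_, ?_⟩
    · have := a.up_lt_down
      rcases Edge.cases a e with rfl | h | h | h | h
      · omega
      · have := h.2; omega
      · have := T.increasing _ _ h
        -- A descendant of `e` can only be the start if `k` is the next label; but then the strip
        -- ends at `e` itself.
        obtain rfl | h3 : k = T.label e + 1 ∨ k < T.label e + 1 := by omega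
        · have h3 : b = e := T.label_inj (by omega)
          subst h3; omega
        · omega
      · exact h
      · unfold Edge.IsLeft at h; omega
    · have := b.up_lt_down
      rcases Edge.cases b e with rfl | h | h | h | h
      · omega
      · have := h.1; omega
      · have := T.increasing _ _ h; omega
      · unfold Edge.IsLeft at h; omega
      · exact h
  · rintro ⟨a, b, ha, hb, h1, h2⟩
    exact ⟨a, b, ha, hb, by omega, by omega⟩

theorem strips_subinterval {e : Edge lam} (ht : t ≤ T.label e + 2) (hp : e.up < p)
    (hpq : p ≤ q) (hq : q ≤ e.down) : T.strips t p q = T.strips t e.up (e.down + 1) :=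
  strips_congr fun _ hk => strip_iff_of_subinterval (by omega) hp hpq hq

/-- For these two labels `e` would be the first or the last edge of the strip, and a strip lies
strictly between its end edges. -/
theorem not_strip_self {e : Edge lam} {k : ℕ} (h1 : T.label e ≤ k) (h2 : k ≤ T.label e + 1) :
    ¬ T.Strip k e.up (e.down + 1) := by
  rintro ⟨a, b, ha, hb, h3, h4⟩
  have := e.up_lt_down
  obtain h5 | h5 : k = T.label e ∨ k = T.label e + 1 := by omega
  · obtain rfl : a = e := T.label_inj (by omega)
    omega
  · obtain rfl : b = e := T.label_inj (by omega)
    omega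

variable (T) in
/-- The number of strips over the edge `e` that start at an earlier label. -/
noncomputable def floorOf (e : Edge lam) : ℕ := T.strips (T.label e) e.up (e.down + 1)

/-- The slack up to `T.label e + 2` is what makes the levels on both sides of the labelling of `e`
expressible by `floorOf e`. -/
theorem strips_eq_floorOf {e : Edge lam} (h1 : T.label e ≤ t) (h2 : t ≤ T.label e + 2) :
    T.strips t e.up (e.down + 1) = T.floorOf e :=
  strips_const h1 fun _ hk hkt => not_strip_self hk (by omega)

/-- A strip over an edge also passes over its descendants, and these count more starting labels. -/
theorem floorOf_le_of_isAbove {e e' : Edge lam} (h : e.IsAbove e') :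
    T.floorOf e ≤ T.floorOf e' := by
  have h1 := T.increasing _ _ h
  have := e'.up_lt_down
  refine le_trans ?_ (strips_mono h1.le)
  exact (strips_subinterval (by omega) h.1 (by omega) h.2).symm.le

theorem floorOf_le_strips {e : Edge lam} {x : ℕ} (h : e.Contains x) (ht : T.label e ≤ t) :
    T.floorOf e ≤ T.strips t x x :=
  le_trans (strips_subinterval (by omega) h.1 le_rfl h.2).symm.le (strips_mono ht)

end NaturalLabel

end Label

/-! ### The level of a line in a column -/

section Level

variable {lam : DyckWord}

/-- The height at `x` of the path `D⋯DU⋯U` with the same end points as `e`. -/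
def Edge.dip (e : Edge lam) (x : ℕ) : ℤ :=
  height lam e.up - min ((x : ℤ) - e.up) ((e.down : ℤ) + 1 - x)

/-- The column of the anchor boxes of `e`. -/
def Edge.mid (e : Edge lam) : ℕ := (e.up + e.down + 1) / 2

namespace Edge

theorem two_mul_mid (e : Edge lam) : 2 * e.mid = e.up + e.down + 1 := by
  obtain ⟨z, hz⟩ := e.even_sub
  unfold mid
  omega

theorem contains_mid (e : Edge lam) : e.Contains e.mid := by
  have := e.two_mul_mid
  have := e.up_lt_down
  constructor <;> omega

theorem anchor_eq (e : Edge lam) (p : ℕ) : e.anchor p = (e.mid, e.dip e.mid + 2 * p + 1) := by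
  have := e.two_mul_mid
  have := e.up_lt_down
  obtain ⟨z, hz⟩ := e.even_sub
  simp only [anchor, dip, Prod.mk.injEq]
  refine ⟨rfl, ?_⟩
  rw [min_eq_left (by omega)]
  omega

theorem dip_le (e : Edge lam) {x : ℕ} (h : e.Contains x) : e.dip x + 2 ≤ height lam x := by
  have h1 := e.height_lt x h.1 h.2
  have h2 := h.1
  have h3 := h.2
  unfold dip
  omega

/-- The ends of `e` lie at least one step further out and at least one unit lower than those of
`e'`; each contributes one to the difference of the bottom paths. -/
theorem dip_lt_of_isAbove {e e' : Edge lam} (h : e.IsAbove e') {x : ℕ} (hx : e'.Contains x) :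
    e.dip x + 2 ≤ e'.dip x := by
  have h1 := height_lt_of_isAbove h
  have h2 := (isPath_height lam).sub_le h.1.le e'.up_lt.le
  have h3 := (isPath_height lam).sub_le (x := e'.down + 1) (y := e.down + 1)
    (by have := h.2; omega) (by have := e.down_lt; omega)
  have := hx.1
  have := hx.2
  have := h.1
  have := h.2
  have := e.height_eq
  have := e'.height_eq
  have h4 := e.height_lt (e'.down + 1) (by omega) (by omega)
  unfold dip
  push_cast at *
  omega

end Edge

namespace NaturalLabel

variable (T : NaturalLabel lam)

/-- `E` is the edge closest to the root among those over `x` with a label of at least `t - 1`. -/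
structure IsTop (t x : ℕ) (E : Edge lam) : Prop where
  contains : E.Contains x
  le_label : t ≤ T.label E + 1
  above : ∀ e : Edge lam, e.IsAbove E → T.label e + 1 < t

/-- All edges over `x` have a label below `t - 1`. -/
def Exposed (t x : ℕ) : Prop := ∀ e : Edge lam, e.Contains x → T.label e + 1 < t

open Classical in
/-- The height of the box centre in column `x` on the line that starts from the label `t`. -/
noncomputable def level (t x : ℕ) : ℤ :=
  if h : ∃ E, T.IsTop t x E then
    h.choose.dip x + 2 * (T.strips t h.choose.up (h.choose.down + 1) : ℤ) + 1
  else height lam x + 2 * (T.strips t x x : ℤ) + 1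

variable {T} {t x : ℕ}

theorem IsTop.unique {E E' : Edge lam} (h : T.IsTop t x E) (h' : T.IsTop t x E') : E = E' := by
  rcases h.contains.cases h'.contains with h1 | h1 | h1
  · exact h1
  · have := h'.above _ h1; have := h.le_label; omega
  · have := h.above _ h1; have := h'.le_label; omega

theorem IsTop.not_exposed {E : Edge lam} (h : T.IsTop t x E) : ¬ T.Exposed t x := by
  intro h'
  have := h' E h.contains
  have := h.le_label
  omega

theorem exists_isTop {e : Edge lam} (he : e.Contains x) (ht : t ≤ T.label e + 1) :
    ∃ E, T.IsTop t x E ∧ (E = e ∨ E.IsAbove e) := by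
  obtain ⟨E, ⟨h1, h2, h3⟩, hmin⟩ := Set.exists_min_image
    {E : Edge lam | E.Contains x ∧ t ≤ T.label E + 1 ∧ (E = e ∨ E.IsAbove e)} Edge.up
    (Set.toFinite _) ⟨e, he, ht, Or.inl rfl⟩
  refine ⟨E, ⟨h1, h2, fun e' he' => ?_⟩, h3⟩
  by_contra hc
  have h4 := hmin e' ⟨he'.contains h1, by omega, Or.inr ?_⟩
  · have := he'.1; omega
  · rcases h3 with rfl | h3
    · exact he'
    · exact he'.trans h3

theorem isTop_or_exposed (T : NaturalLabel lam) (t x : ℕ) : (∃ E, T.IsTop t x E) ∨ T.Exposed t x := by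
  by_cases h : T.Exposed t x
  · exact Or.inr h
  · simp only [Exposed, not_forall] at h
    obtain ⟨e, he, ht⟩ := h
    obtain ⟨E, hE, -⟩ := exists_isTop (T := T) (t := t) he (by omega)
    exact Or.inl ⟨E, hE⟩

theorem IsTop.level_eq {E : Edge lam} (h : T.IsTop t x E) :
    T.level t x = E.dip x + 2 * (T.strips t E.up (E.down + 1) : ℤ) + 1 := by
  have hex : ∃ E, T.IsTop t x E := ⟨E, h⟩
  unfold level
  rw [dif_pos hex, hex.choose_spec.unique h]

theorem Exposed.level_eq (h : T.Exposed t x) :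
    T.level t x = height lam x + 2 * (T.strips t x x : ℤ) + 1 := by
  unfold level
  rw [dif_neg]
  rintro ⟨E, hE⟩
  exact hE.not_exposed h

/-- When the edge labelled `t - 1` lies over column `x`, the level jumps over boxes of its frozen
region. -/
theorem IsTop.level_succ_of_eq {E : Edge lam} (h : T.IsTop t x E) (ht : T.label E + 1 = t) :
    T.level t x = E.dip x + 2 * (T.floorOf E : ℤ) + 1 ∧ T.level t x + 2 ≤ T.level (t + 1) x ∧
      T.level (t + 1) x ≤ height lam x + 2 * (T.floorOf E : ℤ) + 1 := by
  have h0 := h.level_eq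
  rw [strips_eq_floorOf (by omega) (by omega)] at h0
  refine ⟨h0, ?_⟩
  rcases isTop_or_exposed T (t + 1) x with ⟨E', hE'⟩ | hex
  · have hab : E.IsAbove E' := by
      rcases h.contains.cases hE'.contains with rfl | h1 | h1
      · have := hE'.le_label; omega
      · exact h1
      · have := h.above _ h1; have := hE'.le_label; omega
    have h1 := hE'.level_eq
    have := E'.up_lt_down
    rw [strips_subinterval (e := E) (by omega) hab.1 (by omega) hab.2,
      strips_eq_floorOf (by omega) (by omega)] at h1
    have := Edge.dip_lt_of_isAbove hab hE'.contains
    have := E'.dip_le hE'.contains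
    omega
  · have h1 := hex.level_eq
    rw [strips_subinterval (e := E) (by omega) h.contains.1 le_rfl h.contains.2,
      strips_eq_floorOf (by omega) (by omega)] at h1
    have := E.dip_le h.contains
    omega

theorem IsTop.succ {E : Edge lam} (h : T.IsTop t x E) (ht : t ≤ T.label E) :
    T.IsTop (t + 1) x E :=
  ⟨h.contains, by omega, fun e he => (h.above e he).trans (Nat.lt_succ_self t)⟩

theorem Exposed.mono {t' : ℕ} (h : T.Exposed t x) (ht : t ≤ t') : T.Exposed t' x :=
  fun e he => (h e he).trans_le ht

theorem level_le_succ (T : NaturalLabel lam) (t x : ℕ) : T.level t x ≤ T.level (t + 1) x := by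
  rcases isTop_or_exposed T t x with ⟨E, hE⟩ | hex
  · rcases hE.le_label.lt_or_eq with h1 | h1
    · rw [hE.level_eq, (hE.succ (by omega)).level_eq]
      have := strips_mono (T := T) (p := E.up) (q := E.down + 1) (Nat.le_add_right t 1)
      omega
    · have := (hE.level_succ_of_eq h1.symm).2.1
      omega
  · rw [hex.level_eq, (hex.mono (Nat.le_add_right t 1)).level_eq]
    have := strips_mono (T := T) (p := x) (q := x) (Nat.le_add_right t 1)
    omega

theorem level_mono {t' : ℕ} (h : t ≤ t') : T.level t x ≤ T.level t' x := by
  induction t', h using Nat.le_induction with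
  | base => rfl
  | succ m _ ih => exact ih.trans (level_le_succ T m x)

variable (T) in
/-- Column `x` lies strictly between the columns of the labels `t` and `t - 1`, the label `t - 1`
being further right. -/
def OnLine (t x : ℕ) : Prop :=
  ∃ a b, T.label a = t ∧ T.label b + 1 = t ∧ a.IsLeft b ∧ a.mid < x ∧ x < b.mid

/-- The level of a line is strictly below that of the next one, except over the edge from which
the line starts. -/
theorem OnLine.level_succ (h : T.OnLine t x) : T.level t x + 2 ≤ T.level (t + 1) x ∨
    ∃ a, T.label a = t ∧ T.IsTop t x a := by
  obtain ⟨a, b, rfl, hb, hab, h1, h2⟩ := h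
  have hma := a.contains_mid
  have hmb := b.contains_mid
  have := hma.1
  have := hma.2
  have := hmb.1
  have := hmb.2
  rcases isTop_or_exposed T (T.label a) x with ⟨E, hE⟩ | hex
  · rcases hE.le_label.lt_or_eq with h3 | h3
    · by_cases hEa : E = a
      · subst hEa
        exact Or.inr ⟨E, rfl, hE⟩
      left
      rw [hE.level_eq, (hE.succ (by omega)).level_eq, strips_succ_of]
      · push_cast; omega
      have hEc := hE.contains
      rw [strip_iff hb]
      constructor
      · rcases Edge.cases a E with h | h | h | h | h
        · exact absurd h.symm hEa
        · have := hE.above _ h; omega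
        · have := T.increasing _ _ h; omega
        · exact h
        · unfold Edge.IsLeft at h; have := hEc.2; omega
      · rcases Edge.cases b E with h | h | h | h | h
        · subst h; omega
        · have := hE.above _ h; have := h.1; have := h.2; unfold Edge.IsLeft at hab
          have := hEc.1; have := hEc.2
          rcases Edge.cases a E with h | h | h | h | h
          · exact absurd h.symm hEa
          · have := hE.above _ h; omega
          · have := T.increasing _ _ h; omega
          · omega
          · unfold Edge.IsLeft at h; omega
        · have := T.increasing _ _ h; omega
        · unfold Edge.IsLeft at h; have := hEc.1; omega
        · exact h
    · exact Or.inl (hE.level_succ_of_eq h3.symm).2.1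
  · left
    have hexa : ¬ a.Contains x := fun h => by have := hex a h; omega
    have hexb : ¬ b.Contains x := fun h => by have := hex b h; omega
    rw [hex.level_eq, (hex.mono (Nat.le_add_right _ 1)).level_eq, strips_succ_of]
    · push_cast; omega
    rw [strip_iff hb]
    unfold Edge.Contains at hexa hexb
    omega

end NaturalLabel

end Level

/-! ### Levels as lattice paths with unit steps, and their separation -/

section Line

variable {lam : DyckWord}

namespace Edge

theorem dip_succ (e : Edge lam) (x : ℕ) :
    e.dip (x + 1) = e.dip x + 1 ∨ e.dip (x + 1) = e.dip x - 1 := by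
  obtain ⟨z, hz⟩ := e.even_sub
  unfold dip
  push_cast
  omega

theorem dip_of_le_mid (e : Edge lam) {x : ℕ} (h : x ≤ e.mid) :
    e.dip x = height lam e.up - ((x : ℤ) - e.up) := by
  have := e.two_mul_mid
  unfold dip
  omega

theorem dip_of_mid_le (e : Edge lam) {x : ℕ} (h : e.mid ≤ x) :
    e.dip x = height lam e.up - ((e.down : ℤ) + 1 - x) := by
  have := e.two_mul_mid
  unfold dip
  omega

end Edge

namespace NaturalLabel

variable {T : NaturalLabel lam} {t x : ℕ}

/-- Crossing an up step can lose only the strip that ends at this edge, and crossing a down step can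
gain only the strip that starts there. Twice such a change turns a unit step of `lam` into the
opposite unit step. -/
theorem strips_step {e : Edge lam} :
    (T.strips t (e.up + 1) (e.up + 1) ≤ T.strips t e.up e.up ∧
      T.strips t e.up e.up ≤ T.strips t (e.up + 1) (e.up + 1) + 1) ∧
    (T.strips t e.down e.down ≤ T.strips t (e.down + 1) (e.down + 1) ∧
      T.strips t (e.down + 1) (e.down + 1) ≤ T.strips t e.down e.down + 1) := by
  refine ⟨⟨strips_le ?_, strips_le_add_one (k₀ := T.label e + 1) ?_⟩,
    ⟨strips_le ?_, strips_le_add_one (k₀ := T.label e) ?_⟩⟩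
  · rintro k - ⟨a, b, ha, hb, h1, h2⟩
    have := e.up_ne_down a
    exact ⟨a, b, ha, hb, by omega, by omega⟩
  · rintro k - hk ⟨a, b, ha, hb, h1, h2⟩
    refine ⟨a, b, ha, hb, by omega, ?_⟩
    have : e.up ≠ b.up := fun h => hk (by rw [← hb, Edge.ext_up h])
    omega
  · rintro k - ⟨a, b, ha, hb, h1, h2⟩
    have := b.up_ne_down e
    exact ⟨a, b, ha, hb, by omega, by omega⟩
  · rintro k - hk ⟨a, b, ha, hb, h1, h2⟩
    refine ⟨a, b, ha, hb, ?_, by omega⟩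
    have : e.down ≠ a.down := fun h => hk (by rw [← ha, Edge.ext_down h])
    omega

theorem raised_step (T : NaturalLabel lam) (t : ℕ) {x : ℕ} (hx : x < 2 * lam.semilength) :
    height lam (x + 1) + 2 * (T.strips t (x + 1) (x + 1) : ℤ) =
        height lam x + 2 * (T.strips t x x : ℤ) + 1 ∨
      height lam (x + 1) + 2 * (T.strips t (x + 1) (x + 1) : ℤ) =
        height lam x + 2 * (T.strips t x x : ℤ) - 1 := by
  obtain ⟨e, rfl | rfl⟩ := Edge.exists_step hx
  · have := (strips_step (T := T) (t := t) (e := e)).1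
    have := e.height_up_succ
    omega
  · have := (strips_step (T := T) (t := t) (e := e)).2
    have := e.height_down_succ
    omega

/-- Raising the path `lam` by the strips gives a path. -/
theorem isPath_raised (T : NaturalLabel lam) (t : ℕ) :
    IsPath lam.semilength fun x => height lam x + 2 * (T.strips t x x : ℤ) where
  zero := by
    have : T.strips t 0 0 = T.strips 0 0 0 := strips_const (Nat.zero_le t) fun k _ _ => by
      rintro ⟨a, b, -, -, h, -⟩
      omega
    simp only [this, strips_zero, (isPath_height lam).zero]
    simp
  step _ hk := raised_step T t hk
  tail x hx := by
    have : T.strips t x x = T.strips 0 x x := strips_const (Nat.zero_le t) fun k _ _ => by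
      rintro ⟨a, b, -, -, -, h⟩
      have := b.up_lt
      omega
    simp only [this, strips_zero, (isPath_height lam).tail x hx]
    simp
  nonneg x := by
    have := (isPath_height lam).nonneg x
    omega

theorem exposed_of_gt (h : lam.semilength + 1 < t) : T.Exposed t x := fun e _ => by
  have := T.label_le e
  omega

/-- The formula for the level over a topmost edge holds up to its end points. -/
theorem level_eq_of_hull {E : Edge lam} (hl : t ≤ T.label E + 1)
    (hab : ∀ e : Edge lam, e.IsAbove E → T.label e + 1 < t) (h1 : E.up ≤ x) (h2 : x ≤ E.down + 1)
    (h3 : x = E.down + 1 → t ≤ T.label E) :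
    T.level t x = E.dip x + 2 * (T.strips t E.up (E.down + 1) : ℤ) + 1 := by
  have hud := E.up_lt_down
  by_cases hc : E.Contains x
  · exact (IsTop.mk hc hl hab).level_eq
  obtain rfl | rfl : x = E.up ∨ x = E.down + 1 := by
    unfold Edge.Contains at hc
    omega
  · have hex : T.Exposed t E.up := by
      intro e he
      rcases Edge.cases_up_lt e E he.1 with h | h
      · exact hab e h
      · unfold Edge.IsLeft at h; have := he.2; omega
    rw [hex.level_eq, strips_congr (p' := E.up) (q' := E.down + 1)]
    · unfold Edge.dip; omega
    rintro k hk
    constructor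
    · rintro ⟨a, b, ha, hb, h4, h5⟩
      refine ⟨a, b, ha, hb, h4, ?_⟩
      rcases Edge.cases b E with rfl | h | h | h | h
      · omega
      · have := h.1; omega
      · have := T.increasing _ _ h; omega
      · unfold Edge.IsLeft at h; have := b.up_lt_down; omega
      · exact h
    · rintro ⟨a, b, ha, hb, h4, h5⟩
      exact ⟨a, b, ha, hb, h4, by omega⟩
  · have h3 := h3 rfl
    have hex : T.Exposed t (E.down + 1) := by
      intro e he
      refine hab e ?_
      have h4 := e.up_ne_down E
      have h5 := he.1
      have h6 := he.2
      rcases Edge.cases e E with rfl | h | h | h | h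
      · omega
      · exact h
      · have := h.2; omega
      · unfold Edge.IsLeft at h; omega
      · unfold Edge.IsLeft at h; omega
    rw [hex.level_eq, strips_congr (p' := E.up) (q' := E.down + 1)]
    · have := E.height_eq
      unfold Edge.dip
      push_cast
      omega
    rintro k hk
    constructor
    · rintro ⟨a, b, ha, hb, h4, h5⟩
      refine ⟨a, b, ha, hb, ?_, h5⟩
      have := a.up_lt_down
      rcases Edge.cases a E with rfl | h | h | h | h
      · omega
      · have := h.2; omega
      · have := T.increasing _ _ h; omega
      · exact h
      · unfold Edge.IsLeft at h; omega
    · rintro ⟨a, b, ha, hb, h4, h5⟩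
      exact ⟨a, b, ha, hb, by omega, by omega⟩

theorem odd_level (T : NaturalLabel lam) (t : ℕ) {x : ℕ} (hx : x ≤ 2 * lam.semilength) :
    Odd ((x : ℤ) + T.level t x) := by
  rcases isTop_or_exposed T t x with ⟨E, hE⟩ | hex
  · obtain ⟨a, ha⟩ := (isPath_height lam).even_add E.up_lt.le
    obtain ⟨z, hz⟩ := E.even_sub
    rw [hE.level_eq]
    rcases le_total x E.mid with h | h
    · rw [E.dip_of_le_mid h]
      exact ⟨a + T.strips t E.up (E.down + 1), by omega⟩
    · rw [E.dip_of_mid_le h]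
      exact ⟨a - E.up + x - z + T.strips t E.up (E.down + 1), by omega⟩
  · obtain ⟨a, ha⟩ := (isPath_height lam).even_add hx
    rw [hex.level_eq]
    exact ⟨a + T.strips t x x, by omega⟩

/-- The exception in `OnLine.level_succ` is the edge labelled `t`; there the passage from `t + 1` to
`t + 2` jumps over a part of its frozen region. -/
theorem OnLine.level_add_two_le (h : T.OnLine t x) {t' : ℕ} (ht : t + 2 ≤ t') :
    T.level t x + 2 ≤ T.level t' x := by
  refine le_trans ?_ (level_mono ht)
  rcases h.level_succ with h1 | ⟨a, ha, h1⟩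
  · exact h1.trans (level_le_succ T _ x)
  · have h2 := (h1.succ ha.ge).level_succ_of_eq (by omega)
    have h3 := level_le_succ T t x
    change _ ≤ T.level (t + 1 + 1) x
    omega

theorem OnLine.lt_semilength (h : T.OnLine t x) : t ≤ lam.semilength ∧ x < 2 * lam.semilength := by
  obtain ⟨a, b, ha, hb, hab, h1, h2⟩ := h
  have := T.label_le a
  have := b.contains_mid.2
  have := b.down_lt
  omega

/-- Lines `t` and `t + 1` never share a column, since the second ends at the label from which the
first starts going right. All other pairs are separated by `OnLine.level_add_two_le`. -/
theorem OnLine.lt_of_lt {t' : ℕ} (h : T.OnLine t x) (h' : T.OnLine t' x) (ht : t < t') :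
    T.level t x + 2 ≤ T.level t' x := by
  rcases Nat.lt_or_ge (t + 1) t' with h1 | h1
  · exact h.level_add_two_le h1
  · obtain ⟨a, b, ha, hb, hab, h2, h3⟩ := h
    obtain ⟨a', b', ha', hb', hab', h4, h5⟩ := h'
    obtain rfl : a = b' := T.label_inj (by omega)
    omega

section Endpoints

variable {a b : Edge lam}

/-- Naturality bounds the labels above `a` only by that of `a`; the edge `b` must still be excluded,
and it is not above `a` because it lies to the right. -/
theorem isTop_start (hab : a.IsLeft b) (hb : T.label b + 1 = T.label a) {x : ℕ}
    (hx : a.Contains x) : T.IsTop (T.label a) x a := by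
  refine ⟨hx, by omega, fun e he => ?_⟩
  have h1 := T.increasing _ _ he
  have h2 : T.label e ≠ T.label b := by
    intro h
    obtain rfl := T.label_inj h
    have := he.1
    have := a.up_lt_down
    unfold Edge.IsLeft at hab
    omega
  omega

theorem isTop_finish (hb : T.label b + 1 = t) {x : ℕ} (hx : b.Contains x) : T.IsTop t x b :=
  ⟨hx, by omega, fun e he => by have := T.increasing _ _ he; omega⟩

theorem level_start (hab : a.IsLeft b) (hb : T.label b + 1 = T.label a) :
    T.level (T.label a) a.mid = a.dip a.mid + 2 * (T.floorOf a : ℤ) + 1 ∧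
      T.level (T.label a) (a.mid + 1) = T.level (T.label a) a.mid + 1 := by
  have h0 := isTop_start hab hb a.contains_mid
  have h1 := h0.level_eq
  have h2 := a.contains_mid
  have h3 := level_eq_of_hull (x := a.mid + 1) h0.le_label h0.above (by have := h2.1; omega)
    (by have := h2.2; omega) (by omega)
  rw [a.dip_of_mid_le le_rfl] at *
  rw [a.dip_of_mid_le (by omega)] at h3
  rw [strips_eq_floorOf (by omega) (by omega)] at *
  push_cast at *
  omega

theorem level_finish (hb : T.label b + 1 = t) :
    T.level t b.mid = b.dip b.mid + 2 * (T.floorOf b : ℤ) + 1 ∧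
      ∀ x, x + 1 = b.mid → T.level t x = T.level t b.mid + 1 := by
  have h0 := isTop_finish hb b.contains_mid
  have h1 := h0.level_eq
  have h2 := b.contains_mid
  have h4 := h2.1
  have h5 := h2.2
  rw [strips_eq_floorOf (by omega) (by omega)] at h1
  refine ⟨h1, fun x hx => ?_⟩
  have h3 := level_eq_of_hull (x := x) h0.le_label h0.above (by omega)
    (by omega) (by omega)
  rw [strips_eq_floorOf (by omega) (by omega)] at h3
  rw [b.dip_of_le_mid le_rfl] at h1
  rw [b.dip_of_le_mid (by omega)] at h3
  omega

/-- Let `e` be the edge owning step `x`. If its label is too small to be followed, so are those of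
all edges over `x` or `x + 1`, which are `e` or above `e`; the line then runs along the raised path.
Otherwise one topmost edge governs both columns, its end points included, and its bottom path has
unit steps. -/
theorem level_step (hb : T.label b + 1 = T.label a) {x : ℕ}
    (h2 : x < b.mid) : T.level (T.label a) (x + 1) = T.level (T.label a) x + 1 ∨
      T.level (T.label a) (x + 1) = T.level (T.label a) x - 1 := by
  have hbm := b.contains_mid.2
  have := b.down_lt
  obtain ⟨e, he⟩ := Edge.exists_step (lam := lam) (k := x) (by omega)
  have hud := e.up_lt_down
  by_cases hl : T.label e + 1 < T.label a
  · have key : ∀ c : Edge lam, c.Contains x ∨ c.Contains (x + 1) → c = e ∨ c.IsAbove e := by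
      intro c hc
      unfold Edge.Contains at hc
      have := c.up_ne_down e
      have := e.up_ne_down c
      rcases Edge.cases c e with h | h | h | h | h
      · exact Or.inl h
      · exact Or.inr h
      · have := h.1; have := h.2; omega
      · unfold Edge.IsLeft at h; omega
      · unfold Edge.IsLeft at h; omega
    have hex : ∀ c : Edge lam, c.Contains x ∨ c.Contains (x + 1) → T.label c + 1 < T.label a := by
      intro c hc
      rcases key c hc with rfl | h
      · exact hl
      · have := T.increasing _ _ h; omega
    have hex1 : T.Exposed (T.label a) x := fun c hc => hex c (Or.inl hc)
    have hex2 : T.Exposed (T.label a) (x + 1) := fun c hc => hex c (Or.inr hc)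
    rw [hex1.level_eq, hex2.level_eq]
    have := raised_step T (T.label a) (x := x) (by omega)
    omega
  · obtain ⟨E, hE, hEe⟩ := exists_isTop (T := T) (t := T.label a) (e := e) (x := e.down)
      ⟨hud, le_rfl⟩ (by omega)
    have hr : E.up ≤ x ∧ x ≤ E.down := by
      rcases hEe with rfl | h
      · omega
      · have := h.1; have := h.2; omega
    -- At its right end point the hull formula fails for the edge `b` in which the line ends, but
    -- the line stops at the middle of `b`.
    have hne : x = E.down → T.label a ≤ T.label E := by
      intro hx
      by_contra hc
      obtain rfl : b = E := T.label_inj (by have := hE.le_label; omega)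
      omega
    rw [level_eq_of_hull (x := x) hE.le_label hE.above (by omega) (by omega) (by omega),
      level_eq_of_hull (x := x + 1) hE.le_label hE.above (by omega) (by omega)
        (fun h => hne (by omega))]
    have := E.dip_succ x
    omega

end Endpoints

/-! ### Occupied boxes and free floors -/

variable (T) in
/-- The boxes on the lines that start from the labels below `i`. -/
def lineSet (i : ℕ) : Set Box := {b | ∃ k, k < i ∧ T.OnLine k b.1 ∧ b.2 = T.level k b.1}

/-- The two lines that may start or end at `e` stay out of its anchor column. Later lines pass above
it, having jumped over a frozen box. An earlier line follows the bottom path of `e` with a strictly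
smaller number of strips, or that of an edge above `e`, which is lower by at least two. -/
theorem anchor_not_mem_lineSet (e : Edge lam) (i : ℕ) :
    e.anchor (T.strips (min i (T.label e)) e.up (e.down + 1)) ∉ T.lineSet i := by
  rw [e.anchor_eq]
  rintro ⟨k, hk, hon, hlev⟩
  simp only at hon hlev
  have hm := e.contains_mid
  obtain ⟨a, b, ha, hb, hab, h1, h2⟩ := id hon
  have hka : k ≠ T.label e := by
    rintro rfl
    obtain rfl := T.label_inj ha
    omega
  have hkb : k ≠ T.label e + 1 := by
    rintro rfl
    obtain rfl : b = e := T.label_inj (by omega)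
    omega
  rcases Nat.lt_or_ge (T.label e) k with h | h
  · have h3 := (isTop_finish (t := T.label e + 1) rfl hm).level_succ_of_eq rfl
    have h4 := level_mono (T := T) (t := T.label e + 1 + 1) (t' := k) (x := e.mid) (by omega)
    rw [min_eq_right (by omega)] at hlev
    unfold floorOf at h3
    omega
  · obtain ⟨E, hE, rfl | hEe⟩ := exists_isTop (T := T) (t := k) hm (by omega)
    · rcases hon.level_succ with h3 | ⟨c, hc, h3⟩
      · rw [(hE.succ (by omega)).level_eq] at h3
        have := strips_mono (T := T) (p := E.up) (q := E.down + 1)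
          (show k + 1 ≤ min i (T.label E) by omega)
        omega
      · have := hE.unique h3
        subst this
        omega
    · have h3 := Edge.dip_lt_of_isAbove hEe hm
      have h4 := hE.le_label
      rw [hE.level_eq, ← strips_subinterval (p := e.up) (q := e.down + 1) (by omega) hEe.1
        (by have := e.up_lt_down; omega) hEe.2] at hlev
      have := strips_mono (T := T) (p := e.up) (q := e.down + 1)
          (show k ≤ min i (T.label e) by omega)
      omega

theorem Strip.onLine {k p q y : ℕ} (h : T.Strip k p q) (hp : p ≤ y) (hq : y ≤ q) :
    T.OnLine k y := by
  obtain ⟨a, b, ha, hb, h1, h2⟩ := h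
  have := a.contains_mid.2
  have := b.contains_mid.1
  exact ⟨a, b, ha, hb, by unfold Edge.IsLeft; omega, by omega, by omega⟩

/-- For a floor `p` below the claimed one, take the strip with exactly `p` predecessors. If `e` is
topmost for its line, this line occupies the anchor in floor `p`. Otherwise the topmost edge above
`e` has, by recursion, a free floor larger than `p`, and the monotonicity of free floors excludes
`p`. -/
theorem freeFloor_lineSet (T : NaturalLabel lam) (i : ℕ) (e : Edge lam) :
    e.freeFloor (T.lineSet i) = T.strips (min i (T.label e)) e.up (e.down + 1) := by
  have ih : ∀ e' : Edge lam, e'.IsAbove e → e'.freeFloor (T.lineSet i) =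
      T.strips (min i (T.label e')) e'.up (e'.down + 1) := fun e' h => freeFloor_lineSet T i e'
  rw [Edge.freeFloor]
  have hud := e.up_lt_down
  have hmem : T.strips (min i (T.label e)) e.up (e.down + 1) ∈
      {p | (∀ e' : Edge lam, e'.IsAbove e → e'.freeFloor (T.lineSet i) ≤ p) ∧
        e.anchor p ∉ T.lineSet i} := by
    refine ⟨fun e' he' => ?_, anchor_not_mem_lineSet e i⟩
    have h1 := T.increasing _ _ he'
    rw [ih e' he', ← strips_subinterval (p := e.up) (q := e.down + 1) (by omega) he'.1
      (by omega) he'.2]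
    exact strips_mono (by omega)
  refine le_antisymm (Nat.sInf_le hmem) (le_csInf ⟨_, hmem⟩ ?_)
  rintro p ⟨hp1, hp2⟩
  by_contra hc
  obtain ⟨k, hk, hs, hkp⟩ := exists_strip_of_lt (not_le.1 hc)
  have hm := e.contains_mid
  obtain ⟨E, hE, rfl | hEe⟩ := exists_isTop (T := T) (t := k) hm (by omega)
  · refine hp2 ?_
    rw [E.anchor_eq]
    refine ⟨k, by omega, hs.onLine hm.1.le (by have := hm.2; omega), ?_⟩
    simp only
    rw [hE.level_eq, hkp]
  · have h1 := hp1 E hEe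
    have h2 := hE.le_label
    rw [ih E hEe] at h1
    have hs' := (strip_iff_of_subinterval (p := e.up) (q := e.down + 1) (by omega) hEe.1
        (by omega) hEe.2).1 hs
    have h3 : k < T.label E := by
      by_contra hc'
      exact not_strip_self (by omega) (by omega) hs'
    have h4 := strips_lt (T := T) (show k < min i (T.label E) by omega) hs'
    rw [← strips_subinterval (p := e.up) (q := e.down + 1) (by omega) hEe.1
        (by omega) hEe.2, hkp] at h4
    omega
termination_by e.up
decreasing_by exact h.1

/-- If another edge is topmost, it has the same number of strips as `e` but a bottom path lower by
at least two. Hence a free anchor at or below a line lies on it, and its edge is topmost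
(`freeAnchor_isTop`). -/
theorem level_le_of_contains {e : Edge lam} (he : e.Contains x) (ht : t ≤ T.label e + 1) :
    T.IsTop t x e ∨ T.level t x + 2 ≤ e.dip x + 2 * (T.strips t e.up (e.down + 1) : ℤ) + 1 := by
  obtain ⟨E, hE, rfl | hEe⟩ := exists_isTop (T := T) he ht
  · exact Or.inl hE
  · right
    have h4 := hE.le_label
    rw [hE.level_eq, ← strips_subinterval (p := e.up) (q := e.down + 1) (by omega) hEe.1
      (by have := e.up_lt_down; omega) hEe.2]
    have := Edge.dip_lt_of_isAbove hEe he
    omega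

/-- A box between the first level and the level of line `i` is on an earlier line or lies in the
frozen region of an edge with an earlier label. -/
theorem mem_lineSet_or_frozen {i : ℕ} {y : ℤ} (hx : x ≤ 2 * lam.semilength)
    (hodd : Odd ((x : ℤ) + y)) (h1 : T.level 1 x ≤ y) (h2 : y < T.level i x) :
    (x, y) ∈ T.lineSet i ∨ ∃ e : Edge lam, T.label e < i ∧ (x, y) ∈ e.frozenRegion (T.floorOf e) := by
  -- Telescoping: `y` falls into the gap between two successive levels. Such a gap is a single box
  -- of line `t`, or it belongs to the frozen region of the edge labelled `t - 1`.
  have hex : ∃ t, t < i ∧ T.level t x ≤ y ∧ y < T.level (t + 1) x := by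
    have hi : 1 ≤ i := by
      by_contra hc
      obtain rfl : i = 0 := by omega
      have := level_le_succ T 0 x
      simp only [zero_add] at this
      omega
    clear hodd
    induction i, hi using Nat.le_induction with
    | base => omega
    | succ i hi ih =>
      rcases lt_or_ge y (T.level i x) with h | h
      · obtain ⟨t, ht, h3⟩ := ih h
        exact ⟨t, by omega, h3⟩
      · exact ⟨i, by omega, h, h2⟩
  obtain ⟨t, hti, h3, h4⟩ := hex
  obtain ⟨r, hr⟩ := hodd
  obtain ⟨r', hr'⟩ := odd_level T t hx
  obtain ⟨r'', hr''⟩ := odd_level T (t + 1) hx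
  rcases isTop_or_exposed T t x with ⟨E, hE⟩ | hex
  · have hc := hE.contains
    rcases hE.le_label.lt_or_eq with h5 | h5
    · left
      have h6 := hE.level_eq
      have h7 := (hE.succ (by omega)).level_eq
      by_cases hs : T.Strip t E.up (E.down + 1)
      · rw [strips_succ_of hs] at h7
        exact ⟨t, hti, hs.onLine hc.1.le (by have := hc.2; omega), by simp only; omega⟩
      · rw [strips_succ_of_not hs] at h7
        omega
    · right
      have h6 := hE.level_succ_of_eq h5.symm
      refine ⟨E, by omega, ⟨r, hr⟩, hc.1, hc.2, ?_, ?_⟩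
      · simp only; omega
      · have := h6.1
        unfold Edge.dip at this
        simp only; omega
  · left
    have h6 := hex.level_eq
    have h7 := (hex.mono (Nat.le_add_right t 1)).level_eq
    by_cases hs : T.Strip t x x
    · rw [strips_succ_of hs] at h7
      exact ⟨t, hti, hs.onLine le_rfl le_rfl, by simp only; omega⟩
    · rw [strips_succ_of_not hs] at h7
      omega

theorem strips_one {p q : ℕ} : T.strips 1 p q = 0 := by
  rw [← zero_add 1, strips_succ_of_not, strips_zero]
  rintro ⟨a, b, ha, hb, -⟩
  omega

/-- Before any strip, the topmost edges are those at the root, so the first level is the lowest row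
of boxes above the bottom path. -/
theorem level_one_le_of_mem_baseRegion {y : ℤ} (hx : x ≤ 2 * lam.semilength)
    (h : (x, y) ∈ baseRegion lam) :
    T.level 1 x ≤ y := by
  obtain ⟨-, -, h2⟩ := h
  have hn := (isPath_height lam).nonneg
  rcases isTop_or_exposed T 1 x with ⟨E, hE⟩ | hex
  · rw [hE.level_eq, strips_one]
    have h0 : height lam E.up = 0 := by
      by_contra hc
      obtain ⟨e, he⟩ := Edge.exists_isAbove (e := E) (by have := hn E.up; omega)
      have := hE.above e he
      omega
    have h3 := h2 E.up E.up_lt.le h0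
    have h4 := h2 (E.down + 1) (by have := E.down_lt; omega) (by rw [E.height_eq, h0])
    have h5 := hE.contains.1
    have h6 := hE.contains.2
    simp only at h3 h4
    rw [abs_of_nonneg (by omega)] at h3
    rw [abs_of_nonpos (by push_cast; omega)] at h4
    unfold Edge.dip
    push_cast at h4
    omega
  · rw [hex.level_eq, strips_one]
    have h0 : height lam x = 0 := by
      by_contra hc
      obtain ⟨e, he⟩ := Edge.exists_contains (lam := lam) (x := x) (by have := hn x; omega)
      have := hex e he
      omega
    have h3 := h2 x hx h0
    simp only [sub_self, abs_zero, neg_zero] at h3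
    omega

/-- From above, the line lies below the final level, hence under the raised path, which is a Dyck
path. From below, no return of `lam` to height `0` lies in the interior of the topmost edge, so its
bottom path is not lower than the bottom path of `lam`. -/
theorem OnLine.mem_baseRegion (h : T.OnLine t x) : (x, T.level t x) ∈ baseRegion lam := by
  obtain ⟨h1, h2⟩ := h.lt_semilength
  have hn := (isPath_height lam).nonneg
  refine ⟨odd_level T t h2.le, ?_, ?_⟩
  · have h3 := h.level_add_two_le (t' := lam.semilength + 2) (by omega)
    have h4 := (isPath_raised T (lam.semilength + 2)).le_min h2.le
    rw [(exposed_of_gt (t := lam.semilength + 2) (by omega)).level_eq] at h3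
    simp only at h4 ⊢
    omega
  · intro r hr h0
    simp only
    have habs : |(x : ℤ) - r| ≥ (x : ℤ) - r ∧ |(x : ℤ) - r| ≥ (r : ℤ) - x ∧ |(x : ℤ) - r| ≥ 0 :=
      ⟨le_abs_self _, by rw [abs_sub_comm]; exact le_abs_self _, abs_nonneg _⟩
    rcases isTop_or_exposed T t x with ⟨E, hE⟩ | hex
    · have h5 := hE.contains.1
      have h6 := hE.contains.2
      have h7 := hn E.up
      have h8 : r ≤ E.up ∨ E.down < r := by
        by_contra hc
        have := E.height_lt r (by omega) (by omega)
        omega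
      rw [hE.level_eq]
      unfold Edge.dip
      omega
    · rw [hex.level_eq]
      have := hn x
      omega

end NaturalLabel

end Line

/-! ### The tableau of a natural label -/

section Tableau

variable {lam : DyckWord}

namespace NaturalLabel

variable {T : NaturalLabel lam} {F : DyckTableau lam} {i : ℕ}

/-- The diagram `F` consists of the labels up to `i` and the lines of the labels below `j`. -/
structure Describes (T : NaturalLabel lam) (i j : ℕ) (F : DyckTableau lam) : Prop where
  label : F.label = T.label
  floor : ∀ e, T.label e ≤ i → F.floor e = T.floorOf e
  line : ∀ k, F.line k = {b | k < j ∧ T.OnLine k b.1 ∧ b.2 = T.level k b.1}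

namespace Describes

variable {j : ℕ}

theorem lineBoxes_eq (h : T.Describes i j F) : F.lineBoxes = T.lineSet j := by
  ext b
  simp only [DyckTableau.lineBoxes, lineSet, h.line, Set.mem_ofPred_eq]

theorem labeledBox_eq (h : T.Describes i j F) {e : Edge lam} (he : T.label e ≤ i) :
    F.labeledBox e = (e.mid, e.dip e.mid + 2 * (T.floorOf e : ℤ) + 1) := by
  rw [DyckTableau.labeledBox, h.floor e he, e.anchor_eq]

theorem freeAnchor_eq (h : T.Describes i j F) {e : Edge lam} (he : j ≤ T.label e) :
    F.freeAnchor e = (e.mid, e.dip e.mid + 2 * (T.strips j e.up (e.down + 1) : ℤ) + 1) := by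
  rw [DyckTableau.freeAnchor, h.lineBoxes_eq, freeFloor_lineSet, e.anchor_eq, min_eq_left he]

theorem freeAnchor_isTop (h : T.Describes i i F) {e : Edge lam} (he : i < T.label e) {x : ℕ} {y : ℤ}
    (hxy : (x, y) = F.freeAnchor e) (hy : y ≤ T.level i x) : y = T.level i x ∧ T.IsTop i x e := by
  rw [h.freeAnchor_eq (by omega), Prod.mk.injEq] at hxy
  obtain ⟨rfl, rfl⟩ := hxy
  rcases level_le_of_contains (T := T) e.contains_mid (t := i) (by omega) with h1 | h1
  · exact ⟨h1.level_eq.symm, h1⟩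
  · omega

variable {a b : Edge lam}

/-- The turning rules hold for the following reason. A free anchor met by the line belongs to the
topmost edge and is the centre of its bottom path, a `∨`-turn. Away from this centre the bottom path
is straight. In columns without a topmost edge the line runs above all boxes of the redefined frozen
region. -/
theorem isLine_level (h : T.Describes (T.label a) (T.label a) F) (hab : a.IsLeft b)
    (hb : T.label b + 1 = T.label a) : F.IsLine (T.label a) a b (T.level (T.label a)) := by
  have hla := h.labeledBox_eq (e := a) le_rfl
  have hlb := h.labeledBox_eq (e := b) (by omega)
  have hs := level_start hab hb
  have hf := level_finish hb
  have honl : ∀ x, a.mid < x → x < b.mid → T.OnLine (T.label a) x :=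
    fun x h1 h2 => ⟨a, b, rfl, hb, hab, h1, h2⟩
  have htop : ∀ x E, a.mid < x + 1 → x + 1 < b.mid → T.IsTop (T.label a) (x + 1) E →
      T.level (T.label a) x = E.dip x + 2 * (T.strips (T.label a) E.up (E.down + 1) : ℤ) + 1 ∧
      T.level (T.label a) (x + 1) =
        E.dip (x + 1) + 2 * (T.strips (T.label a) E.up (E.down + 1) : ℤ) + 1 ∧
      T.level (T.label a) (x + 2) =
        E.dip (x + 2) + 2 * (T.strips (T.label a) E.up (E.down + 1) : ℤ) + 1 := by
    intro x E h1 h2 hE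
    have h3 := hE.contains.1
    have h4 := hE.contains.2
    refine ⟨level_eq_of_hull hE.le_label hE.above (by omega) (by omega) (by omega), hE.level_eq,
      level_eq_of_hull hE.le_label hE.above (by omega) (by omega) fun h5 => ?_⟩
    by_contra hc
    obtain rfl : b = E := T.label_inj (by have := hE.le_label; omega)
    have := b.contains_mid.2
    omega
  constructor
  · rw [hla]
    exact ⟨hs.1, by simp only; rw [hs.2, hs.1]⟩
  · rw [hlb]
    refine ⟨hf.1, fun x hx => ?_⟩
    simp only at hx ⊢
    rw [hf.2 x hx, hf.1]
  · rw [hla, hlb]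
    intro x h1 h2
    exact level_step hb h2
  · rw [hla, hlb]
    intro x h1 h2
    exact (honl x h1 h2).mem_baseRegion
  · rw [hla, hlb]
    rintro x h1 h2 hx
    rw [h.lineBoxes_eq] at hx
    obtain ⟨k, hk, hon, hlev⟩ := hx
    change T.OnLine k x at hon
    change T.level _ x = T.level k x at hlev
    have := hon.lt_of_lt (honl x h1 h2) hk
    omega
  · rw [hla, hlb]
    rintro x h1 h2 k hk hx
    have h3 := anchor_not_mem_lineSet (T := T) k (T.label a + 1)
    rw [min_eq_right (by rw [h.label] at hk; omega)] at h3
    refine h3 ?_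
    rw [h.labeledBox_eq (by rw [h.label] at hk; exact hk)] at hx
    rw [k.anchor_eq]
    change (k.mid, k.dip k.mid + 2 * (T.floorOf k : ℤ) + 1) ∈ _
    rw [← hx]
    exact ⟨T.label a, by omega, honl x h1 h2, rfl⟩
  · rw [hla, hlb]
    intro x h1 h2 k hk hx
    rw [h.label] at hk
    simp only at h1 h2
    obtain ⟨-, h3⟩ := h.freeAnchor_isTop hk hx le_rfl
    obtain ⟨h4, h5, h6⟩ := htop x k (by omega) h2 h3
    rw [h.freeAnchor_eq hk.le, Prod.mk.injEq] at hx
    rw [k.dip_of_le_mid (by omega)] at h4 h5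
    rw [k.dip_of_mid_le (by omega)] at h6
    have := k.two_mul_mid
    push_cast at *
    omega
  · rw [hla, hlb]
    intro x h1 h2 hx hnf
    simp only at h1 h2
    rcases isTop_or_exposed T (T.label a) (x + 1) with ⟨E, hE⟩ | hex
    · obtain ⟨h4, h5, h6⟩ := htop x E (by omega) h2 hE
      by_cases hm : x + 1 = E.mid
      · exfalso
        have hEa : T.label a ≠ T.label E := fun h => by
          obtain rfl := T.label_inj h; omega
        have hEb : T.label b ≠ T.label E := fun h => by
          obtain rfl := T.label_inj h; omega
        have := hE.le_label
        refine hnf E (by rw [h.label]; omega) ?_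
        rw [h.freeAnchor_eq (by omega), ← hm, h5]
      · rcases Nat.lt_or_ge (x + 1) E.mid with hm' | hm'
        · rw [E.dip_of_le_mid (by omega)] at h4 h5 h6
          push_cast at *
          omega
        · rw [E.dip_of_mid_le (by omega)] at h4 h5 h6
          push_cast at *
          omega
    · exfalso
      have h4 := hex.level_eq
      obtain ⟨e, he⟩ | ⟨e, he, hef⟩ := hx
      · have h5 := he.2.2.2.1
        simp only at h5
        push_cast at h5
        omega
      · rw [h.label] at he
        rw [h.floor e he.le] at hef
        have h5 := hef.2.2.2.1
        have h6 := floorOf_le_strips (T := T) (e := e) (x := x + 1) (t := T.label a)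
          ⟨hef.2.1, hef.2.2.1⟩ he.le
        simp only at h5
        omega

/-- A competitor could fall below the level only by a south-east step. The box entered then lies in
a gap between earlier levels; it carries no line and is not a free anchor, so it is frozen and must
be crossed straight on. Since the level falls by at most one per step, the competitor stays below it
and keeps descending, and never reaches the label `b`. -/
theorem level_le_of_isLine (h : T.Describes (T.label a) (T.label a) F) (hab : a.IsLeft b)
    (hb : T.label b + 1 = T.label a) {L : ℕ → ℤ} (hL : F.IsLine (T.label a) a b L) {x : ℕ}
    (h1 : a.mid ≤ x) (h2 : x ≤ b.mid) : T.level (T.label a) x ≤ L x := by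
  have hla := h.labeledBox_eq (e := a) le_rfl
  have hlb := h.labeledBox_eq (e := b) (by omega)
  have hs := level_start hab hb
  have hf := level_finish hb
  have hbn := b.contains_mid.2
  have hbn' := b.down_lt
  obtain ⟨start, finish, steps, region, notLine, -, -, parallel⟩ := hL
  rw [hla] at start
  rw [hlb] at finish
  rw [hla, hlb] at steps region notLine parallel
  simp only at start finish steps region notLine parallel
  have stuck : ∀ z, a.mid ≤ z → L (z + 1) = L z - 1 → L (z + 1) ≤ T.level (T.label a) (z + 1) - 2 →
      z + 1 ≤ b.mid → False := by
    intro z hz hdown hlow hzb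
    have key : ∀ w, z ≤ w → w + 1 ≤ b.mid →
        L (w + 1) = L w - 1 ∧ L (w + 1) ≤ T.level (T.label a) (w + 1) - 2 := by
      intro w hw
      induction w, hw using Nat.le_induction with
      | base => exact fun _ => ⟨hdown, hlow⟩
      | succ w hw ih =>
        intro hwb
        obtain ⟨ih1, ih2⟩ := ih (by omega)
        have hreg := region (w + 1) (by omega) (by omega)
        have h3 := mem_lineSet_or_frozen (T := T) (i := T.label a) (x := w + 1) (y := L (w + 1))
          (by omega) hreg.1 (level_one_le_of_mem_baseRegion (by omega) hreg) (by omega)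
        rw [← h.lineBoxes_eq] at h3
        obtain ⟨e, he, hef⟩ := h3.resolve_left (notLine (w + 1) (by omega) (by omega))
        have h4 := parallel w (by omega) (by omega)
          (Or.inr ⟨e, by rw [h.label]; exact he, by rw [h.floor e he.le]; exact hef⟩)
          (fun k hk hkx => by
            have := (h.freeAnchor_isTop (by rw [h.label] at hk; exact hk) hkx (by omega)).1
            omega)
        have h5 := level_step hb (x := w + 1) (by omega)
        change L (w + 1 + 1) - _ = _ at h4
        omega
    have h3 := key (b.mid - 1) (by omega) (by omega)
    rw [Nat.sub_add_cancel (by omega)] at h3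
    have := finish.1
    have := hf.1
    omega
  -- Parity is carried along so that falling below means being at least two below, as `stuck`
  -- requires.
  have key : T.level (T.label a) x ≤ L x ∧ Even (L x - T.level (T.label a) x) := by
    induction x, h1 using Nat.le_induction with
    | base => rw [hs.1, start.1]; simp
    | succ x hx ih =>
      obtain ⟨ih1, r, hr⟩ := ih (by omega)
      have h3 := steps x (by omega) (by omega)
      have h4 := level_step hb (x := x) (by omega)
      have h5 : T.level (T.label a) (x + 1) ≤ L (x + 1) := by
        by_contra hc
        exact stuck x hx (by omega) (by omega) h2
      refine ⟨h5, ?_⟩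
      rcases h3 with h3 | h3 <;> rcases h4 with h4 | h4
      · exact ⟨r, by omega⟩
      · exact ⟨r + 1, by omega⟩
      · exact ⟨r - 1, by omega⟩
      · exact ⟨r, by omega⟩
  exact key.1

theorem lowestLine_eq (h : T.Describes i i F) :
    F.lowestLine i = {b | T.OnLine i b.1 ∧ b.2 = T.level i b.1} := by
  ext ⟨x, y⟩
  simp only [DyckTableau.lowestLine, Set.mem_ofPred_eq]
  constructor
  · rintro ⟨e, e', L, he, he', hl, hL, hmin, h1, h2, h3⟩
    rw [h.label] at he he'
    subst he
    rw [h.labeledBox_eq le_rfl] at h1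
    rw [h.labeledBox_eq (by omega)] at h2
    have h4 := h.level_le_of_isLine hl he' hL h1.le h2.le
    have h5 := hmin _ (h.isLine_level hl he') x
    rw [h.labeledBox_eq le_rfl, h.labeledBox_eq (e := e') (by omega)] at h5
    have h5 := h5 h1.le h2.le
    exact ⟨⟨e, e', rfl, he', hl, h1, h2⟩, by omega⟩
  · rintro ⟨⟨e, e', rfl, he', hl, h1, h2⟩, hy⟩
    refine ⟨e, e', T.level (T.label e), by rw [h.label], by rw [h.label, he'], hl,
      h.isLine_level hl he', ?_, ?_⟩
    · rw [h.labeledBox_eq le_rfl, h.labeledBox_eq (e := e') (by omega)]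
      intro L' hL' x h3 h4
      exact h.level_le_of_isLine hl he' hL' h3 h4
    · rw [h.labeledBox_eq le_rfl, h.labeledBox_eq (e := e') (by omega)]
      exact ⟨h1, h2, hy⟩

end Describes

/-- When label `i + 1` is put in, exactly the lines of smaller labels are present, so the free floor
computed at that moment is `floorOf`. -/
theorem describes_partialTableau (T : NaturalLabel lam) (i : ℕ) :
    T.Describes i (i + 1) (T.partialTableau i) := by
  induction i with
  | zero =>
    refine ⟨rfl, fun e he => ?_, fun k => ?_⟩
    · have := T.label_pos e
      omega
    · ext b
      simp only [partialTableau, Set.mem_empty_iff_false, Set.mem_ofPred_eq, false_iff]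
      rintro ⟨h1, ⟨a, b, ha, hb, -⟩, -⟩
      omega
  | succ i ih =>
    have h1 : T.Describes (i + 1) (i + 1) ((T.partialTableau i).putLabel (i + 1)) := by
      refine ⟨ih.label, fun e he => ?_, ih.line⟩
      simp only [DyckTableau.putLabel, ih.label]
      split_ifs with hl
      · rw [ih.lineBoxes_eq, freeFloor_lineSet, min_eq_right (by omega)]
        rfl
      · exact ih.floor e (by omega)
    refine ⟨h1.label, h1.floor, fun k => ?_⟩
    simp only [partialTableau, DyckTableau.putLine, Function.update_apply]
    split_ifs with hk
    · rw [h1.lowestLine_eq, hk]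
      ext b
      simp
    · rw [h1.line]
      ext b
      simp only [Set.mem_ofPred_eq]
      constructor
      · rintro ⟨h2, h3⟩; exact ⟨by omega, h3⟩
      · rintro ⟨h2, h3⟩; exact ⟨by omega, h3⟩

theorem describes_DTab (T : NaturalLabel lam) :
    T.Describes lam.semilength (lam.semilength + 1) (DTab T) :=
  describes_partialTableau T _

/-- The label of each edge is part of the data of a tableau. -/
theorem DTab_injective : Function.Injective (DTab : NaturalLabel lam → DyckTableau lam) := by
  intro T T' h
  have h1 := (describes_DTab T).label
  rw [h, (describes_DTab T').label] at h1
  exact NaturalLabel.ext h1.symm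

/-! ### The upper path -/

variable (T) in
/-- The number of strips over the point `x`. -/
noncomputable def stripCount (x : ℕ) : ℕ := T.strips (lam.semilength + 2) x x

theorem level_last (x : ℕ) :
    T.level (lam.semilength + 2) x = height lam x + 2 * (T.stripCount x : ℤ) + 1 :=
  (exposed_of_gt (t := lam.semilength + 2) (by omega)).level_eq

/-- A path that is nowhere below the labelled boxes and the lines is not below the raised path at
the peaks of the latter. -/
theorem raised_le_of_peak {f : ℕ → ℤ} (hlam : ∀ x, height lam x ≤ f x)
    (hbox : ∀ e : Edge lam, e.dip e.mid + 2 * (T.floorOf e : ℤ) + 2 ≤ f e.mid)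
    (hline : ∀ k x, T.OnLine k x → T.level k x + 1 ≤ f x) {x : ℕ} (hx : x + 1 < 2 * lam.semilength)
    (hup : height lam (x + 1) + 2 * (T.stripCount (x + 1) : ℤ) =
      height lam x + 2 * (T.stripCount x : ℤ) + 1)
    (hdown : height lam (x + 2) + 2 * (T.stripCount (x + 2) : ℤ) =
      height lam (x + 1) + 2 * (T.stripCount (x + 1) : ℤ) - 1) :
    height lam (x + 1) + 2 * (T.stripCount (x + 1) : ℤ) ≤ f (x + 1) := by
  rcases Nat.eq_zero_or_pos (T.stripCount (x + 1)) with h0 | h0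
  · rw [h0]
    have := hlam (x + 1)
    simpa using this
  -- This `k` is the last strip over the peak: all the others precede it.
  obtain ⟨k, hk, hs, hkc⟩ := exists_strip_of_lt
    (show T.stripCount (x + 1) - 1 < T.strips (lam.semilength + 2) (x + 1) (x + 1) from
      Nat.sub_lt h0 one_pos)
  have hmax : ∀ k', T.Strip k' (x + 1) (x + 1) → k' ≤ k := by
    intro k' hk'
    by_contra hc
    have h1 := strips_succ_of hs
    have h2 := strips_lt (t' := lam.semilength + 2) (T := T) (by
      obtain ⟨a, -, rfl, -⟩ := hk'
      have := T.label_le a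
      omega) hk'
    have h3 := strips_mono (T := T) (p := x + 1) (q := x + 1) (show k + 1 ≤ k' by omega)
    unfold stripCount at *
    omega
  by_cases hex : T.Exposed k (x + 1)
  · have h1 := hline k (x + 1) (hs.onLine le_rfl le_rfl)
    rw [hex.level_eq, hkc] at h1
    omega
  -- The line `k` may run lower than the peak here, because of an edge `E` over the peak. As `E` is
  -- not an end of the strip, its label exceeds `k`; the bound at the peak will come from a labelled
  -- box instead.
  simp only [Exposed, not_forall] at hex
  obtain ⟨E, hE, hEk⟩ := hex
  obtain ⟨a, b, ha, hb, h3, h4⟩ := id hs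
  have hEa : E ≠ a := by rintro rfl; have := hE.2; omega
  have hEb : E ≠ b := by rintro rfl; have := hE.1; omega
  have hEa' : T.label E ≠ T.label a := fun h => hEa (T.label_inj h)
  have hEb' : T.label E ≠ T.label b := fun h => hEb (T.label_inj h)
  have hnot : ∀ c : Edge lam, c.Contains (x + 1) → T.label E ≤ T.label c ∨ c.IsAbove E := by
    intro c hc
    rcases hE.cases hc with rfl | h | h
    · exact Or.inl le_rfl
    · exact Or.inl (T.increasing _ _ h).le
    · exact Or.inr h
  obtain ⟨e₁, he₁⟩ := Edge.exists_step (lam := lam) (k := x) (by omega)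
  obtain ⟨e₂, he₂⟩ := Edge.exists_step (lam := lam) (k := x + 1) (by omega)
  -- A down step of `lam` can become an up step of the raised path only if a strip starts at its
  -- edge. But `e₁` would be below `E`, with a label beyond that of the last strip.
  have hu : e₁.up = x := by
    rcases he₁ with h | rfl
    · exact h
    exfalso
    have h5 := e₁.height_down_succ
    have hnc : ¬ T.Strip (T.label e₁) (e₁.down + 1) (e₁.down + 1) := by
      intro hs'
      have h6 := hmax _ hs'
      have h7 := hE.1
      have h8 := hE.2
      have h9 := E.up_ne_down e₁
      rcases Edge.cases E e₁ with rfl | h | h | h | h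
      · omega
      · have := T.increasing _ _ h; omega
      · have := h.2; omega
      · unfold Edge.IsLeft at h; have := e₁.up_lt_down; omega
      · unfold Edge.IsLeft at h; omega
    have h6 : T.stripCount (e₁.down + 1) ≤ T.stripCount e₁.down := by
      refine strips_le ?_
      rintro k' - ⟨a', b', ha', hb', h7, h8⟩
      refine ⟨a', b', ha', hb', ?_, by omega⟩
      have : a'.down ≠ e₁.down := fun h => hnc (by
        rw [← Edge.ext_down h]
        exact ⟨a', b', rfl, by omega, by omega, by rw [h]; exact h8⟩)
      omega
    omega
  have hd : e₂.down = x + 1 := by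
    rcases he₂ with h | h
    swap
    · exact h
    exfalso
    have h5 := e₂.height_up_succ
    have hnc : ¬ T.Strip (T.label e₂ + 1) e₂.up e₂.up := by
      intro hs'
      rw [h] at hs'
      have h6 := hmax _ hs'
      have h7 := hE.1
      have h8 := hE.2
      have h9 := e₂.up_ne_down E
      rcases Edge.cases E e₂ with rfl | h' | h' | h' | h'
      · omega
      · have := T.increasing _ _ h'; omega
      · have := h'.1; omega
      · unfold Edge.IsLeft at h'; omega
      · unfold Edge.IsLeft at h'; have := e₂.up_lt_down; omega
    have h6 : T.stripCount e₂.up ≤ T.stripCount (e₂.up + 1) := by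
      refine strips_le ?_
      rintro k' - ⟨a', b', ha', hb', h7, h8⟩
      refine ⟨a', b', ha', hb', by omega, ?_⟩
      have : e₂.up ≠ b'.up := fun h => hnc (by
        rw [Edge.ext_up h]
        exact ⟨a', b', by omega, rfl, by rw [← h]; exact h7, le_rfl⟩)
      omega
    rw [h] at h5 h6
    change height lam (x + 2) = _ at h5
    change _ ≤ T.stripCount (x + 2) at h6
    omega
  -- An up step followed at once by a down step is a leaf, and its anchor column is that of the
  -- peak.
  have hee : e₁ = e₂ := by
    have := e₁.up_lt_down
    have := e₂.up_lt_down
    rcases Edge.cases e₁ e₂ with h | h | h | h | h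
    · exact h
    · have := h.1; omega
    · have := h.2; omega
    · unfold Edge.IsLeft at h; omega
    · unfold Edge.IsLeft at h; omega
  subst hee
  have hc₁ : e₁.Contains (x + 1) := ⟨by omega, by omega⟩
  have hlab : T.label E ≤ T.label e₁ := by
    rcases hnot e₁ hc₁ with h | h
    · exact h
    · have := h.1; have := h.2; have := hE.1; omega
  have hfl : T.stripCount (x + 1) ≤ T.floorOf e₁ := by
    have h5 := strips_subinterval (T := T) (t := k + 1) (e := e₁) (p := x + 1) (q := x + 1)
      (by omega) hc₁.1 le_rfl hc₁.2
    rw [strips_succ_of hs] at h5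
    have h6 := strips_mono (T := T) (p := e₁.up) (q := e₁.down + 1)
      (show k + 1 ≤ T.label e₁ by omega)
    unfold floorOf
    omega
  have h5 := hbox e₁
  have h6 := e₁.two_mul_mid
  have h7 : e₁.mid = x + 1 := by omega
  rw [e₁.dip_of_mid_le le_rfl, h7] at h5
  have h8 := e₁.height_down
  rw [hd] at h8 h5
  push_cast at h5
  omega

/-- Suppose an admissible path `f` is somewhere below the raised path `g`, and take the highest
point of `g` where this happens. At a higher neighbour `f` would be below `g` as well, so the point
is a peak of `g`, against `raised_le_of_peak`. Conversely `g` is admissible, since the final level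
exceeds every labelled box and every line. -/
theorem topPath_DTab (T : NaturalLabel lam) (x : ℕ) :
    (DTab T).topPath x = height lam x + 2 * (T.stripCount x : ℤ) := by
  have hd := describes_DTab T
  have hp := isPath_raised T (lam.semilength + 2)
  set g : ℕ → ℤ := fun x => height lam x + 2 * (T.strips (lam.semilength + 2) x x : ℤ) with hg
  have hlow : ∀ f, IsDyckPath lam.semilength f → (∀ z, height lam z ≤ f z) →
      (∀ e, ((DTab T).labeledBox e).2 + 1 ≤ f ((DTab T).labeledBox e).1) →
      (∀ b ∈ (DTab T).lineBoxes, b.2 + 1 ≤ f b.1) → ∀ z, g z ≤ f z := by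
    intro f hf hlam hbox hline
    rw [isDyckPath_iff] at hf
    have hbox' : ∀ e : Edge lam, e.dip e.mid + 2 * (T.floorOf e : ℤ) + 2 ≤ f e.mid := by
      intro e
      have := hbox e
      rw [hd.labeledBox_eq (T.label_le e)] at this
      simp only at this
      omega
    have hline' : ∀ k x, T.OnLine k x → T.level k x + 1 ≤ f x := by
      intro k x hon
      refine hline (x, T.level k x) ?_
      rw [hd.lineBoxes_eq]
      exact ⟨k, by have := hon.lt_semilength; omega, hon, rfl⟩
    by_contra hc
    push Not at hc
    obtain ⟨z, hz⟩ := hc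
    have hzn : z < 2 * lam.semilength := hp.lt_of_pos (by have := hf.nonneg z; omega)
    -- climb from `z` up to a peak of `g`
    obtain ⟨y, hy, hmax⟩ := Set.exists_max_image {y : ℕ | y ≤ 2 * lam.semilength ∧ f y < g y}
      (fun y => g y) ((Set.finite_Iic (2 * lam.semilength)).subset fun _ h => h.1) ⟨z, hzn.le, hz⟩
    have hgy : 0 < g y := by have := hf.nonneg y; have := hy.2; omega
    have hyn := hp.lt_of_pos hgy
    have hy0 : y ≠ 0 := by rintro rfl; have := hp.zero; omega
    obtain ⟨w, rfl⟩ : ∃ w, y = w + 1 := ⟨y - 1, by omega⟩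
    have h1 := hp.step w (by omega)
    have h2 := hp.step (w + 1) (by omega)
    have h3 := hf.step w (by omega)
    have h4 := hf.step (w + 1) (by omega)
    have h5 := hy.2
    have h6 : ¬ g w = g (w + 1) + 1 := fun h => by
      have h7 := hmax w ⟨by omega, by omega⟩
      omega
    have h8 : ¬ g (w + 1 + 1) = g (w + 1) + 1 := fun h => by
      have h7 := hmax (w + 1 + 1) ⟨by omega, by omega⟩
      omega
    have h9 := raised_le_of_peak (T := T) hlam hbox' hline' (x := w) (by omega)
      (by change g (w + 1) = g w + 1; omega) (by change g (w + 1 + 1) = g (w + 1) - 1; omega)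
    change g (w + 1) ≤ _ at h9
    omega
  have hmem : g x ∈ {y | ∃ f, IsDyckPath lam.semilength f ∧ (∀ z, height lam z ≤ f z) ∧
      (∀ e, ((DTab T).labeledBox e).2 + 1 ≤ f ((DTab T).labeledBox e).1) ∧
      (∀ b ∈ (DTab T).lineBoxes, b.2 + 1 ≤ f b.1) ∧ y = f x} := by
    refine ⟨g, isDyckPath_iff.2 hp, fun z => by simp only [hg]; omega, fun e => ?_, fun b hb => ?_,
      rfl⟩
    · rw [hd.labeledBox_eq (T.label_le e)]
      have h1 := (isTop_finish (t := T.label e + 1) rfl e.contains_mid).level_succ_of_eq rfl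
      have h2 := level_mono (T := T) (t := T.label e + 1 + 1) (t' := lam.semilength + 2)
        (x := e.mid) (by have := T.label_le e; omega)
      have h3 := level_last (T := T) e.mid
      change T.level _ _ = g e.mid + 1 at h3
      simp only
      omega
    · rw [hd.lineBoxes_eq] at hb
      obtain ⟨k, hk, hon, hlev⟩ := hb
      have h2 := hon.level_add_two_le (t' := lam.semilength + 2) (by omega)
      have h3 := level_last (T := T) b.1
      change T.level _ _ = g b.1 + 1 at h3
      omega
  have hbdd : g x ∈ lowerBounds {y | ∃ f, IsDyckPath lam.semilength f ∧ (∀ z, height lam z ≤ f z) ∧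
      (∀ e, ((DTab T).labeledBox e).2 + 1 ≤ f ((DTab T).labeledBox e).1) ∧
      (∀ b ∈ (DTab T).lineBoxes, b.2 + 1 ≤ f b.1) ∧ y = f x} := by
    rintro y ⟨f, hf, h1, h2, h3, rfl⟩
    exact hlow f hf h1 h2 h3 x
  exact (IsLeast.csInf_eq ⟨hmem, hbdd⟩)

end NaturalLabel

end Tableau

/-! ### Tilings described by heights and joints -/

/-- The boxes of level `j` in the columns from `a` to `b` over the path `low`. -/
def tileAt (low : ℕ → ℤ) (j a b : ℕ) : Set Box :=
  {p | a ≤ p.1 ∧ p.1 ≤ b ∧ p.2 = low p.1 + (2 * (j : ℤ) - 1)}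

/-- `v x` is the number of boxes in column `x`, and the boxes of level `j` in the columns `k` and
`k + 1` are joined when `j ≤ c k`: the boxes of level `j` from column `a` to column `b` are a maximal
joined set. -/
structure IsRun (v c : ℕ → ℕ) (j a b : ℕ) : Prop where
  one_le : 1 ≤ j
  le : a ≤ b
  le_count : j ≤ v a
  joined : ∀ k, a ≤ k → k < b → j ≤ c k
  left : ∀ k, k + 1 = a → c k < j
  right : c b < j

/-- The tiling with `v x` boxes in column `x`, joined as described by `c`. -/
def tilingOf (low : ℕ → ℤ) (v c : ℕ → ℕ) : Tiling where
  lower := low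
  upper := fun x => low x + 2 * (v x : ℤ)
  tiles := {t | ∃ j a b, IsRun v c j a b ∧ t = tileAt low j a b}

/-- The conditions under which `tilingOf low v c` is a cover-inclusive Dyck tiling. -/
structure Valid (n : ℕ) (low : ℕ → ℤ) (v c : ℕ → ℕ) : Prop where
  low_path : IsPath n low
  up_path : IsPath n fun x => low x + 2 * (v x : ℤ)
  left : ∀ k, c k ≤ v k
  right : ∀ k, c k ≤ v (k + 1)
  nest : ∀ a b, IsMatch low a b → ∀ k, a ≤ k → k ≤ b → c a ≤ c k ∧ c b ≤ c k

variable {n m : ℕ} {low : ℕ → ℤ} {v c : ℕ → ℕ}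

theorem mem_tileAt {j a b x : ℕ} {y : ℤ} :
    (x, y) ∈ tileAt low j a b ↔ a ≤ x ∧ x ≤ b ∧ y = low x + (2 * (j : ℤ) - 1) := Iff.rfl

theorem tileAt_self {j a : ℕ} : tileAt low j a a = {(a, low a + (2 * (j : ℤ) - 1))} := by
  ext ⟨x, y⟩
  rw [mem_tileAt, Set.mem_singleton_iff, Prod.mk.injEq]
  constructor
  · rintro ⟨h1, h2, h3⟩
    obtain rfl : x = a := by omega
    exact ⟨rfl, h3⟩
  · rintro ⟨rfl, rfl⟩
    exact ⟨le_rfl, le_rfl, rfl⟩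

theorem singleton_mem_tiles {s : ℕ} {y : ℤ} : ({((s, y) : Box)} : Set Box) ∈ (tilingOf low v c).tiles ↔
    ∃ j, IsRun v c j s s ∧ y = low s + (2 * (j : ℤ) - 1) := by
  constructor
  · rintro ⟨j, a, b, hr, ht⟩
    have h1 : ((a, low a + (2 * (j : ℤ) - 1)) : Box) ∈ ({((s, y) : Box)} : Set Box) := by
      rw [ht]; exact ⟨le_rfl, hr.le, rfl⟩
    have h2 : ((b, low b + (2 * (j : ℤ) - 1)) : Box) ∈ ({((s, y) : Box)} : Set Box) := by
      rw [ht]; exact ⟨hr.le, le_rfl, rfl⟩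
    simp only [Set.mem_singleton_iff, Prod.mk.injEq] at h1 h2
    obtain ⟨rfl, h3⟩ := h1
    obtain ⟨rfl, -⟩ := h2
    exact ⟨j, hr, h3.symm⟩
  · rintro ⟨j, hr, rfl⟩
    exact ⟨j, s, s, hr, tileAt_self.symm⟩

/-- Column `s` is eligible for the tiling `tilingOf low v c`. -/
theorem isEligible_tilingOf {s : ℕ} : (tilingOf low v c).IsEligible s ↔
    (∃ r, s = r + 1 ∧ low s + 2 * (v s : ℤ) = low r + 2 * (v r : ℤ) + 1) ∧
      (1 ≤ v s → v s ≤ c s ∨ ∃ k, k + 1 = s ∧ v s ≤ c k) := by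
  unfold Tiling.IsEligible
  refine and_congr Iff.rfl ?_
  rw [singleton_mem_tiles]
  constructor
  · intro h h1
    by_contra hc
    push Not at hc
    exact h ⟨v s, ⟨h1, le_rfl, le_rfl, fun k _ _ => by omega, fun k hk => hc.2 k hk,
      by omega⟩, by simp only [tilingOf]; omega⟩
  · rintro h ⟨j, hr, hj⟩
    simp only [tilingOf] at hj
    obtain rfl : j = v s := by omega
    have h2 := hr.right
    rcases h hr.one_le with h3 | ⟨k, hk, h3⟩
    · omega
    · have := hr.left k hk
      omega

theorem specialColumn_eq {D : Tiling} {s : ℕ} (h : D.IsEligible s)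
    (hmax : ∀ x, s < x → ¬ D.IsEligible x) : D.specialColumn = s :=
  IsGreatest.csSup_eq ⟨h, fun x hx => not_lt.1 fun hlt => hmax x hlt hx⟩

theorem specialColumn_eq_zero {D : Tiling} (h : ∀ x, ¬ D.IsEligible x) : D.specialColumn = 0 := by
  unfold Tiling.specialColumn
  rw [show {s | D.IsEligible s} = ∅ from Set.eq_empty_iff_forall_notMem.2 h]
  simp

/-! ### Spreads -/

/-- The numbers of boxes in the columns after a spread. -/
def spreadCount (m : ℕ) (v : ℕ → ℕ) (x : ℕ) : ℕ :=
  if x ≤ m then v x else if x = m + 1 then v m else v (x - 2)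

/-- The numbers of joined boxes after a spread. -/
def spreadJoint (m : ℕ) (v c : ℕ → ℕ) (k : ℕ) : ℕ :=
  if k < m then c k else if k < m + 2 then v m else c (k - 2)

theorem spreadPath_of_le {f : ℕ → ℤ} {x : ℕ} (h : x ≤ m) : spreadPath m f x = f x := if_pos h

theorem spreadPath_mid {f : ℕ → ℤ} : spreadPath m f (m + 1) = f m + 1 := by simp [spreadPath]

theorem spreadPath_add_two {f : ℕ → ℤ} {x : ℕ} (h : m ≤ x) : spreadPath m f (x + 2) = f x := by
  unfold spreadPath
  rw [if_neg (by omega), if_neg (by omega), Nat.add_sub_cancel]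

theorem spreadCount_of_le {x : ℕ} (h : x ≤ m) : spreadCount m v x = v x := if_pos h

theorem spreadCount_mid : spreadCount m v (m + 1) = v m := by simp [spreadCount]

theorem spreadCount_add_two {x : ℕ} (h : m ≤ x) : spreadCount m v (x + 2) = v x := by
  unfold spreadCount
  rw [if_neg (by omega), if_neg (by omega), Nat.add_sub_cancel]

theorem spreadJoint_of_lt {k : ℕ} (h : k < m) : spreadJoint m v c k = c k := if_pos h

theorem spreadJoint_mid {k : ℕ} (h1 : m ≤ k) (h2 : k < m + 2) : spreadJoint m v c k = v m := by
  unfold spreadJoint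
  rw [if_neg (by omega), if_pos h2]

theorem spreadJoint_add_two {k : ℕ} (h : m ≤ k) : spreadJoint m v c (k + 2) = c k := by
  unfold spreadJoint
  rw [if_neg (by omega), if_neg (by omega), Nat.add_sub_cancel]

theorem spread_cases (m x : ℕ) : x ≤ m ∨ x = m + 1 ∨ ∃ y, m ≤ y ∧ x = y + 2 := by
  rcases Nat.lt_or_ge x (m + 2) with h | h
  · omega
  · exact Or.inr (Or.inr ⟨x - 2, by omega, by omega⟩)

theorem spreadTile_tileAt_of_lt {j a b : ℕ} (hb : b < m) :
    spreadTile m (tileAt low j a b) = tileAt (spreadPath m low) j a b := by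
  ext ⟨x, y⟩
  simp only [spreadTile, Set.mem_union, Set.mem_ofPred_eq, mem_tileAt, Prod.mk.injEq, Prod.exists]
  constructor
  · rintro ((⟨⟨h1, h2, h3⟩, h4⟩ | ⟨x', y', ⟨h1, h2, h3⟩, h4, -, -⟩) | ⟨x', y', ⟨h1, h2, h3⟩, h4, -, -⟩)
    · exact ⟨h1, h2, by rw [spreadPath_of_le h4]; exact h3⟩
    · omega
    · omega
  · rintro ⟨h1, h2, h3⟩
    rw [spreadPath_of_le (by omega)] at h3
    exact Or.inl (Or.inl ⟨⟨h1, h2, h3⟩, by omega⟩)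

theorem spreadTile_tileAt_of_gt {j a b : ℕ} (ha : m < a) :
    spreadTile m (tileAt low j a b) = tileAt (spreadPath m low) j (a + 2) (b + 2) := by
  ext ⟨x, y⟩
  simp only [spreadTile, Set.mem_union, Set.mem_ofPred_eq, mem_tileAt, Prod.mk.injEq, Prod.exists]
  constructor
  · rintro ((⟨⟨h1, h2, h3⟩, h4⟩ | ⟨x', y', ⟨h1, h2, h3⟩, h4, rfl, rfl⟩) |
      ⟨x', y', ⟨h1, h2, h3⟩, h4, -, -⟩)
    · omega
    · exact ⟨by omega, by omega, by rw [spreadPath_add_two h4]; exact h3⟩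
    · omega
  · rintro ⟨h1, h2, h3⟩
    obtain ⟨z, rfl⟩ : ∃ z, x = z + 2 := ⟨x - 2, by omega⟩
    rw [spreadPath_add_two (by omega)] at h3
    exact Or.inl (Or.inr ⟨z, y, ⟨by omega, by omega, h3⟩, by omega, rfl, rfl⟩)

theorem spreadTile_tileAt_of_mem {j a b : ℕ} (ha : a ≤ m) (hb : m ≤ b) :
    spreadTile m (tileAt low j a b) = tileAt (spreadPath m low) j a (b + 2) := by
  ext ⟨x, y⟩
  simp only [spreadTile, Set.mem_union, Set.mem_ofPred_eq, mem_tileAt, Prod.mk.injEq, Prod.exists]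
  constructor
  · rintro ((⟨⟨h1, h2, h3⟩, h4⟩ | ⟨x', y', ⟨h1, h2, h3⟩, h4, rfl, rfl⟩) |
      ⟨x', y', ⟨h1, h2, h3⟩, rfl, rfl, rfl⟩)
    · exact ⟨by omega, by omega, by rw [spreadPath_of_le h4]; exact h3⟩
    · exact ⟨by omega, by omega, by rw [spreadPath_add_two h4]; exact h3⟩
    · exact ⟨by omega, by omega, by rw [spreadPath_mid]; omega⟩
  · rintro ⟨h1, h2, h3⟩
    rcases spread_cases m x with h | rfl | ⟨z, hz, rfl⟩
    · rw [spreadPath_of_le h] at h3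
      exact Or.inl (Or.inl ⟨⟨h1, by omega, h3⟩, h⟩)
    · rw [spreadPath_mid] at h3
      exact Or.inr ⟨m, low m + (2 * (j : ℤ) - 1), ⟨ha, hb, rfl⟩, rfl, rfl, by omega⟩
    · rw [spreadPath_add_two hz] at h3
      exact Or.inl (Or.inr ⟨z, y, ⟨by omega, by omega, h3⟩, hz, rfl, rfl⟩)

/-- A spread preserves the level of each box over the lower path: runs left of the cut stay, runs
right of it move by two columns, and runs through it gain two columns. -/
theorem spread_tilingOf (hr : ∀ k, c k ≤ v (k + 1)) :
    (tilingOf low v c).spread m =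
      tilingOf (spreadPath m low) (spreadCount m v) (spreadJoint m v c) := by
  refine Tiling.ext rfl (funext fun x => ?_) (Set.ext fun t => ?_)
  · simp only [Tiling.spread, tilingOf]
    rcases spread_cases m x with h | rfl | ⟨z, hz, rfl⟩
    · rw [spreadPath_of_le h, spreadPath_of_le h, spreadCount_of_le h]
    · rw [spreadPath_mid, spreadPath_mid, spreadCount_mid]; omega
    · rw [spreadPath_add_two hz, spreadPath_add_two hz, spreadCount_add_two hz]
  simp only [Tiling.spread, Set.mem_image]
  constructor
  · rintro ⟨_, ⟨j, a, b, ⟨h1, h2, h3, h4, h5, h6⟩, rfl⟩, rfl⟩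
    rcases Nat.lt_or_ge b m with hb | hb
    · refine ⟨j, a, b, ⟨h1, h2, ?_, ?_, ?_, ?_⟩, spreadTile_tileAt_of_lt hb⟩
      · rwa [spreadCount_of_le (by omega)]
      · intro k hk hkb
        rw [spreadJoint_of_lt (by omega)]
        exact h4 k hk hkb
      · intro k hk
        rw [spreadJoint_of_lt (by omega)]
        exact h5 k hk
      · rwa [spreadJoint_of_lt hb]
    rcases Nat.lt_or_ge m a with ha | ha
    · refine ⟨j, a + 2, b + 2, ⟨h1, by omega, ?_, ?_, ?_, ?_⟩, spreadTile_tileAt_of_gt ha⟩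
      · rwa [spreadCount_add_two ha.le]
      · intro k hk hkb
        obtain ⟨k, rfl⟩ : ∃ z, k = z + 2 := ⟨k - 2, by omega⟩
        rw [spreadJoint_add_two (by omega)]
        exact h4 k (by omega) (by omega)
      · intro k hk
        obtain ⟨k, rfl⟩ : ∃ z, k = z + 2 := ⟨k - 2, by omega⟩
        rw [spreadJoint_add_two (by omega)]
        exact h5 k (by omega)
      · rwa [spreadJoint_add_two hb]
    · have hjm : j ≤ v m := by
        rcases ha.lt_or_eq with h | rfl
        · have h7 := h4 (m - 1) (by omega) (by omega)
          have h8 := hr (m - 1)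
          rw [Nat.sub_add_cancel (by omega)] at h8
          omega
        · exact h3
      refine ⟨j, a, b + 2, ⟨h1, by omega, ?_, ?_, ?_, ?_⟩, spreadTile_tileAt_of_mem ha hb⟩
      · rwa [spreadCount_of_le ha]
      · intro k hk hkb
        rcases Nat.lt_or_ge k m with h | h
        · rw [spreadJoint_of_lt h]
          exact h4 k hk (by omega)
        rcases Nat.lt_or_ge k (m + 2) with h' | h'
        · rwa [spreadJoint_mid h h']
        · obtain ⟨k, rfl⟩ : ∃ z, k = z + 2 := ⟨k - 2, by omega⟩
          rw [spreadJoint_add_two (by omega)]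
          exact h4 k (by omega) (by omega)
      · intro k hk
        rw [spreadJoint_of_lt (by omega)]
        exact h5 k hk
      · rwa [spreadJoint_add_two hb]
  · rintro ⟨j, a, b, ⟨h1, h2, h3, h4, h5, h6⟩, rfl⟩
    -- After the spread, the columns `m`, `m + 1`, `m + 2` hold `v m` boxes each, joined at all
    -- levels, so a run contains all three columns or none.
    have hmid : (b < m ∨ m + 2 < a ∨ (a ≤ m ∧ m + 2 ≤ b)) := by
      by_contra hc
      by_cases hj : j ≤ v m
      · have h7 : ∀ k, m ≤ k → k < m + 2 → j ≤ spreadJoint m v c k := fun k hk hk' => by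
          rwa [spreadJoint_mid hk hk']
        have h8 : ¬ (m ≤ b ∧ b < m + 2) := fun h => by have := h7 b h.1 h.2; omega
        have h9 : ¬ (m + 1 ≤ a ∧ a < m + 3) := fun h => by
          have := h7 (a - 1) (by omega) (by omega)
          have := h5 (a - 1) (by omega)
          omega
        omega
      · have h7 : ∀ k, m ≤ k → k < m + 2 → spreadJoint m v c k < j := fun k hk hk' => by
          rw [spreadJoint_mid hk hk']; omega
        rcases Nat.lt_or_ge a m with h | h
        · have h8 := h4 (m - 1) (by omega) (by omega)
          rw [spreadJoint_of_lt (by omega)] at h8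
          have h9 := hr (m - 1)
          rw [Nat.sub_add_cancel (by omega)] at h9
          omega
        · rcases spread_cases m a with h' | rfl | ⟨z, hz, rfl⟩
          · obtain rfl : a = m := by omega
            rw [spreadCount_of_le le_rfl] at h3
            omega
          · rw [spreadCount_mid] at h3
            omega
          · rw [spreadCount_add_two hz] at h3
            obtain rfl : z = m := by omega
            omega
    rcases hmid with hb | ha | ⟨ha, hb⟩
    · refine ⟨_, ⟨j, a, b, ⟨h1, h2, ?_, ?_, ?_, ?_⟩, rfl⟩, spreadTile_tileAt_of_lt hb⟩
      · rwa [spreadCount_of_le (by omega)] at h3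
      · intro k hk hkb
        have := h4 k hk hkb
        rwa [spreadJoint_of_lt (by omega)] at this
      · intro k hk
        have := h5 k hk
        rwa [spreadJoint_of_lt (by omega)] at this
      · rwa [spreadJoint_of_lt hb] at h6
    · obtain ⟨a, rfl⟩ : ∃ z, a = z + 2 := ⟨a - 2, by omega⟩
      obtain ⟨b, rfl⟩ : ∃ z, b = z + 2 := ⟨b - 2, by omega⟩
      refine ⟨_, ⟨j, a, b, ⟨h1, by omega, ?_, ?_, ?_, ?_⟩, rfl⟩,
        spreadTile_tileAt_of_gt (by omega)⟩
      · rwa [spreadCount_add_two (by omega)] at h3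
      · intro k hk hkb
        have := h4 (k + 2) (by omega) (by omega)
        rwa [spreadJoint_add_two (by omega)] at this
      · intro k hk
        have := h5 (k + 2) (by omega)
        rwa [spreadJoint_add_two (by omega)] at this
      · rwa [spreadJoint_add_two (by omega)] at h6
    · obtain ⟨b, rfl⟩ : ∃ z, b = z + 2 := ⟨b - 2, by omega⟩
      refine ⟨_, ⟨j, a, b, ⟨h1, by omega, ?_, ?_, ?_, ?_⟩, rfl⟩,
        spreadTile_tileAt_of_mem ha (by omega)⟩
      · rwa [spreadCount_of_le ha] at h3
      · intro k hk hkb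
        rcases Nat.lt_or_ge k m with h | h
        · have := h4 k hk (by omega)
          rwa [spreadJoint_of_lt h] at this
        · have := h4 (k + 2) (by omega) (by omega)
          rwa [spreadJoint_add_two h] at this
      · intro k hk
        have := h5 k hk
        rwa [spreadJoint_of_lt (by omega)] at this
      · rwa [spreadJoint_add_two (by omega)] at h6

theorem IsPath.spread {f : ℕ → ℤ} (h : IsPath n f) (hm : m ≤ 2 * n) :
    IsPath (n + 1) (spreadPath m f) where
  zero := by rw [spreadPath_of_le (Nat.zero_le m), h.zero]
  step k hk := by
    rcases Nat.lt_or_ge k m with h1 | h1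
    · rw [spreadPath_of_le h1, spreadPath_of_le h1.le]
      exact h.step k (by omega)
    rcases spread_cases m k with h2 | rfl | ⟨z, hz, rfl⟩
    · obtain rfl : k = m := by omega
      rw [spreadPath_mid, spreadPath_of_le le_rfl]
      exact Or.inl rfl
    · rw [spreadPath_mid, spreadPath_add_two le_rfl]
      omega
    · rw [spreadPath_add_two hz, show z + 2 + 1 = z + 1 + 2 by omega, spreadPath_add_two (by omega)]
      exact h.step z (by omega)
  tail x hx := by
    obtain ⟨z, rfl⟩ : ∃ z, x = z + 2 := ⟨x - 2, by omega⟩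
    rw [spreadPath_add_two (by omega)]
    exact h.tail z (by omega)
  nonneg x := by
    rcases spread_cases m x with h2 | rfl | ⟨z, hz, rfl⟩
    · rw [spreadPath_of_le h2]; exact h.nonneg x
    · rw [spreadPath_mid]; have := h.nonneg m; omega
    · rw [spreadPath_add_two hz]; exact h.nonneg z

theorem spread_upper : (fun x => spreadPath m low x + 2 * (spreadCount m v x : ℤ)) =
    spreadPath m fun x => low x + 2 * (v x : ℤ) := by
  funext x
  rcases spread_cases m x with h | rfl | ⟨z, hz, rfl⟩
  · rw [spreadPath_of_le h, spreadPath_of_le h, spreadCount_of_le h]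
  · rw [spreadPath_mid, spreadPath_mid, spreadCount_mid]; omega
  · rw [spreadPath_add_two hz, spreadPath_add_two hz, spreadCount_add_two hz]

/-- The matched pairs of a path that was spread. -/
theorem IsMatch.of_spread {a b : ℕ} (h : IsMatch (spreadPath m low) a b) :
    (b < m ∧ IsMatch low a b) ∨ (a = m ∧ b = m + 1) ∨
    (a < m ∧ ∃ b', m ≤ b' ∧ b = b' + 2 ∧ IsMatch low a b') ∨
    ∃ a' b', m ≤ a' ∧ a = a' + 2 ∧ b = b' + 2 ∧ IsMatch low a' b' := by
  obtain ⟨h1, h2, h3⟩ := h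
  rcases spread_cases m a with ha | rfl | ⟨a, ha, rfl⟩
  · rw [spreadPath_of_le ha] at h2 h3
    rcases Nat.lt_or_ge b m with hb | hb
    · rw [spreadPath_of_le (by omega)] at h2
      refine Or.inl ⟨hb, h1, h2, fun k hk hkb => ?_⟩
      have := h3 k hk hkb
      rwa [spreadPath_of_le (by omega)] at this
    rcases ha.lt_or_eq with ha' | rfl
    · have h4 := h3 m ha' hb
      rw [spreadPath_of_le le_rfl] at h4
      rcases spread_cases m b with hb' | rfl | ⟨b, hb', rfl⟩
      · obtain rfl : b = m := by omega
        rw [spreadPath_mid] at h2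
        omega
      · rw [spreadPath_add_two le_rfl] at h2
        omega
      · refine Or.inr (Or.inr (Or.inl ⟨ha', b, hb', rfl, by omega, ?_, fun k hk hkb => ?_⟩))
        · rwa [show b + 2 + 1 = b + 1 + 2 by omega, spreadPath_add_two (by omega)] at h2
        · rcases Nat.lt_or_ge k m with hk' | hk'
          · have := h3 k hk (by omega)
            rwa [spreadPath_of_le (by omega)] at this
          · have := h3 (k + 2) (by omega) (by omega)
            rwa [spreadPath_add_two (by omega)] at this
    · refine Or.inr (Or.inl ⟨rfl, ?_⟩)
      by_contra hc
      have := h3 (a + 2) (by omega) (by omega)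
      rw [spreadPath_add_two le_rfl] at this
      omega
  · have := h3 (m + 2) (by omega) (by omega)
    rw [spreadPath_add_two le_rfl, spreadPath_mid] at this
    omega
  · obtain ⟨b, rfl⟩ : ∃ z, b = z + 2 := ⟨b - 2, by omega⟩
    rw [spreadPath_add_two ha] at h2 h3
    rw [show b + 2 + 1 = b + 1 + 2 by omega, spreadPath_add_two (by omega)] at h2
    refine Or.inr (Or.inr (Or.inr ⟨a, b, ha, rfl, rfl, by omega, h2, fun k hk hkb => ?_⟩))
    have := h3 (k + 2) (by omega) (by omega)
    rwa [spreadPath_add_two (by omega)] at this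

theorem Valid.spread (h : Valid n low v c) (hm : m ≤ 2 * n) :
    Valid (n + 1) (spreadPath m low) (spreadCount m v) (spreadJoint m v c) where
  low_path := h.low_path.spread hm
  up_path := by rw [spread_upper]; exact h.up_path.spread hm
  left k := by
    rcases Nat.lt_or_ge k m with h1 | h1
    · rw [spreadJoint_of_lt h1, spreadCount_of_le h1.le]; exact h.left k
    rcases spread_cases m k with h2 | rfl | ⟨z, hz, rfl⟩
    · rw [spreadJoint_mid h1 (by omega), spreadCount_of_le h2, le_antisymm h2 h1]
    · rw [spreadJoint_mid h1 (by omega), spreadCount_mid]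
    · rw [spreadJoint_add_two hz, spreadCount_add_two hz]; exact h.left z
  right k := by
    rcases Nat.lt_or_ge k m with h1 | h1
    · rw [spreadJoint_of_lt h1, spreadCount_of_le h1]; exact h.right k
    rcases spread_cases m k with h2 | rfl | ⟨z, hz, rfl⟩
    · obtain rfl : k = m := by omega
      rw [spreadJoint_mid h1 (by omega), spreadCount_mid]
    · rw [spreadJoint_mid h1 (by omega), spreadCount_add_two le_rfl]
    · rw [spreadJoint_add_two hz, show z + 2 + 1 = z + 1 + 2 by omega,
        spreadCount_add_two (by omega)]
      exact h.right z
  nest a b hab k hk hkb := by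
    rcases hab.of_spread with ⟨hb, hab'⟩ | ⟨rfl, rfl⟩ | ⟨ha, b, hb, rfl, hab'⟩ |
      ⟨a, b, ha, rfl, rfl, hab'⟩
    · rw [spreadJoint_of_lt (by omega), spreadJoint_of_lt (by omega), spreadJoint_of_lt (by omega)]
      exact h.nest a b hab' k hk hkb
    · rw [spreadJoint_mid (by omega) (by omega), spreadJoint_mid (by omega) (by omega),
        spreadJoint_mid (by omega) (by omega)]
      exact ⟨le_rfl, le_rfl⟩
    · rw [spreadJoint_of_lt ha, spreadJoint_add_two hb]
      rcases Nat.lt_or_ge k m with h1 | h1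
      · rw [spreadJoint_of_lt h1]
        exact h.nest a b hab' k hk (by omega)
      rcases Nat.lt_or_ge k (m + 2) with h2 | h2
      · rw [spreadJoint_mid h1 h2]
        have h3 := h.nest a b hab' m ha.le hb
        have h4 := h.left m
        omega
      · obtain ⟨k, rfl⟩ : ∃ z, k = z + 2 := ⟨k - 2, by omega⟩
        rw [spreadJoint_add_two (by omega)]
        exact h.nest a b hab' k (by omega) (by omega)
    · obtain ⟨k, rfl⟩ : ∃ z, k = z + 2 := ⟨k - 2, by omega⟩
      rw [spreadJoint_add_two ha, spreadJoint_add_two (by have := hab'.1; omega),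
        spreadJoint_add_two (by omega)]
      exact h.nest a b hab' k (by omega) (by omega)

theorem Valid.of_spread (h : Valid (n + 1) (spreadPath m low) (spreadCount m v) (spreadJoint m v c))
    (hm : m ≤ 2 * n) : Valid n low v c := by
  have hpath : ∀ f : ℕ → ℤ, IsPath (n + 1) (spreadPath m f) → IsPath n f := by
    intro f hf
    refine ⟨?_, fun k hk => ?_, fun x hx => ?_, fun x => ?_⟩
    · rw [← spreadPath_of_le (m := m) (f := f) (Nat.zero_le m), hf.zero]
    · rcases Nat.lt_or_ge k m with h1 | h1
      · have := hf.step k (by omega)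
        rwa [spreadPath_of_le h1, spreadPath_of_le h1.le] at this
      · have := hf.step (k + 2) (by omega)
        rwa [spreadPath_add_two h1, show k + 2 + 1 = k + 1 + 2 by omega,
          spreadPath_add_two (by omega)] at this
    · have := hf.tail (x + 2) (by omega)
      rwa [spreadPath_add_two (by omega)] at this
    · rcases le_total x m with h1 | h1
      · have := hf.nonneg x
        rwa [spreadPath_of_le h1] at this
      · have := hf.nonneg (x + 2)
        rwa [spreadPath_add_two h1] at this
  refine ⟨hpath _ h.low_path, hpath _ (by rw [← spread_upper]; exact h.up_path), fun k => ?_,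
    fun k => ?_, fun a b hab k hk hkb => ?_⟩
  · rcases Nat.lt_or_ge k m with h1 | h1
    · have := h.left k
      rwa [spreadJoint_of_lt h1, spreadCount_of_le h1.le] at this
    · have := h.left (k + 2)
      rwa [spreadJoint_add_two h1, spreadCount_add_two h1] at this
  · rcases Nat.lt_or_ge k m with h1 | h1
    · have := h.right k
      rwa [spreadJoint_of_lt h1, spreadCount_of_le h1] at this
    · have := h.right (k + 2)
      rwa [spreadJoint_add_two h1, show k + 2 + 1 = k + 1 + 2 by omega,
        spreadCount_add_two (by omega)] at this
  -- `σ` sends the number of an old step to its number after the spread; matched pairs go to matched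
  -- pairs.
  · set σ : ℕ → ℕ := fun k => if k < m then k else k + 2 with hσ
    have hσ' : ∀ k, (k < m ∧ σ k = k) ∨ (m ≤ k ∧ σ k = k + 2) := fun k => by
      simp only [hσ]; split_ifs <;> omega
    have hc : ∀ k, spreadJoint m v c (σ k) = c k := fun k => by
      rcases hσ' k with ⟨h1, h2⟩ | ⟨h1, h2⟩
      · rw [h2, spreadJoint_of_lt h1]
      · rw [h2, spreadJoint_add_two h1]
    have hl : ∀ k, spreadPath m low (σ k) = low k ∧ spreadPath m low (σ k + 1) = low (k + 1) := by
      intro k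
      rcases hσ' k with ⟨h1, h2⟩ | ⟨h1, h2⟩
      · rw [h2, spreadPath_of_le h1.le, spreadPath_of_le h1]; simp
      · rw [h2, spreadPath_add_two h1, show k + 2 + 1 = k + 1 + 2 by omega,
          spreadPath_add_two (by omega)]; simp
    have hmatch : IsMatch (spreadPath m low) (σ a) (σ b) := by
      obtain ⟨h1, h2, h3⟩ := hab
      have ha := hσ' a
      have hb := hσ' b
      refine ⟨by omega, by rw [(hl b).2, (hl a).1, h2], fun k hk hkb => ?_⟩
      rw [(hl a).1]
      rcases spread_cases m k with h4 | rfl | ⟨z, hz, rfl⟩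
      · rw [spreadPath_of_le h4]
        exact h3 k (by omega) (by omega)
      · rw [spreadPath_mid]
        rcases Nat.lt_or_ge a m with h5 | h5
        · have := h3 m h5 (by omega); omega
        · omega
      · rw [spreadPath_add_two hz]
        rcases Nat.lt_or_ge a z with h5 | h5
        · exact h3 z h5 (by omega)
        · omega
    have ha := hσ' a
    have hb := hσ' b
    have hk' := hσ' k
    have := h.nest _ _ hmatch (σ k) (by omega) (by omega)
    rwa [hc, hc, hc] at this

/-! ### Ribbon-growth -/

/-- One more box in each column strictly between `p` and `s`. -/
def growCount (p s : ℕ) (v : ℕ → ℕ) (x : ℕ) : ℕ := if p < x ∧ x < s then v x + 1 else v x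

/-- A new box has level `v x + 1`, above all joints on either side of its column. It is therefore a
run of one column without any change of `c`. -/
theorem ribbonGrowth_tilingOf (hl : ∀ k, c k ≤ v k) (hr : ∀ k, c k ≤ v (k + 1)) :
    (tilingOf low v c).ribbonGrowth m =
      tilingOf low (growCount (m + 1) (tilingOf low v c).specialColumn v) c := by
  generalize hs : (tilingOf low v c).specialColumn = s
  refine Tiling.ext rfl (funext fun x => ?_) (Set.ext fun t => ?_)
  · simp only [Tiling.ribbonGrowth, hs]
    simp only [tilingOf, growCount]
    split_ifs
    · push_cast; ring
    · rfl
  · simp only [Tiling.ribbonGrowth, hs, Set.mem_union, Set.mem_ofPred_eq]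
    constructor
    · rintro (⟨j, a, b, h, rfl⟩ | ⟨x, h1, h2, rfl⟩)
      · refine ⟨j, a, b, ⟨h.one_le, h.le, h.le_count.trans ?_, h.joined, h.left, h.right⟩, rfl⟩
        unfold growCount
        split_ifs <;> omega
      · refine ⟨v x + 1, x, x, ⟨by omega, le_rfl, ?_, fun k _ _ => by omega, fun k hk => ?_, ?_⟩, ?_⟩
        · unfold growCount
          rw [if_pos ⟨h1, h2⟩]
        · have := hr k
          rw [hk] at this
          omega
        · have := hl x
          omega
        · rw [tileAt_self]
          simp only [tilingOf]
          congr 2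
          push_cast
          ring
    · rintro ⟨j, a, b, h, rfl⟩
      by_cases hj : j ≤ v a
      · exact Or.inl ⟨j, a, b, ⟨h.one_le, h.le, hj, h.joined, h.left, h.right⟩, rfl⟩
      · have h1 := h.le_count
        unfold growCount at h1
        split_ifs at h1 with h2
        · have h3 : b = a := by
            by_contra hne
            have := h.joined a le_rfl (by have := h.le; omega)
            have := hl a
            omega
          subst h3
          refine Or.inr ⟨b, h2.1, h2.2, ?_⟩
          rw [tileAt_self]
          simp only [tilingOf]
          obtain rfl : j = v b + 1 := by omega
          congr 2
          push_cast
          ring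
        · exact absurd h1 hj

/-! ### Special columns -/

/-- `s` is the right-most eligible column, or `0` if no column is eligible. -/
def IsSpecial (D : Tiling) (s : ℕ) : Prop :=
  (D.IsEligible s ∨ s = 0) ∧ ∀ x, s < x → ¬ D.IsEligible x

theorem IsSpecial.specialColumn_eq {D : Tiling} {s : ℕ} (h : IsSpecial D s) :
    D.specialColumn = s := by
  rcases h.1 with h1 | rfl
  · exact DyckTableaux.specialColumn_eq h1 h.2
  · refine specialColumn_eq_zero fun x hx => ?_
    rcases Nat.eq_zero_or_pos x with rfl | h1
    · obtain ⟨⟨r, hr, -⟩, -⟩ := hx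
      omega
    · exact h.2 x h1 hx

section Special

variable {n m : ℕ} {low : ℕ → ℤ} {v c : ℕ → ℕ}

theorem Valid.lt_of_isEligible (h : Valid n low v c) {x : ℕ}
    (hx : (tilingOf low v c).IsEligible x) : 0 < x ∧ x < 2 * n := by
  obtain ⟨⟨r, rfl, hr⟩, -⟩ := hx
  refine ⟨by omega, h.up_path.lt_of_pos ?_⟩
  have := h.up_path.nonneg r
  beta_reduce at this ⊢
  simp only [tilingOf] at hr
  omega

theorem Valid.exists_isSpecial (h : Valid n low v c) :
    ∃ s, IsSpecial (tilingOf low v c) s := by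
  by_cases hne : ∃ s, (tilingOf low v c).IsEligible s
  · obtain ⟨s, hs, hmax⟩ := Set.exists_max_image {s | (tilingOf low v c).IsEligible s} id
      ((Set.finite_Iio (2 * n)).subset fun x hx => (h.lt_of_isEligible hx).2) hne
    exact ⟨s, Or.inl hs, fun x hx hex => by have := hmax x hex; simp only [id] at this; omega⟩
  · push Not at hne
    exact ⟨0, Or.inr rfl, fun x _ => hne x⟩

theorem isEligible_spread_mid :
    (tilingOf (spreadPath m low) (spreadCount m v) (spreadJoint m v c)).IsEligible (m + 1) := by
  rw [isEligible_tilingOf]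
  refine ⟨⟨m, rfl, ?_⟩, fun _ => Or.inl ?_⟩
  · rw [spreadPath_mid, spreadCount_mid, spreadPath_of_le le_rfl, spreadCount_of_le le_rfl]
    omega
  · rw [spreadCount_mid, spreadJoint_mid (by omega) (by omega)]

theorem isEligible_spread_add_two {y : ℕ} (hy : m < y) :
    (tilingOf (spreadPath m low) (spreadCount m v) (spreadJoint m v c)).IsEligible (y + 2) ↔
      (tilingOf low v c).IsEligible y := by
  obtain ⟨y, rfl⟩ : ∃ z, y = z + 1 := ⟨y - 1, by omega⟩
  have h1 : spreadPath m low (y + 1 + 2) = low (y + 1) := spreadPath_add_two (by omega)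
  have h2 : spreadCount m v (y + 1 + 2) = v (y + 1) := spreadCount_add_two (by omega)
  have h3 : spreadPath m low (y + 2) = low y := spreadPath_add_two (by omega)
  have h4 : spreadCount m v (y + 2) = v y := spreadCount_add_two (by omega)
  have h5 : spreadJoint m v c (y + 1 + 2) = c (y + 1) := spreadJoint_add_two (by omega)
  have h6 : spreadJoint m v c (y + 2) = c y := spreadJoint_add_two (by omega)
  rw [isEligible_tilingOf, isEligible_tilingOf]
  refine and_congr ?_ ?_
  · constructor
    · rintro ⟨r, hr, h⟩
      obtain rfl : r = y + 2 := by omega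
      exact ⟨y, rfl, by rw [h1, h2, h3, h4] at h; exact h⟩
    · rintro ⟨r, hr, h⟩
      obtain rfl : r = y := by omega
      exact ⟨r + 2, rfl, by rw [h1, h2, h3, h4]; exact h⟩
  · rw [h2, h5]
    refine imp_congr Iff.rfl (or_congr Iff.rfl ?_)
    constructor
    · rintro ⟨r, hr, h⟩
      obtain rfl : r = y + 2 := by omega
      exact ⟨y, rfl, by rwa [h6] at h⟩
    · rintro ⟨r, hr, h⟩
      obtain rfl : r = y := by omega
      exact ⟨r + 2, rfl, by rwa [h6]⟩

theorem not_isEligible_spread_two :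
    ¬ (tilingOf (spreadPath m low) (spreadCount m v) (spreadJoint m v c)).IsEligible (m + 2) := by
  rw [isEligible_tilingOf]
  rintro ⟨⟨r, hr, h⟩, -⟩
  obtain rfl : r = m + 1 := by omega
  rw [spreadPath_mid, spreadCount_mid, spreadPath_add_two le_rfl, spreadCount_add_two le_rfl] at h
  omega

/-- Eligible columns right of the cut move by two. Column `m + 1` becomes eligible, all its boxes
being joined, while `m + 2` ends a down step. So `m + 1` is special unless the old special column
lies right of the cut. -/
theorem IsSpecial.spread {s : ℕ} (h : IsSpecial (tilingOf low v c) s) :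
    IsSpecial (tilingOf (spreadPath m low) (spreadCount m v) (spreadJoint m v c))
      (if s ≤ m then m + 1 else s + 2) := by
  have key : ∀ x, m + 1 < x → s + 2 < x →
      ¬ (tilingOf (spreadPath m low) (spreadCount m v) (spreadJoint m v c)).IsEligible x := by
    intro x h1 h2
    rcases spread_cases m x with h3 | h3 | ⟨z, hz, rfl⟩
    · omega
    · omega
    · rcases hz.lt_or_eq with h4 | rfl
      · rw [isEligible_spread_add_two h4]
        exact h.2 z (by omega)
      · exact not_isEligible_spread_two
  split_ifs with hs
  · refine ⟨Or.inl isEligible_spread_mid, fun x hx => ?_⟩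
    rcases Nat.lt_or_ge (m + 2) x with h1 | h1
    · exact key x hx (by omega)
    · obtain rfl : x = m + 2 := by omega
      exact not_isEligible_spread_two
  · refine ⟨Or.inl ?_, fun x hx => key x (by omega) hx⟩
    rw [isEligible_spread_add_two (by omega)]
    exact h.1.resolve_right (by omega)

/-- A ribbon of boxes from the up step ending on `x = p`, followed by a down step, to the up step
ending on the special column. -/
theorem Valid.grow (h : Valid n low v c) {p s : ℕ} (hp : (tilingOf low v c).IsEligible p)
    (hdown : low (p + 1) + 2 * (v (p + 1) : ℤ) = low p + 2 * (v p : ℤ) - 1)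
    (hs : IsSpecial (tilingOf low v c) s) :
    Valid n low (growCount p s v) c ∧ IsSpecial (tilingOf low (growCount p s v) c) p := by
  have hps : p ≤ s := not_lt.1 fun hlt => hs.2 p hlt hp
  have hp0 := h.lt_of_isEligible hp
  have hes : (tilingOf low v c).IsEligible s := hs.1.resolve_right (by omega)
  have hs2 := (h.lt_of_isEligible hes).2
  obtain ⟨⟨r, rfl, hr⟩, hes2⟩ := isEligible_tilingOf.1 hes
  have hge : ∀ x, v x ≤ growCount p (r + 1) v x := fun x => by
    unfold growCount; split_ifs <;> omega
  have hg : ∀ x, (p < x ∧ x < r + 1 ∧ growCount p (r + 1) v x = v x + 1) ∨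
      ((x ≤ p ∨ r + 1 ≤ x) ∧ growCount p (r + 1) v x = v x) := fun x => by
    unfold growCount; split_ifs <;> omega
  refine ⟨⟨h.low_path, ⟨?_, fun k hk => ?_, fun x hx => ?_, fun x => ?_⟩,
    fun k => (h.left k).trans (hge k), fun k => (h.right k).trans (hge _), h.nest⟩, Or.inl ?_,
    fun x hx => ?_⟩
  · have h1 := h.up_path.zero
    have h2 := hg 0
    beta_reduce at h1 ⊢
    rw [(h2.resolve_left (by omega)).2, h1]
  · have h1 := h.up_path.step k hk
    have h2 := hg k
    have h3 := hg (k + 1)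
    beta_reduce at h1 ⊢
    -- A nonempty ribbon changes the upper path's steps only at its two ends: the down step after
    -- `p` turns up, and the up step ending on the special column turns down.
    have h4 : k = p → low (k + 1) + 2 * (v (k + 1) : ℤ) = low k + 2 * (v k : ℤ) - 1 := by
      rintro rfl; exact hdown
    have h5 : k = r → low (k + 1) + 2 * (v (k + 1) : ℤ) = low k + 2 * (v k : ℤ) + 1 := by
      rintro rfl; exact hr
    omega
  · have h1 := h.up_path.tail x hx
    beta_reduce at h1 ⊢
    rw [((hg x).resolve_left (by omega)).2, h1]
  · have h1 := h.up_path.nonneg x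
    have := hge x
    beta_reduce at h1 ⊢
    omega
  · obtain ⟨⟨q, rfl, hq⟩, hp2⟩ := isEligible_tilingOf.1 hp
    rw [isEligible_tilingOf, ((hg (q + 1)).resolve_left (by omega)).2]
    exact ⟨⟨q, rfl, by rw [((hg q).resolve_left (by omega)).2]; exact hq⟩, hp2⟩
  · rw [isEligible_tilingOf]
    rintro ⟨⟨q, rfl, hq⟩, hx2⟩
    have h1 := hg q
    have h2 := hg (q + 1)
    -- Inside the ribbon each column is topped by a new single box, the step at its right end now
    -- goes down, and further right nothing has changed.
    rcases Nat.lt_or_ge q (r + 1) with h3 | h3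
    · rcases Nat.lt_or_ge q r with h4 | h4
      · have h5 : growCount p (r + 1) v (q + 1) = v (q + 1) + 1 := by omega
        rw [h5] at hx2
        have := h.left (q + 1)
        rcases hx2 (by omega) with h6 | ⟨k, hk, h6⟩
        · omega
        · have := h.right k
          rw [hk] at this
          omega
      · obtain rfl : q = r := by omega
        rcases Nat.lt_or_ge p q with h5 | h5
        · omega
        · obtain rfl : p = q := by omega
          omega
    · refine hs.2 (q + 1) (by omega) ?_
      rw [isEligible_tilingOf]
      have h4 : growCount p (r + 1) v (q + 1) = v (q + 1) := by omega
      have h5 : growCount p (r + 1) v q = v q := by omega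
      rw [h4] at hx2 hq
      rw [h5] at hq
      exact ⟨⟨q, rfl, hq⟩, hx2⟩

/-- One insertion: a spread at `x = m` followed by the ribbon-growth. -/
theorem Valid.insert (h : Valid n low v c) (hm : m ≤ 2 * n) {s : ℕ}
    (hs : IsSpecial (tilingOf low v c) s) :
    ((tilingOf low v c).spread m).ribbonGrowth m = tilingOf (spreadPath m low)
      (growCount (m + 1) (if s ≤ m then m + 1 else s + 2) (spreadCount m v))
      (spreadJoint m v c) ∧
    Valid (n + 1) (spreadPath m low)
      (growCount (m + 1) (if s ≤ m then m + 1 else s + 2) (spreadCount m v))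
      (spreadJoint m v c) ∧
    IsSpecial (tilingOf (spreadPath m low)
      (growCount (m + 1) (if s ≤ m then m + 1 else s + 2) (spreadCount m v))
      (spreadJoint m v c)) (m + 1) := by
  have h1 := h.spread hm
  have h2 := hs.spread (m := m)
  refine ⟨?_, h1.grow isEligible_spread_mid ?_ h2⟩
  · rw [spread_tilingOf h.right, ribbonGrowth_tilingOf h1.left h1.right, h2.specialColumn_eq]
  · rw [spreadPath_mid, spreadCount_mid, show m + 1 + 1 = m + 2 by rfl, spreadPath_add_two le_rfl,
      spreadCount_add_two le_rfl]
    omega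

end Special

/-! ### Steps of a set of edges -/

section Steps

variable {lam : DyckWord}

/-- The number of steps before the line `x` that belong to edges in `S`. -/
noncomputable def stepCount (S : Set (Edge lam)) (x : ℕ) : ℕ :=
  {e | e ∈ S ∧ e.up < x}.ncard + {e | e ∈ S ∧ e.down < x}.ncard

/-- The height at `x` when only the steps of edges in `S` are counted. -/
noncomputable def partialHeight (S : Set (Edge lam)) (x : ℕ) : ℤ :=
  {e | e ∈ S ∧ e.up < x}.ncard - {e | e ∈ S ∧ e.down < x}.ncard

variable {S : Set (Edge lam)} {x y : ℕ}

theorem stepCount_mono (h : x ≤ y) : stepCount S x ≤ stepCount S y :=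
  add_le_add (Set.ncard_le_ncard fun _ he => ⟨he.1, by have := he.2; omega⟩)
    (Set.ncard_le_ncard fun _ he => ⟨he.1, by have := he.2; omega⟩)

theorem ncard_up_succ {e : Edge lam} (he : e ∈ S) :
    {e' | e' ∈ S ∧ e'.up < e.up + 1}.ncard = {e' | e' ∈ S ∧ e'.up < e.up}.ncard + 1 := by
  rw [← Set.ncard_insert_of_notMem (a := e) (fun h => lt_irrefl _ h.2)]
  congr 1
  ext e'
  simp only [Set.mem_ofPred_eq, Set.mem_insert_iff]
  constructor
  · rintro ⟨h1, h2⟩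
    rcases (Nat.lt_succ_iff.1 h2).lt_or_eq with h3 | h3
    · exact Or.inr ⟨h1, h3⟩
    · exact Or.inl (Edge.ext_up h3)
  · rintro (rfl | ⟨h1, h2⟩)
    · exact ⟨he, Nat.lt_succ_self _⟩
    · exact ⟨h1, by omega⟩

theorem ncard_down_succ {e : Edge lam} (he : e ∈ S) :
    {e' | e' ∈ S ∧ e'.down < e.down + 1}.ncard = {e' | e' ∈ S ∧ e'.down < e.down}.ncard + 1 := by
  rw [← Set.ncard_insert_of_notMem (a := e) (fun h => lt_irrefl _ h.2)]
  congr 1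
  ext e'
  simp only [Set.mem_ofPred_eq, Set.mem_insert_iff]
  constructor
  · rintro ⟨h1, h2⟩
    rcases (Nat.lt_succ_iff.1 h2).lt_or_eq with h3 | h3
    · exact Or.inr ⟨h1, h3⟩
    · exact Or.inl (Edge.ext_down h3)
  · rintro (rfl | ⟨h1, h2⟩)
    · exact ⟨he, Nat.lt_succ_self _⟩
    · exact ⟨h1, by omega⟩

theorem setOf_up_lt_congr (hxy : x ≤ y) (h : ∀ e ∈ S, x ≤ e.up → y ≤ e.up) :
    {e | e ∈ S ∧ e.up < y} = {e | e ∈ S ∧ e.up < x} := by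
  ext e
  simp only [Set.mem_ofPred_eq, and_congr_right_iff]
  intro he
  have := h e he
  omega

theorem setOf_down_lt_congr (hxy : x ≤ y) (h : ∀ e ∈ S, x ≤ e.down → y ≤ e.down) :
    {e | e ∈ S ∧ e.down < y} = {e | e ∈ S ∧ e.down < x} := by
  ext e
  simp only [Set.mem_ofPred_eq, and_congr_right_iff]
  intro he
  have := h e he
  omega

theorem stepCount_up_succ {e : Edge lam} (he : e ∈ S) :
    stepCount S (e.up + 1) = stepCount S e.up + 1 ∧
      partialHeight S (e.up + 1) = partialHeight S e.up + 1 := by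
  have h1 : {e' | e' ∈ S ∧ e'.down < e.up + 1} = {e' | e' ∈ S ∧ e'.down < e.up} :=
    setOf_down_lt_congr (Nat.le_succ _) fun e' _ h => by have := e.up_ne_down e'; omega
  unfold stepCount partialHeight
  rw [h1, ncard_up_succ he]
  push_cast
  omega

theorem stepCount_down_succ {e : Edge lam} (he : e ∈ S) :
    stepCount S (e.down + 1) = stepCount S e.down + 1 ∧
      partialHeight S (e.down + 1) = partialHeight S e.down - 1 := by
  have h1 : {e' | e' ∈ S ∧ e'.up < e.down + 1} = {e' | e' ∈ S ∧ e'.up < e.down} :=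
    setOf_up_lt_congr (Nat.le_succ _) fun e' _ h => by have := e'.up_ne_down e; omega
  unfold stepCount partialHeight
  rw [h1, ncard_down_succ he]
  push_cast
  omega

theorem stepCount_congr (hxy : x ≤ y) (hup : ∀ e ∈ S, x ≤ e.up → y ≤ e.up)
    (hdown : ∀ e ∈ S, x ≤ e.down → y ≤ e.down) : stepCount S y = stepCount S x := by
  unfold stepCount
  rw [setOf_up_lt_congr hxy hup, setOf_down_lt_congr hxy hdown]

theorem stepCount_zero : stepCount S 0 = 0 ∧ partialHeight S 0 = 0 := by
  simp [stepCount, partialHeight]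

theorem stepCount_univ (hx : x ≤ 2 * lam.semilength) :
    stepCount (Set.univ : Set (Edge lam)) x = x ∧
      partialHeight (Set.univ : Set (Edge lam)) x = height lam x := by
  induction x with
  | zero => exact ⟨stepCount_zero.1, by rw [stepCount_zero.2, (isPath_height lam).zero]⟩
  | succ x ih =>
    obtain ⟨ih1, ih2⟩ := ih (by omega)
    obtain ⟨e, rfl | rfl⟩ := Edge.exists_step (lam := lam) (k := x) (by omega)
    · rw [(stepCount_up_succ (Set.mem_univ e)).1, (stepCount_up_succ (Set.mem_univ e)).2, ih1, ih2,
        e.height_up_succ]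
      exact ⟨rfl, rfl⟩
    · rw [(stepCount_down_succ (Set.mem_univ e)).1, (stepCount_down_succ (Set.mem_univ e)).2, ih1,
        ih2, e.height_down_succ]
      exact ⟨rfl, rfl⟩

theorem stepCount_insert {e : Edge lam} (he : e ∉ S) :
    (x ≤ e.up → stepCount (insert e S) x = stepCount S x ∧
      partialHeight (insert e S) x = partialHeight S x) ∧
    (e.up < x → x ≤ e.down → stepCount (insert e S) x = stepCount S x + 1 ∧
      partialHeight (insert e S) x = partialHeight S x + 1) ∧
    (e.down < x → stepCount (insert e S) x = stepCount S x + 2 ∧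
      partialHeight (insert e S) x = partialHeight S x) := by
  have hud := e.up_lt_down
  have hu1 : e.up < x →
      {e' | e' ∈ insert e S ∧ e'.up < x}.ncard = {e' | e' ∈ S ∧ e'.up < x}.ncard + 1 := by
    intro h
    rw [← Set.ncard_insert_of_notMem (a := e) (fun h => he h.1)]
    congr 1
    ext e'
    simp only [Set.mem_ofPred_eq, Set.mem_insert_iff]
    constructor
    · rintro ⟨rfl | h1, h2⟩ <;> simp [*]
    · rintro (rfl | h1) <;> simp [*]
  have hu2 : ¬ e.up < x → {e' | e' ∈ insert e S ∧ e'.up < x} = {e' | e' ∈ S ∧ e'.up < x} := by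
    intro h
    ext e'
    simp only [Set.mem_ofPred_eq, Set.mem_insert_iff]
    constructor
    · rintro ⟨rfl | h1, h2⟩
      · exact absurd h2 h
      · exact ⟨h1, h2⟩
    · rintro ⟨h1, h2⟩
      exact ⟨Or.inr h1, h2⟩
  have hd1 : e.down < x →
      {e' | e' ∈ insert e S ∧ e'.down < x}.ncard = {e' | e' ∈ S ∧ e'.down < x}.ncard + 1 := by
    intro h
    rw [← Set.ncard_insert_of_notMem (a := e) (fun h => he h.1)]
    congr 1
    ext e'
    simp only [Set.mem_ofPred_eq, Set.mem_insert_iff]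
    constructor
    · rintro ⟨rfl | h1, h2⟩ <;> simp [*]
    · rintro (rfl | h1) <;> simp [*]
  have hd2 : ¬ e.down < x → {e' | e' ∈ insert e S ∧ e'.down < x} = {e' | e' ∈ S ∧ e'.down < x} := by
    intro h
    ext e'
    simp only [Set.mem_ofPred_eq, Set.mem_insert_iff]
    constructor
    · rintro ⟨rfl | h1, h2⟩
      · exact absurd h2 h
      · exact ⟨h1, h2⟩
    · rintro ⟨h1, h2⟩
      exact ⟨Or.inr h1, h2⟩
  unfold stepCount partialHeight
  refine ⟨fun h => ?_, fun h1 h2 => ?_, fun h => ?_⟩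
  · rw [hu2 (by omega), hd2 (by omega)]; exact ⟨rfl, rfl⟩
  · rw [hu1 h1, hd2 (by omega)]; push_cast; omega
  · rw [hu1 (by omega), hd1 h]; push_cast; omega

end Steps

/-! ### The ribbon tiling of a natural label -/

section Ribbon

variable {lam : DyckWord}

namespace NaturalLabel

variable {T : NaturalLabel lam} {i x : ℕ}

/-- An edge left of `e` has both steps before `e.up`, and an edge above `e` has one; the latter
automatically has a smaller label. So the history records the position of the new up step among the
steps already present. -/
theorem insertionHistory_eq (T : NaturalLabel lam) (e : Edge lam) :
    T.insertionHistory (T.label e) = stepCount {e' | T.label e' < T.label e} e.up := by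
  have h1 : {e' : Edge lam | ∃ e₀, T.label e₀ = T.label e ∧ e'.IsLeft e₀ ∧ T.label e' < T.label e} =
      {e' | e' ∈ {e' | T.label e' < T.label e} ∧ e'.down < e.up} := by
    ext e'
    constructor
    · rintro ⟨e₀, h, h1, h2⟩
      obtain rfl := T.label_inj h
      exact ⟨h2, h1⟩
    · rintro ⟨h1, h2⟩
      exact ⟨e, rfl, h2, h1⟩
  have h2 : {e' | e' ∈ {e' | T.label e' < T.label e} ∧ e'.up < e.up} =
      {e' | e' ∈ {e' | T.label e' < T.label e} ∧ e'.down < e.up} ∪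
        {e' : Edge lam | ∃ e₀, T.label e₀ = T.label e ∧ e'.IsAbove e₀} := by
    ext e'
    constructor
    · rintro ⟨h1, h2⟩
      rcases Edge.cases_up_lt e' e h2 with h | h
      · exact Or.inr ⟨e, rfl, h⟩
      · exact Or.inl ⟨h1, h⟩
    · rintro (⟨h3, h4⟩ | ⟨e₀, h, h3⟩)
      · exact ⟨h3, e'.up_lt_down.trans h4⟩
      · obtain rfl := T.label_inj h
        exact ⟨T.increasing _ _ h3, h3.1⟩
  have h3 : Disjoint {e' | e' ∈ {e' | T.label e' < T.label e} ∧ e'.down < e.up}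
        {e' : Edge lam | ∃ e₀, T.label e₀ = T.label e ∧ e'.IsAbove e₀} := by
    rw [Set.disjoint_left]
    rintro e' ⟨-, h3⟩ ⟨e₀, h, h4⟩
    obtain rfl := T.label_inj h
    have := h4.2
    have := e₀.up_lt_down
    omega
  unfold insertionHistory stepCount
  rw [h1, h2, Set.ncard_union_eq h3]
  ring

variable (T) in
/-- The edges with a label of at most `i`. -/
def initial (i : ℕ) : Set (Edge lam) := {e | T.label e < i + 1}

theorem initial_zero : T.initial 0 = ∅ :=
  Set.eq_empty_iff_forall_notMem.2 fun e (he : T.label e < 0 + 1) => by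
    have := T.label_pos e
    omega

theorem initial_succ {e : Edge lam} (he : T.label e = i + 1) :
    T.initial (i + 1) = insert e (T.initial i) := by
  ext e'
  simp only [initial, Set.mem_ofPred_eq, Set.mem_insert_iff]
  constructor
  · intro h
    by_cases h1 : T.label e' = i + 1
    · exact Or.inl (T.label_inj (h1.trans he.symm))
    · exact Or.inr (by omega)
  · rintro (rfl | h) <;> omega

theorem not_mem_initial {e : Edge lam} (he : T.label e = i + 1) : e ∉ T.initial i := by
  simp only [initial, Set.mem_ofPred_eq]
  omega

theorem stepCount_initial_le (hi : i ≤ lam.semilength) : stepCount (T.initial i) x ≤ 2 * i := by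
  induction i with
  | zero =>
    simp [stepCount, initial_zero]
  | succ i ih =>
    obtain ⟨e, he⟩ := T.exists_label (i := i + 1) (by omega) hi
    have h1 := stepCount_insert (x := x) (T.not_mem_initial he)
    have h2 := ih (by omega)
    rw [initial_succ he]
    rcases le_or_gt x e.up with h | h
    · have := (h1.1 h).1; omega
    · rcases le_or_gt x e.down with h' | h'
      · have := (h1.2.1 h h').1; omega
      · have := (h1.2.2 h').1; omega

/-- The edges inside `e` are its descendants, and these are inserted later. -/
theorem stepCount_initial_const {e : Edge lam} (he : T.label e = i + 1) (h1 : e.up ≤ x)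
    (h2 : x ≤ e.down + 1) : stepCount (T.initial i) x = stepCount (T.initial i) e.up := by
  have hud := e.up_lt_down
  have hlt : ∀ e' ∈ T.initial i, T.label e' < i + 1 := fun _ h => h
  refine stepCount_congr h1 (fun e' he' h => ?_) (fun e' he' h => ?_)
  · have h3 := hlt e' he'
    rcases Edge.cases e' e with rfl | h4 | h4 | h4 | h4
    · omega
    · have := h4.1; omega
    · have := T.increasing _ _ h4; omega
    · unfold Edge.IsLeft at h4; have := e'.up_lt_down; omega
    · unfold Edge.IsLeft at h4; omega
  · have h3 := hlt e' he'
    rcases Edge.cases e' e with rfl | h4 | h4 | h4 | h4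
    · omega
    · have := h4.2; omega
    · have := T.increasing _ _ h4; omega
    · unfold Edge.IsLeft at h4; omega
    · unfold Edge.IsLeft at h4; have := e'.up_lt_down; omega

/-- The data of the tiling after `i` insertions, in terms of the labels up to `i`. -/
structure IsStage (T : NaturalLabel lam) (i : ℕ) (low : ℕ → ℤ) (v c : ℕ → ℕ) (s : ℕ) : Prop where
  tiling : T.ribbonTiling i = tilingOf low v c
  valid : Valid i low v c
  special : IsSpecial (tilingOf low v c) s
  special_zero : i = 0 → s = 0
  special_eq : ∀ e, T.label e = i → s = stepCount (T.initial i) e.up + 1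
  low_eq : ∀ x, low (stepCount (T.initial i) x) = partialHeight (T.initial i) x
  count_eq : ∀ x, v (stepCount (T.initial i) x) = T.strips (i + 1) x x
  joint_up : ∀ e ∈ T.initial i, c (stepCount (T.initial i) e.up) = T.floorOf e
  joint_down : ∀ e ∈ T.initial i, c (stepCount (T.initial i) e.down) = T.floorOf e

/-- An earlier strip over the point `e.up` ends neither at `e` nor at a descendant, so it passes
over all of `e`. This identifies the number of boxes cut by the spread with `floorOf e`. -/
theorem strips_up {e : Edge lam} : T.strips (T.label e) e.up e.up = T.floorOf e := by
  refine strips_congr fun k hk => ?_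
  constructor
  · rintro ⟨a, b, ha, hb, h1, h2⟩
    refine ⟨a, b, ha, hb, h1, ?_⟩
    have := b.up_lt_down
    rcases Edge.cases b e with rfl | h | h | h | h
    · omega
    · have := h.1; omega
    · have := T.increasing _ _ h; omega
    · unfold Edge.IsLeft at h; omega
    · exact h
  · rintro ⟨a, b, ha, hb, h1, h2⟩
    exact ⟨a, b, ha, hb, h1, by have := e.up_lt_down; omega⟩

/-- Each point of `lam` is followed through the insertions by its `stepCount`. Inserting `e` cuts
the column of `e.up`, and the two new joints equal the number of boxes there, namely `floorOf e`.
The ribbon extends from the new up step to the up step of the preceding label, if that lies further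
right, and its columns are exactly those of the new strip. -/
theorem exists_isStage (T : NaturalLabel lam) (hi : i ≤ lam.semilength) :
    ∃ low v c s, T.IsStage i low v c s := by
  induction i with
  | zero =>
    have h0 : T.initial 0 = ∅ := initial_zero
    have hp : IsPath 0 fun _ => (0 : ℤ) :=
      ⟨rfl, fun k hk => by omega, fun _ _ => rfl, fun _ => le_rfl⟩
    refine ⟨fun _ => 0, fun _ => 0, fun _ => 0, 0, ?_, ?_, ⟨Or.inr rfl, ?_⟩, fun _ => rfl, ?_, ?_,
      ?_, ?_, ?_⟩
    · refine Tiling.ext rfl (funext fun x => by simp [ribbonTiling, tilingOf]) ?_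
      ext t
      simp only [ribbonTiling, tilingOf, Set.mem_empty_iff_false, Set.mem_ofPred_eq, false_iff]
      rintro ⟨j, a, b, h, -⟩
      have := h.one_le
      have := h.le_count
      omega
    · exact ⟨hp, by simpa using hp, fun _ => le_rfl, fun _ => le_rfl,
        fun _ _ _ _ _ _ => ⟨le_rfl, le_rfl⟩⟩
    · rintro x - hx
      obtain ⟨⟨r, -, h⟩, -⟩ := isEligible_tilingOf.1 hx
      simp at h
    · intro e he
      have := T.label_pos e
      omega
    · intro x; simp [partialHeight, h0]
    · intro x; exact strips_one.symm
    · intro e he; rw [h0] at he; exact he.elim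
    · intro e he; rw [h0] at he; exact he.elim
  | succ i ih =>
    obtain ⟨low, v, c, s, h⟩ := ih (by omega)
    obtain ⟨e, he⟩ := T.exists_label (i := i + 1) (by omega) hi
    have hud := e.up_lt_down
    set m := stepCount (T.initial i) e.up with hm
    have hhist : T.insertionHistory (i + 1) = m := by
      rw [← he, insertionHistory_eq, he]; rfl
    have hm2 : m ≤ 2 * i := stepCount_initial_le (by omega)
    obtain ⟨h1, h2, h3⟩ := h.valid.insert hm2 h.special
    have hins := T.initial_succ he
    have hnot := T.not_mem_initial he
    have hpos : ∀ x, (x ≤ e.up ∧ stepCount (T.initial (i + 1)) x = stepCount (T.initial i) x ∧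
          stepCount (T.initial i) x ≤ m ∧
          partialHeight (T.initial (i + 1)) x = partialHeight (T.initial i) x) ∨
        (e.up < x ∧ x ≤ e.down ∧ stepCount (T.initial (i + 1)) x = m + 1 ∧
          stepCount (T.initial i) x = m ∧
          partialHeight (T.initial (i + 1)) x = partialHeight (T.initial i) x + 1) ∨
        (e.down < x ∧ stepCount (T.initial (i + 1)) x = stepCount (T.initial i) x + 2 ∧
          m ≤ stepCount (T.initial i) x ∧
          partialHeight (T.initial (i + 1)) x = partialHeight (T.initial i) x) := by
      intro x
      have h4 := stepCount_insert (x := x) hnot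
      rw [← hins] at h4
      rcases le_or_gt x e.up with h5 | h5
      · exact Or.inl ⟨h5, (h4.1 h5).1, stepCount_mono h5, (h4.1 h5).2⟩
      rcases le_or_gt x e.down with h6 | h6
      · have h7 := stepCount_initial_const he h5.le (by omega)
        exact Or.inr (Or.inl ⟨h5, h6, by rw [(h4.2.1 h5 h6).1, h7], h7, (h4.2.1 h5 h6).2⟩)
      · exact Or.inr (Or.inr ⟨h6, (h4.2.2 h6).1, stepCount_mono (by omega), (h4.2.2 h6).2⟩)
    have hcount : ∀ x, spreadCount m v (stepCount (T.initial (i + 1)) x) = T.strips (i + 1) x x := by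
      intro x
      rw [← h.count_eq x]
      rcases hpos x with ⟨-, h5, h6, -⟩ | ⟨-, -, h5, h6, -⟩ | ⟨-, h5, h6, -⟩
      · rw [h5, spreadCount_of_le h6]
      · rw [h5, spreadCount_mid, h6]
      · rw [h5, spreadCount_add_two h6]
    have hother : ∀ e' ∈ T.initial i,
        (e'.up < e.up ∨ e.down < e'.up) ∧ (e'.down < e.up ∨ e.down < e'.down) := by
      intro e' he'
      have h5 : T.label e' < i + 1 := he'
      have := e'.up_lt_down
      rcases Edge.cases e' e with rfl | h4 | h4 | h4 | h4
      · omega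
      · have := h4.1; have := h4.2; omega
      · have := T.increasing _ _ h4; omega
      · unfold Edge.IsLeft at h4; omega
      · unfold Edge.IsLeft at h4; omega
    refine ⟨_, _, _, _, ⟨?_, h2, h3, fun h => by omega, ?_, ?_, ?_, ?_, ?_⟩⟩
    · rw [ribbonTiling, hhist, h.tiling, h1]
    · intro e' he'
      obtain rfl := T.label_inj (he.trans he'.symm)
      rcases hpos e.up with ⟨-, h5, -⟩ | h5 | h5
      · rw [h5]
      · omega
      · omega
    · intro x
      rcases hpos x with ⟨-, h5, h6, h7⟩ | ⟨-, -, h5, h6, h7⟩ | ⟨-, h5, h6, h7⟩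
      · rw [h5, spreadPath_of_le h6, h7, h.low_eq]
      · rw [h5, spreadPath_mid, h7, ← h.low_eq x, h6]
      · rw [h5, spreadPath_add_two h6, h7, h.low_eq]
    · intro x
      have h5 := hcount x
      have key : (m + 1 < stepCount (T.initial (i + 1)) x ∧
          stepCount (T.initial (i + 1)) x < if s ≤ m then m + 1 else s + 2) ↔
          T.Strip (i + 1) x x := by
        -- The first insertion has no preceding label; the special column `0` of the empty tiling
        -- yields the empty ribbon.
        rcases Nat.eq_zero_or_pos i with h0 | h0
        · have hs0 := h.special_zero h0
          rw [if_pos (by omega)]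
          constructor
          · rintro ⟨h6, h7⟩; omega
          · rintro ⟨a, b, ha, hb, -⟩
            have := T.label_pos b
            omega
        · obtain ⟨b, hb⟩ := T.exists_label h0 (by omega)
          have hs := h.special_eq b hb
          have hbi : b ∈ T.initial i := by change T.label b < i + 1; omega
          have hbs := (stepCount_up_succ hbi).1
          have hst := strip_iff (T := T) (p := x) (q := x) (a := e) (b := b) (by omega)
          rw [he] at hst
          rw [hst]
          constructor
          · rintro ⟨h6, h7⟩
            rcases hpos x with ⟨-, h8, h9, -⟩ | ⟨-, -, h8, -⟩ | ⟨h8, h9, -⟩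
            · omega
            · omega
            · refine ⟨h8, ?_⟩
              by_contra hc
              have := stepCount_mono (S := T.initial i) (show b.up + 1 ≤ x by omega)
              split_ifs at h7 <;> omega
          · rintro ⟨h6, h7⟩
            rcases hpos x with ⟨h8, -⟩ | ⟨-, h8, -⟩ | ⟨-, h8, h9, -⟩
            · omega
            · omega
            · have := stepCount_mono (S := T.initial i) h7
              rw [if_neg (by omega)]
              omega
      unfold growCount
      by_cases hS : T.Strip (i + 1) x x
      · rw [if_pos (key.2 hS), h5, strips_succ_of hS]
      · rw [if_neg (fun h => hS (key.1 h)), h5, strips_succ_of_not hS]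
    · intro e' he'
      rw [hins] at he'
      rcases he' with rfl | he'
      · rcases hpos e'.up with ⟨-, h5, -⟩ | h5 | h5
        · rw [h5, spreadJoint_mid le_rfl (by omega), hm, h.count_eq, ← he, strips_up]
        · omega
        · omega
      · have h4 := (hother e' he').1
        have h5 := (stepCount_up_succ he').1
        rw [← h.joint_up e' he']
        rcases hpos e'.up with ⟨h6, h7, -⟩ | h6 | ⟨h6, h7, h8, -⟩
        · have := stepCount_mono (S := T.initial i) (show e'.up + 1 ≤ e.up by omega)
          rw [h7, spreadJoint_of_lt (by omega)]
        · omega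
        · rw [h7, spreadJoint_add_two h8]
    · intro e' he'
      rw [hins] at he'
      rcases he' with rfl | he'
      · rcases hpos e'.down with h5 | ⟨-, -, h5, -⟩ | h5
        · omega
        · rw [h5, spreadJoint_mid (by omega) (by omega), hm, h.count_eq, ← he, strips_up]
        · omega
      · have h4 := (hother e' he').2
        have h5 := (stepCount_down_succ he').1
        rw [← h.joint_down e' he']
        rcases hpos e'.down with ⟨h6, h7, -⟩ | h6 | ⟨h6, h7, h8, -⟩
        · have := stepCount_mono (S := T.initial i) (show e'.down + 1 ≤ e.up by omega)
          rw [h7, spreadJoint_of_lt (by omega)]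
        · omega
        · rw [h7, spreadJoint_add_two h8]

open Classical in
variable (T) in
/-- The floor of the edge to which step `k` belongs. -/
noncomputable def joint (k : ℕ) : ℕ :=
  if h : ∃ e : Edge lam, e.up = k ∨ e.down = k then T.floorOf h.choose else 0

theorem joint_eq {e : Edge lam} {k : ℕ} (he : e.up = k ∨ e.down = k) :
    T.joint k = T.floorOf e := by
  have hex : ∃ e : Edge lam, e.up = k ∨ e.down = k := ⟨e, he⟩
  unfold joint
  rw [dif_pos hex, Edge.eq_of_step hex.choose_spec he]

theorem joint_eq_zero {k : ℕ} (hk : 2 * lam.semilength ≤ k) : T.joint k = 0 := by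
  unfold joint
  rw [dif_neg]
  rintro ⟨e, he⟩
  have := e.up_lt
  have := e.down_lt
  omega

/-- Once all edges are inserted, `stepCount` is the identity on `[0, 2 * lam.semilength]`, so the
final stage can be read off; beyond this interval all counts and joints vanish. -/
theorem DTR_eq (T : NaturalLabel lam) :
    Valid lam.semilength (height lam) T.stripCount T.joint ∧
      DTR T = tilingOf (height lam) T.stripCount T.joint := by
  obtain ⟨low, v, c, s, h⟩ := T.exists_isStage le_rfl
  have huniv : T.initial lam.semilength = Set.univ := by
    ext e
    have := T.label_le e
    simp only [initial, Set.mem_ofPred_eq, Set.mem_univ, iff_true]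
    omega
  have hlow : low = height lam := by
    funext x
    rcases le_total x (2 * lam.semilength) with hx | hx
    · have := h.low_eq x
      rwa [huniv, (stepCount_univ hx).1, (stepCount_univ hx).2] at this
    · rw [h.valid.low_path.tail x hx, (isPath_height lam).tail x hx]
  have hv : v = T.stripCount := by
    funext x
    rcases le_total x (2 * lam.semilength) with hx | hx
    · have h1 := h.count_eq x
      rw [huniv, (stepCount_univ hx).1] at h1
      rw [h1]
      exact (strips_succ_of_not (by
        rintro ⟨a, -, ha, -⟩
        have := T.label_le a
        omega)).symm
    · have h1 := h.valid.up_path.tail x hx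
      have h2 := (isPath_raised T (lam.semilength + 2)).tail x hx
      have h3 := h.valid.low_path.tail x hx
      have h4 := (isPath_height lam).tail x hx
      unfold stripCount
      beta_reduce at h1 h2
      omega
  have hc : c = T.joint := by
    funext k
    rcases lt_or_ge k (2 * lam.semilength) with hk | hk
    · obtain ⟨e, he⟩ := Edge.exists_step hk
      rw [joint_eq he]
      have h1 := h.joint_up e (by rw [huniv]; trivial)
      have h2 := h.joint_down e (by rw [huniv]; trivial)
      rw [huniv, (stepCount_univ e.up_lt.le).1] at h1
      rw [huniv, (stepCount_univ e.down_lt.le).1] at h2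
      rcases he with rfl | rfl
      · exact h1
      · exact h2
    · rw [joint_eq_zero hk]
      have h1 := h.valid.left k
      have h2 := h.valid.up_path.tail k hk
      have h3 := h.valid.low_path.tail k hk
      beta_reduce at h2
      omega
  subst hlow hv hc
  exact ⟨h.valid, h.tiling⟩

end NaturalLabel

end Ribbon

/-! ### Cover-inclusive Dyck tilings and their valid descriptions -/

section Cover

variable {n : ℕ} {low : ℕ → ℤ} {v c : ℕ → ℕ}

theorem IsRun.unique {j a b a' b' x : ℕ} (h : IsRun v c j a b) (h' : IsRun v c j a' b')
    (h1 : a ≤ x) (h2 : x ≤ b) (h1' : a' ≤ x) (h2' : x ≤ b') : a = a' ∧ b = b' := by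
  have key : ∀ {a b a' b' : ℕ}, IsRun v c j a b → IsRun v c j a' b' → a ≤ x → x ≤ b → a' ≤ x →
      x ≤ b' → a' ≤ a ∧ b ≤ b' := by
    intro a b a' b' h h' h1 h2 h1' h2'
    constructor
    · by_contra hc
      have h3 := h.joined (a' - 1) (by omega) (by omega)
      have h4 := h'.left (a' - 1) (by omega)
      omega
    · by_contra hc
      have h3 := h.joined b' (by omega) (by omega)
      have h4 := h'.right
      omega
  have h3 := key h h' h1 h2 h1' h2'
  have h4 := key h' h h1' h2' h1 h2
  omega

theorem exists_isRun (hl : ∀ k, c k ≤ v k) (hz : ∀ k, 2 * n ≤ k → c k = 0) {j x : ℕ} (h1 : 1 ≤ j)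
    (h2 : j ≤ v x) : ∃ a b, IsRun v c j a b ∧ a ≤ x ∧ x ≤ b := by
  classical
  have hb : ∃ b, x ≤ b ∧ c b < j := ⟨x + 2 * n, by omega, by rw [hz _ (by omega)]; omega⟩
  have ha : ∃ a, a ≤ x ∧ ∀ k, a ≤ k → k < x → j ≤ c k := ⟨x, le_rfl, fun k _ _ => by omega⟩
  have hb1 := Nat.find_spec hb
  have hb2 : ∀ k, k < Nat.find hb → ¬ (x ≤ k ∧ c k < j) := fun k => Nat.find_min hb
  have ha1 := Nat.find_spec ha
  have ha2 : ∀ k, k < Nat.find ha → ¬ (k ≤ x ∧ ∀ k', k ≤ k' → k' < x → j ≤ c k') :=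
    fun k => Nat.find_min ha
  generalize Nat.find hb = b at hb1 hb2
  generalize Nat.find ha = a at ha1 ha2
  refine ⟨a, b, ⟨h1, by omega, ?_, fun k hk hkb => ?_, fun k hk => ?_, hb1.2⟩, ha1.1, hb1.1⟩
  · rcases ha1.1.lt_or_eq with h | rfl
    · exact (ha1.2 a le_rfl h).trans (hl a)
    · exact h2
  · rcases Nat.lt_or_ge k x with h | h
    · exact ha1.2 k hk h
    · have := hb2 k hkb
      omega
  · have h3 := ha2 k (by omega)
    by_contra hc
    refine h3 ⟨by omega, fun k' hk' hkx => ?_⟩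
    rcases hk'.lt_or_eq with h | rfl
    · exact ha1.2 k' (by omega) hkx
    · omega

namespace Valid

theorem count_eq_zero (h : Valid n low v c) {x : ℕ} (hx : 2 * n ≤ x) : v x = 0 := by
  have h1 := h.low_path.tail x hx
  have h2 := h.up_path.tail x hx
  beta_reduce at h2
  omega

theorem joint_eq_zero (h : Valid n low v c) {x : ℕ} (hx : 2 * n ≤ x) : c x = 0 := by
  have := h.left x
  rw [h.count_eq_zero hx] at this
  omega

theorem exists_isRun (h : Valid n low v c) {j x : ℕ} (h1 : 1 ≤ j) (h2 : j ≤ v x) :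
    ∃ a b, IsRun v c j a b ∧ a ≤ x ∧ x ≤ b :=
  DyckTableaux.exists_isRun h.left (fun _ => h.joint_eq_zero) h1 h2

theorem mem_skewShape (h : Valid n low v c) {x : ℕ} {y : ℤ} :
    (x, y) ∈ skewShape low (fun x => low x + 2 * (v x : ℤ)) ↔
      ∃ j : ℕ, 1 ≤ j ∧ j ≤ v x ∧ y = low x + (2 * (j : ℤ) - 1) := by
  constructor
  · rintro ⟨⟨r, hr⟩, h1, h2⟩
    simp only at hr h1 h2
    have hx : x ≤ 2 * n := by
      by_contra hc
      have := h.count_eq_zero (x := x) (by omega)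
      omega
    obtain ⟨z, hz⟩ := h.low_path.even_add hx
    exact ⟨((y - low x + 1) / 2).toNat, by omega, by omega, by omega⟩
  · rintro ⟨j, h1, h2, rfl⟩
    have hx : x ≤ 2 * n := by
      by_contra hc
      have := h.count_eq_zero (x := x) (by omega)
      omega
    obtain ⟨z, hz⟩ := h.low_path.even_add hx
    refine ⟨⟨z + j - 1, ?_⟩, ?_, ?_⟩ <;> simp only <;> omega

theorem run_le (h : Valid n low v c) {j a b : ℕ} (hr : IsRun v c j a b) : b < 2 * n + 1 ∧
    ∀ k, a ≤ k → k < b → k < 2 * n := by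
  have h1 : ∀ k, a ≤ k → k < b → k < 2 * n := by
    intro k hk hkb
    by_contra hc
    have h2 := hr.joined k hk hkb
    have h3 := hr.one_le
    rw [h.joint_eq_zero (by omega)] at h2
    omega
  refine ⟨?_, h1⟩
  rcases hr.le.lt_or_eq with h2 | rfl
  · have := h1 (b - 1) (by omega) (by omega)
    omega
  · by_contra hc
    have h2 := hr.le_count
    have h3 := hr.one_le
    rw [h.count_eq_zero (by omega)] at h2
    omega

/-- Consider a down step `y` by which the run falls below its left end, and its matching up step
`p`. If `p` lies left of the run, `nest` gives `c y ≤ c (a - 1) < j`, although `y` is joined.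
Otherwise `p` starts at an equally low point of the run further left. -/
theorem run_le_left (h : Valid n low v c) {j a b : ℕ} (hr : IsRun v c j a b) {x : ℕ} (h1 : a ≤ x)
    (h2 : x ≤ b) : low a ≤ low x := by
  by_contra hc
  induction x using Nat.strong_induction_on with
  | _ x ih =>
    have hxa : x ≠ a := by rintro rfl; exact hc le_rfl
    obtain ⟨y, rfl⟩ : ∃ y, x = y + 1 := ⟨x - 1, by omega⟩
    have hn := (h.run_le hr).2 y (by omega) (by omega)
    have h3 : low a ≤ low y := by
      by_contra h3
      exact ih y (by omega) (by omega) (by omega) h3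
    have h4 := h.low_path.step y hn
    obtain ⟨p, hp⟩ := h.low_path.exists_match_down hn (by omega)
    have hp1 := hp.1
    have hp2 := hp.2.1
    rcases Nat.lt_or_ge p a with h5 | h5
    · have h6 := (h.nest p y hp (a - 1) (by omega) (by omega)).2
      have h7 := hr.left (a - 1) (by omega)
      have h8 := hr.joined y (by omega) (by omega)
      omega
    · exact ih p (by omega) h5 (by omega) (by omega)

/-- Mirror image of `run_le_left`, by induction on the distance `d` to the right end. -/
theorem run_le_right (h : Valid n low v c) {j a b : ℕ} (hr : IsRun v c j a b) {x : ℕ} (h1 : a ≤ x)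
    (h2 : x ≤ b) : low b ≤ low x := by
  obtain ⟨d, rfl⟩ : ∃ d, b = x + d := ⟨b - x, by omega⟩
  by_contra hc
  induction d using Nat.strong_induction_on generalizing x with
  | _ d ih =>
    have hd : d ≠ 0 := by rintro rfl; exact hc le_rfl
    have hn := (h.run_le hr).2 x (by omega) (by omega)
    have h3 : low (x + d) ≤ low (x + 1) := by
      by_contra h3
      refine ih (d - 1) (by omega) (x := x + 1) (by omega) ?_ (by omega) ?_
      · rwa [show x + 1 + (d - 1) = x + d by omega]
      · rwa [show x + 1 + (d - 1) = x + d by omega]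
    have h4 := h.low_path.step x hn
    obtain ⟨q, hq⟩ := h.low_path.exists_match_up (k := x) (by omega)
    have hq1 := hq.1
    have hq2 := hq.2.1
    rcases Nat.lt_or_ge q (x + d) with h5 | h5
    · refine ih (x + d - (q + 1)) (by omega) (x := q + 1) (by omega) ?_ (by omega) ?_
      · rwa [show q + 1 + (x + d - (q + 1)) = x + d by omega]
      · rw [show q + 1 + (x + d - (q + 1)) = x + d by omega]
        omega
    · have h6 := (h.nest x q hq (x + d) (by omega) (by omega)).1
      have h7 := hr.right
      have h8 := hr.joined x (by omega) (by omega)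
      omega

theorem isDyckTile (h : Valid n low v c) {j a b : ℕ} (hr : IsRun v c j a b) :
    IsDyckTile (tileAt low j a b) := by
  have hab := hr.le
  have hbn := (h.run_le hr).1
  have heq : low a = low b :=
    le_antisymm (h.run_le_left hr hab le_rfl) (h.run_le_right hr le_rfl hab)
  obtain ⟨z, hz⟩ := h.low_path.even_add (x := a) (by omega)
  obtain ⟨z', hz'⟩ := h.low_path.even_add (x := b) (by omega)
  obtain ⟨m, hm⟩ : ∃ m, b = a + 2 * m := ⟨(b - a) / 2, by omega⟩
  obtain ⟨w, hw, hwf⟩ := exists_dyckWord (m := m) (f := fun k => low (a + k) - low a) (by simp)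
    (fun k hk => by
      have := h.low_path.step (a + k) ((h.run_le hr).2 (a + k) (by omega) (by omega))
      rw [← add_assoc]
      omega) (by rw [← hm, heq]; simp)
    (fun x hx => by have := h.run_le_left hr (x := a + x) (by omega) (by omega); omega)
  refine ⟨(a, low a + (2 * (j : ℤ) - 1)), w, ?_⟩
  rw [hw]
  ext ⟨x, y⟩
  rw [mem_tileAt, Set.mem_ofPred_eq]
  constructor
  · rintro ⟨h1, h2, rfl⟩
    refine ⟨x - a, by omega, ?_⟩
    rw [hwf _ (by omega), Prod.mk.injEq, Nat.add_sub_cancel' h1]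
    exact ⟨rfl, by ring⟩
  · rintro ⟨k, hk, hxy⟩
    rw [Prod.mk.injEq, hwf k hk] at hxy
    obtain ⟨rfl, rfl⟩ := hxy
    exact ⟨by omega, by omega, by ring⟩

/-- A valid description gives a cover-inclusive Dyck tiling. -/
theorem mem_coverInclusiveTilings {lam : DyckWord}
    (h : Valid lam.semilength (height lam) v c) :
    tilingOf (height lam) v c ∈ coverInclusiveTilings lam := by
  refine ⟨⟨⟨lam.semilength, isDyckPath_iff.2 h.low_path, isDyckPath_iff.2 h.up_path⟩, fun x => ?_,
    ?_, ?_, ?_⟩, ?_, rfl⟩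
  · simp only [tilingOf]
    omega
  · rintro _ ⟨j, a, b, hr, rfl⟩
    exact h.isDyckTile hr
  · rintro _ ⟨j, a, b, hr, rfl⟩ ⟨x, y⟩ ⟨h1, h2, h3⟩
    refine h.mem_skewShape.2 ⟨j, hr.one_le, ?_, h3⟩
    rcases h2.lt_or_eq with h4 | h4
    · exact (hr.joined x h1 h4).trans (h.left x)
    · rcases h1.lt_or_eq with h5 | h5
      · have := hr.joined (x - 1) (by simp only at *; omega) (by simp only at *; omega)
        have h6 := h.right (x - 1)
        rw [Nat.sub_add_cancel (by simp only at *; omega)] at h6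
        exact this.trans h6
      · simp only at h5; rw [← h5]; exact hr.le_count
  · rintro ⟨x, y⟩ hxy
    obtain ⟨j, h1, h2, h3⟩ := h.mem_skewShape.1 hxy
    obtain ⟨a, b, hr, hax, hxb⟩ := h.exists_isRun h1 h2
    refine ⟨tileAt (height lam) j a b, ⟨⟨j, a, b, hr, rfl⟩, hax, hxb, h3⟩, ?_⟩
    rintro _ ⟨⟨j', a', b', hr', rfl⟩, hax', hxb', h3'⟩
    simp only at hax' hxb' h3'
    obtain rfl : j = j' := by omega
    obtain ⟨rfl, rfl⟩ := hr.unique hr' hax hxb hax' hxb'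
    rfl
  · rintro _ ⟨j, a, b, hr, rfl⟩
    have h1 := hr.one_le
    rcases h1.lt_or_eq with h2 | rfl
    · right
      obtain ⟨a', b', hr', h3, h4⟩ := h.exists_isRun (j := j - 1) (x := a) (by omega)
        (by have := hr.le_count; omega)
      have h5 : b ≤ b' := by
        by_contra hc
        have := hr.joined b' (by omega) (by omega)
        have := hr'.right
        omega
      refine ⟨tileAt (height lam) (j - 1) a' b', ⟨j - 1, a', b', hr', rfl⟩, fun heq => ?_, ?_⟩
      · have h6 : (a, height lam a + (2 * ((j - 1 : ℕ) : ℤ) - 1)) ∈ tileAt (height lam) j a b := by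
          rw [← heq]
          exact ⟨h3, h4, rfl⟩
        have h7 := h6.2.2
        simp only at h7
        omega
      · rintro ⟨x, y⟩ ⟨h6, h7, h8⟩
        simp only at h6 h7 h8
        exact ⟨by simp only; omega, by simp only; omega, by simp only; omega⟩
    · left
      rintro ⟨x, y⟩ ⟨h6, h7, h8⟩
      simp only [tilingOf] at h8 ⊢
      omega

/-- This expresses the joints by the set of tiles alone, which is why the tiling determines them. -/
theorem le_joint_iff (h : Valid n low v c) {j k : ℕ} (hj : 1 ≤ j) : j ≤ c k ↔
    ∃ t ∈ (tilingOf low v c).tiles, (k, low k + (2 * (j : ℤ) - 1)) ∈ t ∧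
      (k + 1, low (k + 1) + (2 * (j : ℤ) - 1)) ∈ t := by
  constructor
  · intro h1
    obtain ⟨a, b, hr, h2, h3⟩ := h.exists_isRun hj (h1.trans (h.left k))
    have : k ≠ b := by rintro rfl; have := hr.right; omega
    exact ⟨_, ⟨j, a, b, hr, rfl⟩, ⟨h2, h3, rfl⟩, by simp only; omega, by simp only; omega, rfl⟩
  · rintro ⟨_, ⟨j', a, b, hr, rfl⟩, ⟨h1, h2, h3⟩, ⟨h4, h5, h6⟩⟩
    simp only at h1 h2 h3 h4 h5 h6
    obtain rfl : j = j' := by omega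
    exact hr.joined k h1 (by omega)

/-- The tiling determines its description. -/
theorem ext {n' : ℕ} {low' : ℕ → ℤ} {v' c' : ℕ → ℕ} (h : Valid n low v c)
    (h' : Valid n' low' v' c') (heq : tilingOf low v c = tilingOf low' v' c') :
    low = low' ∧ v = v' ∧ c = c' := by
  obtain rfl : low = low' := congrArg Tiling.lower heq
  refine ⟨rfl, funext fun x => ?_, funext fun k => ?_⟩
  · have := congrFun (congrArg Tiling.upper heq) x
    simp only [tilingOf] at this
    omega
  · have key : ∀ j, 1 ≤ j → (j ≤ c k ↔ j ≤ c' k) := fun j hj => by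
      rw [h.le_joint_iff hj, h'.le_joint_iff hj, heq]
    have h1 := key (c k)
    have h2 := key (c' k)
    omega

end Valid

theorem IsPath.length_unique {n' : ℕ} {f : ℕ → ℤ} (h : IsPath n f) (h' : IsPath n' f) : n = n' := by
  have key : ∀ {n n' : ℕ}, IsPath n f → IsPath n' f → n' ≤ n := by
    intro n n' h h'
    by_contra hc
    have h1 := h.tail (2 * n) le_rfl
    have h2 := h.tail (2 * n + 1) (by omega)
    have h3 := h'.step (2 * n) (by omega)
    omega
  exact le_antisymm (key h' h) (key h h')

/-- Every cover-inclusive Dyck tiling has a valid description. -/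
theorem exists_valid {lam : DyckWord} {D : Tiling} (hD : D ∈ coverInclusiveTilings lam) :
    ∃ v c, Valid lam.semilength (height lam) v c ∧ D = tilingOf (height lam) v c := by
  obtain ⟨⟨⟨n, hlow, hupp⟩, hle, hdyck, hsub, huniq⟩, hcov, hD3⟩ := hD
  rw [isDyckPath_iff] at hlow hupp
  rw [hD3] at hlow hle hsub huniq
  unfold Tiling.IsCoverInclusive at hcov
  rw [hD3] at hcov
  have hp := isPath_height lam
  obtain rfl := hlow.length_unique hp
  set low := height lam with hlowdef
  have hpar : ∀ x, ∃ z : ℕ, D.upper x = low x + 2 * (z : ℤ) := by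
    intro x
    obtain ⟨z, hz⟩ := hp.even_sub hupp x
    have := hle x
    exact ⟨z.toNat, by omega⟩
  choose v hv using hpar
  -- all boxes of a tile have the same level
  have hshape : ∀ t ∈ D.tiles, ∀ b ∈ t, ∃ j : ℕ, 1 ≤ j ∧ j ≤ v b.1 ∧
      b.2 = low b.1 + (2 * (j : ℤ) - 1) := by
    intro t ht b hb
    obtain ⟨⟨r, hr⟩, h1, h2⟩ := hsub t ht hb
    have hvb := hv b.1
    have hx : b.1 ≤ 2 * lam.semilength := by
      by_contra hc
      have := hp.tail b.1 (by omega)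
      have := hupp.tail b.1 (by omega)
      omega
    obtain ⟨z, hz⟩ := hp.even_add hx
    exact ⟨((b.2 - low b.1 + 1) / 2).toNat, by omega, by omega, by omega⟩
  -- Induction on the level: a tile whose translate is below the lower path has only boxes of level
  -- `1`, and any other tile lies over a tile whose boxes below it are one level lower.
  have hlevel : ∀ j : ℕ, ∀ t ∈ D.tiles, ∀ b ∈ t, ∀ b' ∈ t, ∀ j' : ℕ,
      b.2 = low b.1 + (2 * (j : ℤ) - 1) → b'.2 = low b'.1 + (2 * (j' : ℤ) - 1) → j = j' := by
    intro j
    induction j with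
    | zero =>
      intro t ht b hb b' hb' j' h1 h2
      obtain ⟨i, hi, -, hi2⟩ := hshape t ht b hb
      omega
    | succ j ih =>
      intro t ht b hb b' hb' j' h1 h2
      obtain ⟨i', hi', -, hi2'⟩ := hshape t ht b' hb'
      obtain rfl : i' = j' := by omega
      by_cases hbot : j = 0 ∧ i' = 1
      · omega
      rcases hcov t ht with h3 | ⟨t', ht', -, h3⟩
      · have h4 := h3 b hb
        have h5 := h3 b' hb'
        omega
      · have h4 := h3 b hb
        have h5 := h3 b' hb'
        have h6 := ih t' ht' _ h4 _ h5 (i' - 1) (by simp only; omega) (by simp only; omega)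
        omega
  -- every tile is a set `tileAt low j a b`
  have htile : ∀ t ∈ D.tiles, ∃ j a b : ℕ, 1 ≤ j ∧ j ≤ v a ∧ a ≤ b ∧ t = tileAt low j a b ∧
      low a = low b ∧ ∀ x, a ≤ x → x ≤ b → low a ≤ low x := by
    intro t ht
    obtain ⟨b, w, hw⟩ := hdyck t ht
    have hmem : ∀ k, k ≤ 2 * w.semilength → (b.1 + k, b.2 + height w k) ∈ t := by
      intro k hk
      rw [hw]
      exact ⟨k, hk, rfl⟩
    have hpw := isPath_height w
    have hb : b ∈ t := by
      have := hmem 0 (by omega)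
      rw [hpw.zero] at this
      simpa using this
    obtain ⟨j, hj1, hj2, hj3⟩ := hshape t ht b hb
    have hlev : ∀ k, k ≤ 2 * w.semilength →
        b.2 + height w k = low (b.1 + k) + (2 * (j : ℤ) - 1) := by
      intro k hk
      obtain ⟨j', -, -, h2⟩ := hshape t ht _ (hmem k hk)
      have := hlevel j t ht b hb _ (hmem k hk) j' hj3 h2
      simp only at h2
      rw [h2, this]
    refine ⟨j, b.1, b.1 + 2 * w.semilength, hj1, hj2, by omega, ?_, ?_, ?_⟩
    · rw [hw]
      ext ⟨x, y⟩
      rw [mem_tileAt, Set.mem_ofPred_eq]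
      constructor
      · rintro ⟨k, hk, hxy⟩
        rw [Prod.mk.injEq] at hxy
        obtain ⟨rfl, rfl⟩ := hxy
        exact ⟨by omega, by omega, hlev k hk⟩
      · rintro ⟨h1, h2, rfl⟩
        refine ⟨x - b.1, by omega, ?_⟩
        rw [hlev _ (by omega), Nat.add_sub_cancel' h1]
    · have := hlev (2 * w.semilength) le_rfl
      rw [hpw.tail _ le_rfl] at this
      omega
    · intro x h1 h2
      have := hlev (x - b.1) (by omega)
      rw [Nat.add_sub_cancel' h1] at this
      have := hpw.nonneg (x - b.1)
      omega
  have hbox : ∀ x j : ℕ, 1 ≤ j → j ≤ v x →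
      ∃! t, t ∈ D.tiles ∧ (x, low x + (2 * (j : ℤ) - 1)) ∈ t := by
    intro x j h1 h2
    refine huniq _ ?_
    have hvx := hv x
    have hx : x ≤ 2 * lam.semilength := by
      by_contra hc
      have := hp.tail x (by omega)
      have := hupp.tail x (by omega)
      omega
    obtain ⟨z, hz⟩ := hp.even_add hx
    refine ⟨⟨z + j - 1, ?_⟩, ?_, ?_⟩ <;> simp only <;> omega
  set J : ℕ → ℕ → Prop := fun k j => 1 ≤ j ∧ ∃ t ∈ D.tiles, (k, low k + (2 * (j : ℤ) - 1)) ∈ t ∧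
      (k + 1, low (k + 1) + (2 * (j : ℤ) - 1)) ∈ t with hJ
  have hJv : ∀ k j, J k j → j ≤ v k ∧ j ≤ v (k + 1) := by
    rintro k j ⟨-, t, ht, h1, h2⟩
    obtain ⟨i, -, h3, h4⟩ := hshape t ht _ h1
    obtain ⟨i', -, h5, h6⟩ := hshape t ht _ h2
    simp only at h3 h4 h5 h6
    omega
  -- Cover-inclusion pushes a joint down one level, so the joined levels at `k` form an initial
  -- segment and a single number `c k` describes them.
  have hJdown : ∀ k j, 1 ≤ j → J k (j + 1) → J k j := by
    rintro k j hj ⟨-, t, ht, h1, h2⟩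
    refine ⟨hj, ?_⟩
    rcases hcov t ht with h3 | ⟨t', ht', -, h3⟩
    · have := h3 _ h1
      push_cast at this
      omega
    · have h4 := h3 _ h1
      have h5 := h3 _ h2
      refine ⟨t', ht', ?_, ?_⟩
      · convert h4 using 2
        push_cast; ring
      · convert h5 using 2
        push_cast; ring
  classical
  set c : ℕ → ℕ := fun k => Nat.findGreatest (J k) (v k) with hc
  have hcJ : ∀ k j, 1 ≤ j → (j ≤ c k ↔ J k j) := by
    intro k j hj
    constructor
    · intro h1
      have h2 : J k (c k) := by
        have : c k ≠ 0 := by omega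
        exact Nat.findGreatest_of_ne_zero (P := J k) (n := v k) rfl this
      have h3 : ∀ d, 1 ≤ c k - d → J k (c k - d) := by
        intro d
        induction d with
        | zero => exact fun _ => h2
        | succ d ih =>
          intro hd
          refine hJdown k _ hd ?_
          rw [show c k - (d + 1) + 1 = c k - d by omega]
          exact ih (by omega)
      have := h3 (c k - j) (by omega)
      rwa [show c k - (c k - j) = j by omega] at this
    · intro h1
      exact Nat.le_findGreatest (hJv k j h1).1 h1
  have hcl : ∀ k, c k ≤ v k := fun k => Nat.findGreatest_le _
  have hcr : ∀ k, c k ≤ v (k + 1) := by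
    intro k
    rcases Nat.eq_zero_or_pos (c k) with h | h
    · omega
    · exact (hJv k _ ((hcJ k _ h).1 le_rfl)).2
  have hvalid : Valid lam.semilength low v c := by
    refine ⟨hp, ?_, hcl, hcr, ?_⟩
    · have : (fun x => low x + 2 * (v x : ℤ)) = D.upper := funext fun x => (hv x).symm
      rwa [this]
    · intro a b hab k hk hkb
      constructor
      · rcases Nat.eq_zero_or_pos (c a) with h | h
        · omega
        rw [hcJ k _ h]
        obtain ⟨-, t, ht, h1, h2⟩ := (hcJ a _ h).1 le_rfl
        obtain ⟨j, A, B, -, -, -, rfl, hAB, hmin⟩ := htile t ht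
        obtain ⟨h3, h4, h5⟩ := h1
        obtain ⟨h6, h7, h8⟩ := h2
        simp only at h3 h4 h5 h6 h7 h8
        -- A tile ends at the minimal height of the path below it, so `low B ≤ low a`; strictly
        -- inside the matched pair the path is higher.
        have h9 : b + 1 ≤ B := by
          by_contra hcon
          have := hab.2.2 B (by omega) (by omega)
          have := hmin a h3 h4
          omega
        obtain rfl : c a = j := by omega
        exact ⟨h, _, ht, ⟨by simp only; omega, by simp only; omega, rfl⟩,
          by simp only; omega, by simp only; omega, rfl⟩
      · rcases Nat.eq_zero_or_pos (c b) with h | h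
        · omega
        rw [hcJ k _ h]
        obtain ⟨-, t, ht, h1, h2⟩ := (hcJ b _ h).1 le_rfl
        obtain ⟨j, A, B, -, -, -, rfl, hAB, hmin⟩ := htile t ht
        obtain ⟨h3, h4, h5⟩ := h1
        obtain ⟨h6, h7, h8⟩ := h2
        simp only at h3 h4 h5 h6 h7 h8
        have h9 : A ≤ a := by
          by_contra hcon
          have := hab.2.2 A (by omega) (by omega)
          have := hmin (b + 1) h6 h7
          have := hab.2.1
          omega
        obtain rfl : c b = j := by omega
        exact ⟨h, _, ht, ⟨by simp only; omega, by simp only; omega, rfl⟩,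
          by simp only; omega, by simp only; omega, rfl⟩
  refine ⟨v, c, hvalid, Tiling.ext hD3 (funext hv) (Set.ext fun t => ⟨fun ht => ?_, ?_⟩)⟩
  · obtain ⟨j, a, b, h1, h2, h3, rfl, -, -⟩ := htile t ht
    refine ⟨j, a, b, ⟨h1, h3, h2, fun k hk hkb => ?_, fun k hk => ?_, ?_⟩, rfl⟩
    · exact (hcJ k j h1).2 ⟨h1, _, ht, ⟨by simp only; omega, by simp only; omega, rfl⟩,
        by simp only; omega, by simp only; omega, rfl⟩
    · by_contra hcon
      obtain ⟨-, t', ht', h4, h5⟩ := (hcJ k j h1).1 (not_lt.1 hcon)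
      rw [hk] at h5
      have := (hbox a j h1 h2).unique ⟨ht', h5⟩ ⟨ht, le_rfl, h3, rfl⟩
      rw [this] at h4
      have := h4.1
      simp only at this
      omega
    · by_contra hcon
      obtain ⟨-, t', ht', h4, h5⟩ := (hcJ b j h1).1 (not_lt.1 hcon)
      have := (hbox b j h1 ((not_lt.1 hcon).trans (hcl b))).unique ⟨ht', h4⟩ ⟨ht, h3, le_rfl, rfl⟩
      rw [this] at h5
      have := h5.2.1
      simp only at this
      omega
  · rintro ⟨j, a, b, hr, rfl⟩
    have hj := hr.one_le
    obtain ⟨t, ⟨ht, hat⟩, -⟩ := hbox a j hj hr.le_count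
    obtain ⟨j', a', b', h1, h2, h3, rfl, -, -⟩ := htile t ht
    obtain ⟨h4, h5, h6⟩ := hat
    simp only at h4 h5 h6
    obtain rfl : j = j' := by omega
    have hin : ∀ k, a' ≤ k → k < b' → j ≤ c k := fun k hk hkb =>
      (hcJ k j h1).2 ⟨h1, _, ht, ⟨by simp only; omega, by simp only; omega, rfl⟩,
        by simp only; omega, by simp only; omega, rfl⟩
    obtain rfl : a' = a := by
      by_contra hne
      have := hin (a - 1) (by omega) (by omega)
      have := hr.left (a - 1) (by omega)
      omega
    obtain rfl : b' = b := by
      rcases lt_trichotomy b' b with h7 | h7 | h7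
      · exfalso
        have h8 := hr.joined b' h5 h7
        obtain ⟨-, t', ht', h9, h10⟩ := (hcJ b' j h1).1 h8
        have := (hbox b' j h1 (h8.trans (hcl b'))).unique ⟨ht', h9⟩ ⟨ht, h5, le_rfl, rfl⟩
        rw [this] at h10
        have := h10.2.1
        simp only at this
        omega
      · exact h7
      · exfalso
        have := hin b hr.le h7
        have := hr.right
        omega
    exact ht

end Cover

/-! ### The map from tableaux to tilings -/

section Phi

variable {lam : DyckWord}

/-- Floors do not decrease away from the root, so a step is covered at level `j` exactly when the
edge owning it has floor at least `j`. The non-trivial tiles are thus the runs of more than one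
column, and the filled-in single boxes are the runs of one column. -/
theorem phi0_DTab (T : NaturalLabel lam) : (DTab T).phi0 = DTR T := by
  obtain ⟨hvalid, hDTR⟩ := T.DTR_eq
  have hd := T.describes_DTab
  have htop : (DTab T).topPath = fun x => height lam x + 2 * (T.stripCount x : ℤ) :=
    funext T.topPath_DTab
  have hcov : ∀ j k, 1 ≤ j → ((DTab T).IsCovered j k ↔ j ≤ T.joint k) := by
    intro j k hj
    constructor
    · rintro ⟨e, he, h1, h2⟩
      rw [hd.floor e (T.label_le e)] at he
      obtain ⟨e', he'⟩ := Edge.exists_step (lam := lam) (k := k) (by have := e.down_lt; omega)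
      rw [NaturalLabel.joint_eq he']
      refine he.trans ?_
      have := e'.up_lt_down
      have := e'.up_ne_down e
      have := e.up_ne_down e'
      rcases Edge.cases e e' with rfl | h | h | h | h
      · exact le_rfl
      · exact NaturalLabel.floorOf_le_of_isAbove h
      · have := h.1; have := h.2; omega
      · unfold Edge.IsLeft at h; omega
      · unfold Edge.IsLeft at h; omega
    · intro h
      have hk : k < 2 * lam.semilength := by
        by_contra hc
        rw [NaturalLabel.joint_eq_zero (by omega)] at h
        omega
      obtain ⟨e, he⟩ := Edge.exists_step hk
      rw [NaturalLabel.joint_eq he] at h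
      have := e.up_lt_down
      exact ⟨e, by rw [hd.floor e (T.label_le e)]; exact h, by omega, by omega⟩
  have hnt : (DTab T).nontrivialTiles =
      {t | ∃ j a b, IsRun T.stripCount T.joint j a b ∧ a < b ∧ t = tileAt (height lam) j a b} := by
    ext t
    constructor
    · rintro ⟨j, a, b, hj, hab, h1, h2, h3, rfl⟩
      rw [hcov j b hj] at h3
      refine ⟨j, a, b, ⟨hj, hab.le, ?_, fun k hk hkb => (hcov j k hj).1 (h1 k hk hkb),
        fun k hk => ?_, not_le.1 h3⟩, hab, rfl⟩
      · exact ((hcov j a hj).1 (h1 a le_rfl hab)).trans (hvalid.left a)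
      · have := h2 k hk
        rw [hcov j k hj] at this
        exact not_le.1 this
    · rintro ⟨j, a, b, hr, hab, rfl⟩
      have hj := hr.one_le
      refine ⟨j, a, b, hj, hab, fun k hk hkb => (hcov j k hj).2 (hr.joined k hk hkb),
        fun k hk => ?_, ?_, rfl⟩
      · rw [hcov j k hj]
        exact not_le.2 (hr.left k hk)
      · rw [hcov j b hj]
        exact not_le.2 hr.right
  rw [hDTR]
  refine Tiling.ext rfl htop (Set.ext fun t => ?_)
  simp only [DyckTableau.phi0, hnt, htop, Set.mem_union, Set.mem_ofPred_eq]
  constructor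
  · rintro (⟨j, a, b, hr, -, rfl⟩ | ⟨⟨x, y⟩, hxy, hnot, rfl⟩)
    · exact ⟨j, a, b, hr, rfl⟩
    · obtain ⟨j, h1, h2, rfl⟩ := hvalid.mem_skewShape.1 hxy
      obtain ⟨a, b, hr, h3, h4⟩ := hvalid.exists_isRun h1 h2
      have h5 : ¬ a < b := fun hab => hnot _ ⟨j, a, b, hr, hab, rfl⟩ ⟨h3, h4, rfl⟩
      obtain rfl : a = x := by omega
      obtain rfl : a = b := by omega
      exact ⟨j, a, a, hr, tileAt_self.symm⟩
  · rintro ⟨j, a, b, hr, rfl⟩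
    rcases hr.le.lt_or_eq with hab | rfl
    · exact Or.inl ⟨j, a, b, hr, hab, rfl⟩
    · refine Or.inr ⟨(a, height lam a + (2 * (j : ℤ) - 1)),
        hvalid.mem_skewShape.2 ⟨j, hr.one_le, hr.le_count, rfl⟩, ?_, tileAt_self⟩
      rintro _ ⟨j', a', b', hr', hab', rfl⟩ ⟨h1, h2, h3⟩
      simp only at h1 h2 h3
      obtain rfl : j = j' := by omega
      have := hr.unique hr' le_rfl le_rfl h1 h2
      omega

end Phi

/-! ### Removing the last insertion -/

section Inverse

variable {n m : ℕ} {low : ℕ → ℤ} {v c : ℕ → ℕ}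

theorem growCount_cases (p s : ℕ) (v : ℕ → ℕ) (x : ℕ) :
    (p < x ∧ x < s ∧ growCount p s v x = v x + 1) ∨
      ((x ≤ p ∨ s ≤ x) ∧ growCount p s v x = v x) := by
  unfold growCount
  split_ifs <;> omega

/-- At the right-most eligible column the lower path has a peak, and the tile below the upper path
comes from a spread. -/
theorem Valid.peak_of_isSpecial (h : Valid (n + 1) low v c)
    (hs : (tilingOf low v c).IsEligible (m + 1))
    (hmax : ∀ x, m + 1 < x → ¬ (tilingOf low v c).IsEligible x) :
    low (m + 1) = low m + 1 ∧ low (m + 2) = low m ∧ v (m + 1) = v m ∧ c m = v m ∧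
      c (m + 1) = v m := by
  have hlt := (h.lt_of_isEligible hs).2
  obtain ⟨⟨r, hr, hup⟩, hjoin⟩ := isEligible_tilingOf.1 hs
  obtain rfl : r = m := by omega
  have hnext := hmax (r + 2) (by omega)
  rw [isEligible_tilingOf] at hnext
  have hjoin' : 1 ≤ v (r + 1) → v (r + 1) ≤ c (r + 1) ∨ v (r + 1) ≤ c r := by
    intro h1
    rcases hjoin h1 with h2 | ⟨k, hk, h2⟩
    · exact Or.inl h2
    · obtain rfl : k = r := by omega
      exact Or.inr h2
  have hnext' : low (r + 2) + 2 * (v (r + 2) : ℤ) = low (r + 1) + 2 * (v (r + 1) : ℤ) + 1 →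
      1 ≤ v (r + 2) ∧ c (r + 2) < v (r + 2) ∧ c (r + 1) < v (r + 2) := by
    intro h1
    by_contra hc
    refine hnext ⟨⟨r + 1, rfl, h1⟩, fun h2 => ?_⟩
    by_cases h3 : v (r + 2) ≤ c (r + 2)
    · exact Or.inl h3
    · exact Or.inr ⟨r + 1, rfl, by omega⟩
  have h1 := h.low_path.step r (by omega)
  have h2 := h.low_path.step (r + 1) (by omega)
  have h3 := h.up_path.step (r + 1) (by omega)
  have hl := h.left r
  have hl' := h.left (r + 1)
  have hr := h.right r
  have hr' := h.right (r + 1)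
  beta_reduce at h3
  change low (r + 2) = _ ∨ low (r + 2) = _ at h2
  change low (r + 2) + 2 * (v (r + 2) : ℤ) = _ ∨ low (r + 2) + 2 * (v (r + 2) : ℤ) = _ at h3
  change _ ≤ v (r + 2) at hr'
  -- If `low` descended here, the top box of column `r + 1` would be too high to be joined to the
  -- left, hence joined to the right. A further descent contradicts `nest`; an ascent would make `r
  -- + 2` eligible or leave no box there to join.
  have hU : low (r + 1) = low r + 1 := by
    by_contra hc
    rcases h2 with h2 | h2
    · rcases h3 with h3 | h3
      · have := hnext' h3
        omega
      · omega
    · obtain ⟨p, hp⟩ := h.low_path.exists_match_down (k := r + 1) (by omega) h2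
      have := (h.nest p (r + 1) hp r (by have := hp.1; omega) (by omega)).2
      omega
  -- If `low` went on rising, `nest` would turn a joint on the left into one on the right. Column `r
  -- + 2` would then be eligible or have too few boxes.
  have hD : low (r + 2) = low (r + 1) - 1 := by
    by_contra hc
    obtain ⟨q, hq⟩ := h.low_path.exists_match_up (k := r) hU
    have h5 := (h.nest r q hq (r + 1) (by omega) (by have := hq.1; omega)).1
    rcases h3 with h3 | h3
    · have := hnext' h3
      omega
    · omega
  have hmatch : IsMatch low r (r + 1) :=
    ⟨by omega, by change low (r + 2) = _; omega, fun k h4 h5 => by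
      obtain rfl : k = r + 1 := by omega
      omega⟩
  have h5 := h.nest r (r + 1) hmatch r le_rfl (by omega)
  have h6 := h.nest r (r + 1) hmatch (r + 1) (by omega) le_rfl
  refine ⟨hU, by omega, by omega, ?_, ?_⟩ <;> omega

/-- The ribbon that ends the last insertion can be removed. -/
theorem Valid.exists_shrink (h : Valid (n + 1) low v c)
    (hs : (tilingOf low v c).IsEligible (m + 1))
    (hmax : ∀ x, m + 1 < x → ¬ (tilingOf low v c).IsEligible x) :
    ∃ v' s, Valid (n + 1) low v' c ∧ v = growCount (m + 1) s v' ∧ (∀ x, x ≤ m + 1 → v' x = v x) ∧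
      v' (m + 2) = v m ∧ IsSpecial (tilingOf low v' c) s := by
  classical
  obtain ⟨p1, p2, p3, p4, p5⟩ := h.peak_of_isSpecial hs hmax
  have hlt := (h.lt_of_isEligible hs).2
  have h3 := h.up_path.step (m + 1) (by omega)
  beta_reduce at h3
  change low (m + 2) + 2 * (v (m + 2) : ℤ) = _ ∨ low (m + 2) + 2 * (v (m + 2) : ℤ) = _ at h3
  rcases h3 with h3 | h3
  swap
  -- The upper path already descends after the special column: the ribbon is empty.
  · refine ⟨v, m + 1, h, funext fun x => ?_, fun _ _ => rfl, by omega, Or.inl hs, hmax⟩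
    have := growCount_cases (m + 1) (m + 1) v x
    omega
  have hex : ∃ r, m + 1 ≤ r ∧ low (r + 1) + 2 * (v (r + 1) : ℤ) = low r + 2 * (v r : ℤ) - 1 ∧
      (1 ≤ v (r + 1) → v (r + 1) ≤ c (r + 1) ∨ v (r + 1) ≤ c r) := by
    -- The last step of the upper path goes down to a column without boxes, so the search for the
    -- end of the ribbon stops.
    refine ⟨2 * n + 1, by omega, ?_, ?_⟩
    · have h4 := h.up_path.step (2 * n + 1) (by omega)
      have h5 := h.up_path.tail (2 * n + 1 + 1) (by omega)
      have h6 := h.up_path.nonneg (2 * n + 1)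
      beta_reduce at h4 h5 h6
      omega
    · intro h4
      rw [h.count_eq_zero (by omega)] at h4
      omega
  have hr1 := Nat.find_spec hex
  have hr2 : ∀ k, k < Nat.find hex → ¬ _ := fun k => Nat.find_min hex
  generalize Nat.find hex = r at hr1 hr2
  obtain ⟨hmr, hdown, hjoin⟩ := hr1
  have hne : m + 1 ≠ r := by
    rintro rfl
    change low (m + 2) + 2 * (v (m + 2) : ℤ) = _ at hdown
    omega
  -- Every column of the ribbon is topped by a single box: otherwise an up step would give an
  -- eligible column too far right, and a down step would have stopped the search earlier.
  have hin : ∀ y, m + 1 ≤ y → y < r → 1 ≤ v (y + 1) ∧ c (y + 1) < v (y + 1) ∧ c y < v (y + 1) := by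
    intro y hy hyr
    by_contra hc
    have hc' : 1 ≤ v (y + 1) → v (y + 1) ≤ c (y + 1) ∨ v (y + 1) ≤ c y := by omega
    rcases lt_or_ge y (2 * (n + 1)) with hyn | hyn
    · rcases h.up_path.step y hyn with h4 | h4
      · refine hmax (y + 1) (by omega) (isEligible_tilingOf.2 ⟨⟨y, rfl, h4⟩, fun h5 => ?_⟩)
        rcases hc' h5 with h6 | h6
        · exact Or.inl h6
        · exact Or.inr ⟨y, rfl, h6⟩
      · exact hr2 y hyr ⟨hy, h4, hc'⟩
    · have h4 := h.up_path.tail y hyn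
      have h5 := h.up_path.tail r (by omega)
      have h6 := h.up_path.nonneg (r + 1)
      beta_reduce at h4 h5 h6
      omega
  set v' : ℕ → ℕ := fun x => if m + 1 < x ∧ x < r + 1 then v x - 1 else v x with hv'
  have hv : ∀ x, (m + 1 < x ∧ x < r + 1 ∧ v' x + 1 = v x ∧ c x < v x ∧ ∀ k, k + 1 = x → c k < v x) ∨
      ((x ≤ m + 1 ∨ r + 1 ≤ x) ∧ v' x = v x) := by
    intro x
    by_cases hx : m + 1 < x ∧ x < r + 1
    · left
      obtain ⟨y, rfl⟩ : ∃ y, x = y + 1 := ⟨x - 1, by omega⟩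
      have h4 := hin y (by omega) (by omega)
      refine ⟨hx.1, hx.2, ?_, h4.2.1, fun k hk => ?_⟩
      · simp only [hv']
        rw [if_pos hx]
        omega
      · obtain rfl : k = y := by omega
        exact h4.2.2
    · right
      simp only [hv']
      rw [if_neg hx]
      omega
  have hrn : r < 2 * (n + 1) := by
    refine h.up_path.lt_of_pos ?_
    have h6 := h.up_path.nonneg (r + 1)
    beta_reduce at h6 ⊢
    omega
  refine ⟨v', r + 1, ⟨h.low_path, ⟨?_, fun k hk => ?_, fun x hx => ?_, fun x => ?_⟩, fun k => ?_,
    fun k => ?_, h.nest⟩, funext fun x => ?_, fun x hx => ?_, ?_, Or.inl ?_, fun x hx => ?_⟩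
  · have h4 := h.up_path.zero
    have h5 := hv 0
    beta_reduce at h4 ⊢
    rw [(h5.resolve_left (by omega)).2, h4]
  · have h4 := h.up_path.step k hk
    have h5 := hv k
    have h6 := hv (k + 1)
    beta_reduce at h4 ⊢
    have h7 : k = m + 1 → low (k + 1) + 2 * (v (k + 1) : ℤ) = low k + 2 * (v k : ℤ) + 1 := by
      rintro rfl; exact h3
    have h8 : k = r → low (k + 1) + 2 * (v (k + 1) : ℤ) = low k + 2 * (v k : ℤ) - 1 := by
      rintro rfl; exact hdown
    omega
  · have h4 := h.up_path.tail x hx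
    have h5 := hv x
    beta_reduce at h4 ⊢
    rw [(h5.resolve_left (by omega)).2, h4]
  · have h4 := h.low_path.nonneg x
    omega
  · have h4 := h.left k
    have h5 := hv k
    omega
  · have h4 := h.right k
    rcases hv (k + 1) with h5 | h5
    · have := h5.2.2.2.2 k rfl
      omega
    · omega
  · have h5 := hv x
    have h6 := growCount_cases (m + 1) (r + 1) v' x
    omega
  · have h5 := hv x
    omega
  · have h5 := hv (m + 2)
    omega
  · rw [isEligible_tilingOf]
    have h5 := hv r
    have h6 := hv (r + 1)
    refine ⟨⟨r, rfl, by omega⟩, fun h7 => ?_⟩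
    have h8 : v' (r + 1) = v (r + 1) := by omega
    rw [h8] at h7 ⊢
    rcases hjoin h7 with h9 | h9
    · exact Or.inl h9
    · exact Or.inr ⟨r, rfl, h9⟩
  · intro hel
    refine hmax x (by omega) ?_
    rw [isEligible_tilingOf] at hel ⊢
    obtain ⟨⟨q, rfl, h4⟩, h5⟩ := hel
    have h6 := hv q
    have h7 := hv (q + 1)
    have h8 : v' (q + 1) = v (q + 1) := by omega
    have h9 : v' q = v q := by omega
    rw [h8] at h4 h5
    rw [h9] at h4
    exact ⟨⟨q, rfl, h4⟩, h5⟩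

/-- Every nonempty cover-inclusive Dyck tiling arises by an insertion. -/
theorem Valid.exists_insert (h : Valid (n + 1) low v c) :
    ∃ m low' v' c', m ≤ 2 * n ∧ Valid n low' v' c' ∧ low = spreadPath m low' ∧
      tilingOf low v c = ((tilingOf low' v' c').spread m).ribbonGrowth m := by
  obtain ⟨s, hs1, hmax⟩ := h.exists_isSpecial
  -- Both paths begin with an up step, so column `1` holds no box and the special column is
  -- positive.
  have h1 : (tilingOf low v c).IsEligible 1 := by
    have h2 := h.low_path.zero
    have h3 := h.up_path.zero
    have h4 := h.low_path.step 0 (by omega)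
    have h5 := h.up_path.step 0 (by omega)
    have h6 := h.low_path.nonneg 1
    have h7 := h.up_path.nonneg 1
    beta_reduce at h3 h5 h7
    rw [zero_add] at h4 h5
    exact isEligible_tilingOf.2 ⟨⟨0, rfl, by omega⟩, fun h8 => by omega⟩
  have hs0 : 1 ≤ s := not_lt.1 fun hlt => hmax 1 hlt h1
  have hs := hs1.resolve_right (by omega)
  obtain ⟨m, rfl⟩ : ∃ m, s = m + 1 := ⟨s - 1, by omega⟩
  have hlt := (h.lt_of_isEligible hs).2
  obtain ⟨p1, p2, p3, p4, p5⟩ := h.peak_of_isSpecial hs hmax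
  obtain ⟨w, s', hw, hgrow, hle, hw2, hspec⟩ := h.exists_shrink hs hmax
  have e1 : low = spreadPath m fun x => if x ≤ m then low x else low (x + 2) := by
    funext x
    rcases spread_cases m x with hx | rfl | ⟨z, hz, rfl⟩
    · rw [spreadPath_of_le hx, if_pos hx]
    · rw [spreadPath_mid, if_pos le_rfl, p1]
    · rw [spreadPath_add_two hz]
      split_ifs with hzm
      · obtain rfl : z = m := by omega
        exact p2
      · rfl
  have e2 : w = spreadCount m fun x => if x ≤ m then w x else w (x + 2) := by
    funext x
    rcases spread_cases m x with hx | rfl | ⟨z, hz, rfl⟩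
    · rw [spreadCount_of_le hx, if_pos hx]
    · rw [spreadCount_mid, if_pos le_rfl, hle _ le_rfl, hle _ (by omega), p3]
    · rw [spreadCount_add_two hz]
      split_ifs with hzm
      · obtain rfl : z = m := by omega
        rw [hw2, hle _ (by omega)]
      · rfl
  have e3 : c = spreadJoint m (fun x => if x ≤ m then w x else w (x + 2))
      fun k => if k < m then c k else c (k + 2) := by
    funext k
    rcases Nat.lt_or_ge k m with hk | hk
    · rw [spreadJoint_of_lt hk, if_pos hk]
    rcases Nat.lt_or_ge k (m + 2) with hk' | hk'
    · rw [spreadJoint_mid hk hk', if_pos le_rfl, hle _ (by omega)]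
      obtain rfl | rfl : k = m ∨ k = m + 1 := by omega
      · exact p4
      · exact p5
    · obtain ⟨k, rfl⟩ : ∃ z, k = z + 2 := ⟨k - 2, by omega⟩
      rw [spreadJoint_add_two (by omega), if_neg (by omega)]
  have hvalid : Valid n _ _ _ := Valid.of_spread (m := m)
    (low := fun x => if x ≤ m then low x else low (x + 2))
    (v := fun x => if x ≤ m then w x else w (x + 2))
    (c := fun k => if k < m then c k else c (k + 2)) (by rw [← e1, ← e2, ← e3]; exact hw) (by omega)
  refine ⟨m, _, _, _, by omega, hvalid, e1, ?_⟩
  rw [spread_tilingOf hvalid.right, ← e1, ← e2, ← e3, ribbonGrowth_tilingOf hw.left hw.right,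
    hspec.specialColumn_eq, ← hgrow]

/-- If the second ribbon reached beyond `s₁ > p`, then `v₁ s₁ = v₂ s₁ + 1` would exceed all joints
at this column, so its top box would be single and `s₁` not eligible. If `s₁ = p`, the first ribbon
is empty, and comparing columns `p` and `p + 1`, where both upper paths descend, shows that the
second is empty too. -/
theorem growCount_special_le {v₁ v₂ : ℕ → ℕ} {p s₁ s₂ : ℕ} (hl : ∀ k, c k ≤ v₂ k)
    (hr : ∀ k, c k ≤ v₂ (k + 1)) (h1 : (tilingOf low v₁ c).IsEligible s₁)
    (h2 : (tilingOf low v₂ c).IsEligible s₂) (hp : p ≤ s₁)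
    (hd1 : low (p + 1) + 2 * (v₁ (p + 1) : ℤ) = low p + 2 * (v₁ p : ℤ) - 1)
    (hd2 : low (p + 1) + 2 * (v₂ (p + 1) : ℤ) = low p + 2 * (v₂ p : ℤ) - 1)
    (heq : growCount p s₁ v₁ = growCount p s₂ v₂) : s₂ ≤ s₁ := by
  by_contra hc
  obtain ⟨⟨r₁, rfl, h3⟩, h4⟩ := isEligible_tilingOf.1 h1
  obtain ⟨⟨r₂, rfl, h5⟩, h6⟩ := isEligible_tilingOf.1 h2
  rcases hp.lt_or_eq with hp | rfl
  · have h7 := congrFun heq (r₁ + 1)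
    have h8 := growCount_cases p (r₁ + 1) v₁ (r₁ + 1)
    have h9 := growCount_cases p (r₂ + 1) v₂ (r₁ + 1)
    have h10 := hl (r₁ + 1)
    rcases h4 (by omega) with h11 | ⟨k, hk, h11⟩
    · omega
    · have h12 := hr k
      rw [hk] at h12
      omega
  · have hne : r₂ ≠ r₁ + 1 := by
      rintro rfl
      omega
    have h7 := congrFun heq (r₁ + 1 + 1)
    have h8 := growCount_cases (r₁ + 1) (r₁ + 1) v₁ (r₁ + 1 + 1)
    have h9 := growCount_cases (r₁ + 1) (r₂ + 1) v₂ (r₁ + 1 + 1)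
    have h10 := congrFun heq (r₁ + 1)
    have h11 := growCount_cases (r₁ + 1) (r₁ + 1) v₁ (r₁ + 1)
    have h12 := growCount_cases (r₁ + 1) (r₂ + 1) v₂ (r₁ + 1)
    omega

/-- An insertion can be undone in only one way. -/
theorem Valid.insert_injective {m' : ℕ} {low' : ℕ → ℤ} {v' c' : ℕ → ℕ} (h : Valid n low v c)
    (h' : Valid n low' v' c') (hm : m ≤ 2 * n) (hm' : m' ≤ 2 * n)
    (heq : ((tilingOf low v c).spread m).ribbonGrowth m =
      ((tilingOf low' v' c').spread m').ribbonGrowth m') :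
    m = m' ∧ tilingOf low v c = tilingOf low' v' c' := by
  obtain ⟨s, hs⟩ := h.exists_isSpecial
  obtain ⟨s', hs'⟩ := h'.exists_isSpecial
  obtain ⟨a1, a2, a3⟩ := h.insert hm hs
  obtain ⟨b1, b2, b3⟩ := h'.insert hm' hs'
  rw [a1, b1] at heq
  -- The line of the spread can be recovered, since the special column after the insertion is `m +
  -- 1`.
  obtain rfl : m = m' := by
    have := a3.specialColumn_eq
    rw [heq, b3.specialColumn_eq] at this
    omega
  refine ⟨rfl, ?_⟩
  obtain ⟨e1, e2, e3⟩ := a2.ext b2 heq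
  have hlow : low = low' := by
    funext x
    rcases le_total x m with hx | hx
    · have := congrFun e1 x
      rwa [spreadPath_of_le hx, spreadPath_of_le hx] at this
    · have := congrFun e1 (x + 2)
      rwa [spreadPath_add_two hx, spreadPath_add_two hx] at this
  have hc : c = c' := by
    funext k
    rcases Nat.lt_or_ge k m with hx | hx
    · have := congrFun e3 k
      rwa [spreadJoint_of_lt hx, spreadJoint_of_lt hx] at this
    · have := congrFun e3 (k + 2)
      rwa [spreadJoint_add_two hx, spreadJoint_add_two hx] at this
  subst hlow hc
  have hS := hs.spread (m := m)
  have hS' := hs'.spread (m := m)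
  generalize (if s ≤ m then m + 1 else s + 2) = S at *
  generalize (if s' ≤ m then m + 1 else s' + 2) = S' at *
  have hv := h.spread hm
  have hv' := h'.spread hm
  have hmS : m + 1 ≤ S := not_lt.1 fun hlt => hS.2 _ hlt isEligible_spread_mid
  have hmS' : m + 1 ≤ S' := not_lt.1 fun hlt => hS'.2 _ hlt isEligible_spread_mid
  have hES := hS.1.resolve_right (by omega)
  have hES' := hS'.1.resolve_right (by omega)
  have hdown : ∀ w : ℕ → ℕ,
      spreadPath m low (m + 1 + 1) + 2 * (spreadCount m w (m + 1 + 1) : ℤ) =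
        spreadPath m low (m + 1) + 2 * (spreadCount m w (m + 1) : ℤ) - 1 := by
    intro w
    rw [show m + 1 + 1 = m + 2 by rfl, spreadPath_add_two le_rfl, spreadCount_add_two le_rfl,
      spreadPath_mid, spreadCount_mid]
    omega
  rw [← e3] at hES' hv'
  have hSS : S = S' := le_antisymm
    (growCount_special_le hv.left hv.right hES' hES hmS' (hdown v') (hdown v) e2.symm)
    (growCount_special_le hv'.left hv'.right hES hES' hmS (hdown v) (hdown v') e2)
  subst hSS
  have hcount : ∀ x, spreadCount m v x = spreadCount m v' x := by
    intro x
    have h1 := congrFun e2 x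
    have h2 := growCount_cases (m + 1) S (spreadCount m v) x
    have h3 := growCount_cases (m + 1) S (spreadCount m v') x
    omega
  have : v = v' := by
    funext x
    rcases le_total x m with hx | hx
    · have := hcount x
      rwa [spreadCount_of_le hx, spreadCount_of_le hx] at this
    · have := hcount (x + 2)
      rwa [spreadCount_add_two hx, spreadCount_add_two hx] at this
  rw [this]

end Inverse

/-! ### The ribbon map is a bijection -/

section Bijection

variable {lam : DyckWord} {S : Set (Edge lam)} {n i x y : ℕ} {low : ℕ → ℤ} {v c : ℕ → ℕ}

theorem stepCount_injective {k l : ℕ} (hk : stepCount S (k + 1) = stepCount S k + 1)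
    (hl : stepCount S (l + 1) = stepCount S l + 1) (h : stepCount S k = stepCount S l) : k = l := by
  rcases lt_trichotomy k l with h1 | h1 | h1
  · have := stepCount_mono (S := S) (Nat.succ_le_of_lt h1)
    simp only [Nat.succ_eq_add_one] at this
    omega
  · exact h1
  · have := stepCount_mono (S := S) (Nat.succ_le_of_lt h1)
    simp only [Nat.succ_eq_add_one] at this
    omega

theorem exists_step_of_lt_stepCount (h : y < stepCount S x) :
    ∃ e ∈ S, stepCount S e.up = y ∨ stepCount S e.down = y := by
  induction x with
  | zero => simp [stepCount_zero.1] at h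
  | succ x ih =>
    by_cases hx : y < stepCount S x
    · exact ih hx
    by_cases hu : ∃ e ∈ S, e.up = x
    · obtain ⟨e, he, rfl⟩ := hu
      have := (stepCount_up_succ he).1
      exact ⟨e, he, Or.inl (by omega)⟩
    by_cases hd : ∃ e ∈ S, e.down = x
    · obtain ⟨e, he, rfl⟩ := hd
      have := (stepCount_down_succ he).1
      exact ⟨e, he, Or.inr (by omega)⟩
    · push Not at hu hd
      rw [stepCount_congr (Nat.le_succ x) (fun e he _ => by have := hu e he; omega)
        (fun e he _ => by have := hd e he; omega)] at h
      exact absurd h hx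

theorem stepCount_two_mul_semilength : stepCount S (2 * lam.semilength) = 2 * S.ncard := by
  have h1 : {e | e ∈ S ∧ e.up < 2 * lam.semilength} = S :=
    Set.sep_eq_self_iff_mem_true.2 fun e _ => e.up_lt_down.trans e.down_lt
  have h2 : {e | e ∈ S ∧ e.down < 2 * lam.semilength} = S :=
    Set.sep_eq_self_iff_mem_true.2 fun e _ => e.down_lt
  rw [stepCount, h1, h2, two_mul]

theorem ncard_univ_edge : (Set.univ : Set (Edge lam)).ncard = lam.semilength := by
  have := stepCount_two_mul_semilength (S := (Set.univ : Set (Edge lam)))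
  rw [(stepCount_univ le_rfl).1] at this
  omega

namespace NaturalLabel

variable {T T' : NaturalLabel lam}

theorem insertionHistory_eq_initial {e : Edge lam} (he : T.label e = i + 1) :
    T.insertionHistory (i + 1) = stepCount (T.initial i) e.up := by
  rw [← he, insertionHistory_eq, he]
  rfl

theorem ribbonTiling_pred_eq (hi : i + 1 ≤ lam.semilength)
    (h : T.ribbonTiling (i + 1) = T'.ribbonTiling (i + 1)) :
    T.insertionHistory (i + 1) = T'.insertionHistory (i + 1) ∧
      T.ribbonTiling i = T'.ribbonTiling i := by
  obtain ⟨low, v, c, s, h1⟩ := T.exists_isStage (Nat.le_of_succ_le hi)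
  obtain ⟨low', v', c', s', h2⟩ := T'.exists_isStage (Nat.le_of_succ_le hi)
  have hle : ∀ T₀ : NaturalLabel lam, T₀.insertionHistory (i + 1) ≤ 2 * i := fun T₀ => by
    obtain ⟨e, he⟩ := T₀.exists_label (Nat.le_add_left 1 i) hi
    rw [insertionHistory_eq_initial he]
    exact stepCount_initial_le (Nat.le_of_succ_le hi)
  rw [ribbonTiling, ribbonTiling, h1.tiling, h2.tiling] at h
  rw [h1.tiling, h2.tiling]
  exact h1.valid.insert_injective h2.valid (hle T) (hle T') h

theorem ribbonTiling_eq_of_DTR_eq (h : DTR T = DTR T') (hi : i ≤ lam.semilength) :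
    T.ribbonTiling i = T'.ribbonTiling i := by
  induction hi using Nat.decreasingInduction with
  | self => exact h
  | of_succ i hi ih => exact (ribbonTiling_pred_eq hi ih).2

/-- Descending induction on `i`. If all larger labels agree, both labellings have the same set of
remaining edges, and the common line of insertion is the position of the up step of the edge
labelled `i + 1` among their steps. -/
theorem label_eq_of_DTR_eq (h : DTR T = DTR T') (hi : i ≤ lam.semilength) :
    ∀ e, i < T.label e ∨ i < T'.label e → T.label e = T'.label e := by
  induction hi using Nat.decreasingInduction with
  | self =>
    intro e he
    have := T.label_le e
    have := T'.label_le e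
    omega
  | of_succ i hi ih =>
    obtain ⟨e₁, h1⟩ := T.exists_label (Nat.le_add_left 1 i) hi
    obtain ⟨e₂, h2⟩ := T'.exists_label (Nat.le_add_left 1 i) hi
    have hS : T.initial (i + 1) = T'.initial (i + 1) := by
      ext e
      have := ih e
      simp only [initial, Set.mem_ofPred_eq]
      omega
    have hh := (ribbonTiling_pred_eq hi (ribbonTiling_eq_of_DTR_eq h hi)).1
    -- Both positions are rewritten as counts over the common set of remaining edges; an edge has no
    -- step of its own before its up step.
    rw [insertionHistory_eq_initial h1, insertionHistory_eq_initial h2,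
      ← ((stepCount_insert (not_mem_initial h1)).1 le_rfl).1,
      ← ((stepCount_insert (not_mem_initial h2)).1 le_rfl).1, ← initial_succ h1,
      ← initial_succ h2, ← hS] at hh
    have m1 : e₁ ∈ T.initial (i + 1) := by rw [initial_succ h1]; exact Set.mem_insert _ _
    have m2 : e₂ ∈ T.initial (i + 1) := by rw [hS, initial_succ h2]; exact Set.mem_insert _ _
    obtain rfl : e₁ = e₂ :=
      Edge.ext_up (stepCount_injective (stepCount_up_succ m1).1 (stepCount_up_succ m2).1 hh)
    intro e he
    by_cases he1 : T.label e = i + 1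
    · rw [T.label_inj (he1.trans h1.symm), h1, h2]
    by_cases he2 : T'.label e = i + 1
    · rw [T'.label_inj (he2.trans h2.symm), h1, h2]
    exact ih e (by omega)

theorem DTR_injective : Function.Injective (DTR : NaturalLabel lam → Tiling) := fun T _ h =>
  NaturalLabel.ext (funext fun e =>
    label_eq_of_DTR_eq h (Nat.zero_le _) e (Or.inl (T.label_pos e)))

end NaturalLabel

/-- The tiling obtained from the empty one by insertions at the lines `h 1, …, h i`. -/
noncomputable def insertSeq (h : ℕ → ℕ) : ℕ → Tiling
  | 0 => ⟨fun _ => 0, fun _ => 0, ∅⟩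
  | i + 1 => ((insertSeq h i).spread (h (i + 1))).ribbonGrowth (h (i + 1))

theorem insertSeq_congr {h h' : ℕ → ℕ} (hh : ∀ k, 1 ≤ k → k ≤ i → h k = h' k) :
    insertSeq h i = insertSeq h' i := by
  induction i with
  | zero => rfl
  | succ i ih =>
    rw [insertSeq, insertSeq, ih fun k h1 h2 => hh k h1 (by omega), hh (i + 1) (by omega) le_rfl]

theorem NaturalLabel.ribbonTiling_eq_insertSeq (T : NaturalLabel lam) :
    T.ribbonTiling i = insertSeq T.insertionHistory i := by
  induction i with
  | zero => rfl
  | succ i ih => rw [ribbonTiling, insertSeq, ih]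

theorem Valid.tilingOf_zero (h : Valid 0 low v c) :
    tilingOf low v c = ⟨fun _ => 0, fun _ => 0, ∅⟩ := by
  have h1 : ∀ x, low x = 0 := fun x => h.low_path.tail x (by omega)
  have h2 : ∀ x, low x + 2 * (v x : ℤ) = 0 := fun x => h.up_path.tail x (by omega)
  refine Tiling.ext (funext h1) (funext h2) (Set.eq_empty_iff_forall_notMem.2 ?_)
  rintro t ⟨j, a, b, hr, -⟩
  have := hr.one_le
  have := hr.le_count
  have := h1 a
  have := h2 a
  omega

/-- A labelling of the edges in `S` by `1, …, i` that increases from the root to the leaves and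
whose insertion history agrees with `h`. -/
structure IsPartialLabel (S : Set (Edge lam)) (i : ℕ) (l : Edge lam → ℕ) (h : ℕ → ℕ) : Prop where
  bijOn : Set.BijOn l S (Set.Icc 1 i)
  increasing : ∀ e ∈ S, ∀ e' ∈ S, e.IsAbove e' → l e < l e'
  history : ∀ e ∈ S, h (l e) = stepCount {e' | e' ∈ S ∧ l e' < l e} e.up

/-- If the low path of the edges in `S` is spread from `low'` at `x = m`, then the two new steps
belong to an edge in `S` which is not above another one. -/
theorem exists_leaf {m : ℕ} {low' : ℕ → ℤ} (hm : m + 1 < 2 * S.ncard)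
    (hlow : ∀ x, spreadPath m low' (stepCount S x) = partialHeight S x) :
    ∃ e ∈ S, stepCount S e.up = m ∧ stepCount S e.down = m + 1 ∧
      ∀ e' ∈ S, ¬ e.IsAbove e' := by
  have s0 : spreadPath m low' m = low' m := spreadPath_of_le le_rfl
  have s1 : spreadPath m low' (m + 1) = low' m + 1 := spreadPath_mid
  have s2 : spreadPath m low' (m + 1 + 1) = low' m := spreadPath_add_two le_rfl
  have hup : ∃ e ∈ S, stepCount S e.up = m := by
    obtain ⟨e, he, h | h⟩ := exists_step_of_lt_stepCount (S := S) (x := 2 * lam.semilength) (y := m)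
      (by rw [stepCount_two_mul_semilength]; omega)
    · exact ⟨e, he, h⟩
    · obtain ⟨h1, h2⟩ := stepCount_down_succ he
      rw [← hlow, ← hlow, h1, h] at h2
      omega
  have hdown : ∃ e ∈ S, stepCount S e.down = m + 1 := by
    obtain ⟨e, he, h | h⟩ := exists_step_of_lt_stepCount (S := S) (x := 2 * lam.semilength)
      (y := m + 1) (by rw [stepCount_two_mul_semilength]; omega)
    · obtain ⟨h1, h2⟩ := stepCount_up_succ he
      rw [← hlow, ← hlow, h1, h] at h2
      omega
    · exact ⟨e, he, h⟩
  obtain ⟨e, he, hu⟩ := hup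
  obtain ⟨e', he', hd⟩ := hdown
  have u1 := (stepCount_up_succ he).1
  have u2 := (stepCount_up_succ he').1
  have d1 := (stepCount_down_succ he).1
  have d2 := (stepCount_down_succ he').1
  have mono : ∀ {x y}, x < y → stepCount S (x + 1) ≤ stepCount S y := fun h => stepCount_mono h
  have hud := mono e'.up_lt_down
  obtain rfl : e = e' := by
    rcases Edge.cases e e' with h | h | h | h | h
    · exact h
    · have := mono h.1; omega
    · have := mono h.2; have := mono e.up_lt_down; omega
    · have := mono h; have := mono e.up_lt_down; omega
    · have := mono h; omega
  refine ⟨e, he, hu, hd, fun e'' he'' h => ?_⟩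
  have := mono h.1
  have := (stepCount_up_succ he'').1
  have := mono (e''.up_lt_down.trans h.2)
  omega

/-- The last insertion is undone; the two steps of its spread form a leaf of the subtree `S`, which
receives the largest label, and the rest is labelled by induction. Subtrees of `lam` closed towards
the root replace the whole tree, so that the edges keep their identity when a leaf is removed. -/
theorem exists_isPartialLabel (hS : ∀ e ∈ S, ∀ e' : Edge lam, e'.IsAbove e → e' ∈ S)
    (hcard : S.ncard = i) (hv : Valid i low v c)
    (hlow : ∀ x, low (stepCount S x) = partialHeight S x) :
    ∃ l h, IsPartialLabel S i l h ∧ insertSeq h i = tilingOf low v c := by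
  induction i generalizing S low v c with
  | zero =>
    rw [Set.ncard_eq_zero] at hcard
    subst hcard
    exact ⟨fun _ => 0, fun _ => 0, ⟨by simp, by simp, by simp⟩, hv.tilingOf_zero.symm⟩
  | succ i ih =>
    obtain ⟨m, low', v', c', hm, hv', rfl, htil⟩ := hv.exists_insert
    obtain ⟨e, he, hu, hd, hleaf⟩ := exists_leaf (by omega) hlow
    have hins : insert e (S \ {e}) = S := Set.insert_sdiff_self_of_mem he
    have hnot : e ∉ S \ {e} := fun h => h.2 rfl
    have hS' : ∀ e₁ ∈ S \ {e}, ∀ e₂ : Edge lam, e₂.IsAbove e₁ → e₂ ∈ S \ {e} := fun e₁ h1 e₂ h2 =>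
      ⟨hS e₁ h1.1 e₂ h2, fun h => hleaf e₁ h1.1 (by rwa [Set.mem_singleton_iff.1 h] at h2)⟩
    have hcard' : (S \ {e}).ncard = i := by
      rw [Set.ncard_sdiff_singleton_of_mem he, hcard, Nat.add_sub_cancel]
    have hlow' : ∀ x, low' (stepCount (S \ {e}) x) = partialHeight (S \ {e}) x := by
      intro x
      obtain ⟨h1, h2, h3⟩ := stepCount_insert (x := x) hnot
      rw [hins] at h1 h2 h3
      have h4 := hlow x
      rcases le_or_gt x e.up with h5 | h5
      · obtain ⟨h6, h7⟩ := h1 h5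
        have := stepCount_mono (S := S) h5
        rw [spreadPath_of_le (by omega), h6, h7] at h4
        exact h4
      rcases le_or_gt x e.down with h8 | h8
      · obtain ⟨h6, h7⟩ := h2 h5 h8
        have h9 := (stepCount_up_succ he).1
        have h10 : stepCount S (e.up + 1) ≤ stepCount S x := stepCount_mono h5
        have h11 := stepCount_mono (S := S) h8
        rw [show stepCount S x = m + 1 by omega, spreadPath_mid, h7] at h4
        rw [show stepCount (S \ {e}) x = m by omega]
        omega
      · obtain ⟨h6, h7⟩ := h3 h8
        have h9 := (stepCount_down_succ he).1
        have h10 : stepCount S (e.down + 1) ≤ stepCount S x := stepCount_mono h8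
        rw [h6, spreadPath_add_two (by omega), h7] at h4
        exact h4
    obtain ⟨l, h, hl, hseq⟩ := ih hS' hcard' hv' hlow'
    classical
    have hle : ∀ e₁ ∈ S \ {e}, 1 ≤ l e₁ ∧ l e₁ ≤ i := fun e₁ h1 => hl.bijOn.mapsTo h1
    have hl1 : ∀ e₁ ∈ S, e₁ ≠ e → Function.update l e (i + 1) e₁ = l e₁ ∧ e₁ ∈ S \ {e} :=
      fun e₁ h1 h2 => ⟨Function.update_of_ne h2 _ _, h1, h2⟩
    have hle' : Function.update l e (i + 1) e = i + 1 := Function.update_self _ _ _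
    refine ⟨Function.update l e (i + 1), Function.update h (i + 1) m, ⟨?_, ?_, ?_⟩, ?_⟩
    · have h1 : Set.BijOn (Function.update l e (i + 1)) (S \ {e}) (Set.Icc 1 i) :=
        hl.bijOn.congr fun e₁ h1 => (Function.update_of_ne h1.2 _ _).symm
      have h2 := h1.insert (a := e) (by rw [hle']; simp)
      rwa [hins, hle', ← Order.succ_eq_add_one, Set.insert_Icc_right_eq_Icc_succ (by simp)] at h2
    · intro e₁ h1 e₂ h2 h3
      obtain ⟨h4, h5⟩ := hl1 e₁ h1 fun h4 => hleaf e₂ h2 (h4 ▸ h3)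
      rw [h4]
      by_cases h6 : e₂ = e
      · rw [h6, hle']
        have := hle e₁ h5
        omega
      · obtain ⟨h7, h8⟩ := hl1 e₂ h2 h6
        rw [h7]
        exact hl.increasing e₁ h5 e₂ h8 h3
    · intro e₁ h1
      by_cases h6 : e₁ = e
      · subst h6
        rw [hle', Function.update_self, ← hu, ← hins, ((stepCount_insert hnot).1 le_rfl).1, hins]
        congr 1
        ext e₂
        constructor
        · intro h2
          have := (hle e₂ h2).2
          exact ⟨h2.1, by rw [Function.update_of_ne h2.2]; omega⟩
        · rintro ⟨h2, h3⟩
          exact ⟨h2, fun h4 => by rw [Set.mem_singleton_iff.1 h4, hle'] at h3; omega⟩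
      · obtain ⟨h7, h8⟩ := hl1 e₁ h1 h6
        have h9 := hle e₁ h8
        rw [h7, Function.update_of_ne (by omega), hl.history e₁ h8]
        congr 1
        ext e₂
        constructor
        · rintro ⟨h2, h3⟩
          exact ⟨h2.1, by rwa [Function.update_of_ne h2.2]⟩
        · rintro ⟨h2, h3⟩
          by_cases h4 : e₂ = e
          · rw [h4, hle'] at h3
            omega
          · obtain ⟨h5, h10⟩ := hl1 e₂ h2 h4
            exact ⟨h10, by rwa [h5] at h3⟩
    · rw [htil, insertSeq, Function.update_self,
        insertSeq_congr (h' := h) fun k _ hk => Function.update_of_ne (by omega) _ _, hseq]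

theorem Valid.exists_DTR_eq (h : Valid lam.semilength (height lam) v c) :
    ∃ T : NaturalLabel lam, DTR T = tilingOf (height lam) v c := by
  have hlow : ∀ x, height lam (stepCount (Set.univ : Set (Edge lam)) x) =
      partialHeight (Set.univ : Set (Edge lam)) x := by
    intro x
    rcases le_total x (2 * lam.semilength) with hx | hx
    · rw [(stepCount_univ hx).1, (stepCount_univ hx).2]
    · have h1 : ∀ e : Edge lam, e.up < x ∧ e.down < x := fun e => by
        have := e.down_lt
        have := e.up_lt_down
        omega
      have h2 : stepCount (Set.univ : Set (Edge lam)) x = 2 * lam.semilength := by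
        have h3 := ncard_univ_edge (lam := lam)
        rw [Set.ncard_univ] at h3
        simp [stepCount, h1, h3, two_mul]
      rw [h2, (isPath_height lam).tail _ le_rfl]
      simp [partialHeight, h1]
  obtain ⟨l, hist, hl, hseq⟩ :=
    exists_isPartialLabel (fun _ _ _ _ => Set.mem_univ _) ncard_univ_edge h hlow
  refine ⟨⟨l, hl.bijOn, fun e e' => hl.increasing e (Set.mem_univ e) e' (Set.mem_univ e')⟩, ?_⟩
  rw [DTR, NaturalLabel.ribbonTiling_eq_insertSeq, ← hseq]
  refine insertSeq_congr fun k h1 h2 => ?_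
  obtain ⟨e, -, rfl⟩ := hl.bijOn.surjOn ⟨h1, h2⟩
  refine (NaturalLabel.insertionHistory_eq _ e).trans ?_
  rw [hl.history e (Set.mem_univ e)]
  simp

/-- Since `phi0` after `DTab` is `DTR`, everything is transferred from the bijectivity of the ribbon
map. -/
theorem bijOn_phi0 : Set.BijOn (DyckTableau.phi0 : DyckTableau lam → Tiling)
    (Set.range (DTab : NaturalLabel lam → DyckTableau lam)) (coverInclusiveTilings lam) := by
  refine ⟨?_, ?_, ?_⟩
  · rintro _ ⟨T, rfl⟩
    rw [phi0_DTab, T.DTR_eq.2]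
    exact T.DTR_eq.1.mem_coverInclusiveTilings
  · rintro _ ⟨T, rfl⟩ _ ⟨T', rfl⟩ h
    rw [phi0_DTab, phi0_DTab] at h
    rw [NaturalLabel.DTR_injective h]
  · intro D hD
    obtain ⟨v, c, hv, rfl⟩ := exists_valid hD
    obtain ⟨T, hT⟩ := hv.exists_DTR_eq
    exact ⟨DTab T, ⟨T, rfl⟩, by rw [phi0_DTab, hT]⟩

end Bijection

end DyckTableaux

theorem mainTheorem4 (lam : DyckWord) :
    Function.Injective
        (DyckTableaux.DTab : DyckTableaux.NaturalLabel lam → DyckTableaux.DyckTableau lam) ∧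
      Set.BijOn (DyckTableaux.DyckTableau.phi0 : DyckTableaux.DyckTableau lam → DyckTableaux.Tiling)
        (Set.range (DyckTableaux.DTab : DyckTableaux.NaturalLabel lam → DyckTableaux.DyckTableau lam))
        (DyckTableaux.coverInclusiveTilings lam) ∧
      ∀ T : DyckTableaux.NaturalLabel lam,
        DyckTableaux.DyckTableau.phi0 (DyckTableaux.DTab T) = DyckTableaux.DTR T :=
  ⟨DyckTableaux.NaturalLabel.DTab_injective, DyckTableaux.bijOn_phi0, DyckTableaux.phi0_DTab⟩
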